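/- Definitions. A \emph{scalable group} $(G,\delta)$ is a topological group $G$ with a continuous map $\delta:\mathbb R\times G\to G$, $(t,g)\mapsto\delta_t(g)$, such that $\delta_t$ is an automorphism of the topological group $G$ for $t\neq 0$, $\delta_s\circ\delta_t=\delta_{st}$ for all $s,t\in\mathbb R$, and $\delta_0\equiv e_G$. It is a \emph{metric scalable group} if it carries a left-invariant distance $d$ inducing its topology with $d(\delta_t(p),\delta_t(q))=|t|\,d(p,q)$ for all $t\in\mathbb R$, $p,q\in G$. A \emph{Carnot group} is a simply connected (finite-dimensional) Lie group whose Lie algebra has a stratification $V_1\oplus\dots\oplus V_s$ (so $[V_1,V_k]=V_{k+1}$ for $1\le k<s$ and $[V_1,V_s]=0$), with the dilations whose differentials at the identity are multiplication by $t^k$ on $V_k$ ($t\ne0$). A \emph{Carnot subgroup} of $(G,\delta)$ is a closed subgroup $N$ with $\delta_t(N)=N$ for all $t\neq0$ that, with the subspace topology and the restrictions of the $\delta_t$, is a Carnot group. A \emph{filtration} of $G$ by Carnot subgroups is a sequence $N_1\le N_2\le\cdots$ of Carnot subgroups whose union is dense in $G$. An \emph{infinite-dimensional Carnot group} is a complete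 metric scalable group that admits such a filtration. Let $G$ be an infinite-dimensional Carnot group and let $V_1(G)$ be the set of $p\in G$ such that $t\mapsto\delta_t(p)$ is a continuous homomorphism $\mathbb R\to G$. A \emph{Carnot-spanning set} is a sequence $\mathcal X=(X_1,X_2,\dots)$ in $V_1(G)$ such that the subgroups $H_k:=\overline{\langle \delta_t(X_i): 1\le i\le k,\ t\in\mathbb R\rangle}$ form a filtration of $G$ by Carnot subgroups. For $Y\in V_1(G)$ let $\mathcal A(Y)$ be the class of Borel sets $E\subseteq G$ such that $\{t\in\mathbb R: g\,\delta_t(Y)\in E\}$ is Lebesgue null for every $g\in G$, and let $\mathcal A(\mathcal X)$ be the class of Borel sets of the form $E=\bigcup_{i\ge1}E_i$ with $E_i\in\mathcal A(X_i)$ for every $i$. Let $\operatorname{AC}(H_k)$ be the set of Borel probability measures on $H_k$ that are absolutely continuous with respect to Haar measure $\operatorname{vol}_{H_k}$; such measures are also viewed as measures on $G$. The identity $e_G$ is a \emph{density point} of a Borel set $U\subseteq H_k$ if $\operatorname{vol}_{H_k}(U\cap B(e_G,r))/\operatorname{vol}_{H_k}(B(e_G,r))\to1$ as $r\to0^+$,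 where $B(e_G,r)$ is the open $d$-ball in $H_k$. For Borel probability measures on $G$, $\mu*\nu$ is the image of $\mu\otimes\nu$ under $(x,y)\mapsto xy$; weak convergence is convergence of the integrals of all bounded continuous functions; and $x\nu$ is the image of $\nu$ under $y\mapsto xy$. Theorem. Let $\mathcal X$ be a Carnot-spanning set in an infinite-dimensional Carnot group $G$, with associated subgroups $H_k$. For $k\ge1$ and $\epsilon>0$ let $\nu_k^\epsilon\in\operatorname{AC}(H_k)$ be such that, for every $k$ and every Borel set $U\subseteq H_k$ of which $e_G$ is a density point, $\lim_{\epsilon\to0^+}\nu_k^\epsilon(U)=1$. Let $E\subseteq G$ be a Borel set with $E\notin\mathcal A(\mathcal X)$. Then there exist $x\in E$ and a sequence $(\epsilon_1,\epsilon_2,\dots)$ of positive numbers such that the sequence $\nu_n^{\epsilon_n}*\cdots*\nu_1^{\epsilon_1}$ converges weakly, as $n\to\infty$, to a probability measure $\nu$ on $G$ with $(x\nu)(E)>0$. -/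

import Mathlib

open MeasureTheory Filter Topology
open scoped Manifold ContDiff BoundedContinuousFunction

namespace CarnotNull

/-- `(G, δ)` is a scalable group: `δ : ℝ × G → G` is continuous, `δ_t` is an automorphism of the
topological group `G` for `t ≠ 0` (the inverse is `δ_{1/t}`, so bicontinuity is automatic),
`δ_s ∘ δ_t = δ_{st}` for all real `s, t`, and `δ_0` is constantly the identity. -/
structure IsScalableGroup {G : Type*} [Group G] [TopologicalSpace G] (δ : ℝ → G → G) : Prop where
  continuous_uncurry : Continuous fun p : ℝ × G => δ p.1 p.2
  map_mul : ∀ t : ℝ, t ≠ 0 → ∀ g h : G, δ t (g * h) = δ t g * δ t h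
  bijective : ∀ t : ℝ, t ≠ 0 → Function.Bijective (δ t)
  comp : ∀ (s t : ℝ) (g : G), δ s (δ t g) = δ (s * t) g
  zero : ∀ g : G, δ 0 g = 1

/-- `(G, δ, d)` is a metric scalable group, `d` being the distance of the metric space `G`
(which induces the topology of `G`). -/
structure IsMetricScalableGroup {G : Type*} [Group G] [MetricSpace G] (δ : ℝ → G → G) : Prop
    extends IsScalableGroup δ where
  dist_mul_left : ∀ a g h : G, dist (a * g) (a * h) = dist g h
  dist_dil : ∀ (t : ℝ) (g h : G), dist (δ t g) (δ t h) = |t| * dist g h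

/-- `V 1 ⊕ ⋯ ⊕ V s` is a stratification of the real Lie algebra `L`: it is a direct sum
decomposition, `[V 1, V k] = V (k + 1)` for `1 ≤ k < s` and `[V 1, V s] = 0`.  The layers are
indexed by `ℕ`, with `V 0 = 0` and `V k = 0` for `k > s`.  It is used below only for `L` the Lie
algebra of a Lie group; the definition refers to its vector space structure and its bracket. -/
structure IsStratification {L : Type*} [AddCommGroup L] [Module ℝ L] [Bracket L L]
    (s : ℕ) (V : ℕ → Submodule ℝ L) : Prop where
  isInternal : DirectSum.IsInternal V
  layer_zero : V 0 = ⊥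
  layer_gt : ∀ k, s < k → V k = ⊥
  bracket : ∀ k, 1 ≤ k →
    V (k + 1) = Submodule.span ℝ {z : L | ∃ x ∈ V 1, ∃ y ∈ V k, z = ⁅x, y⁆}

/-- The topological group `H` with the maps `δ_t` is a (finite-dimensional) Carnot group: `H` is a
simply connected Lie group, with its given topology, whose Lie algebra has a stratification
`V 1 ⊕ ⋯ ⊕ V s` such that, for every `t ≠ 0`, `δ_t` is the Lie group homomorphism whose
differential at the identity is multiplication by `t ^ k` on the layer `V k`. -/
def IsCarnotGroup (H : Type*) [Group H] [TopologicalSpace H] (δ : ℝ → H → H) : Prop :=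
  ∃ (n : ℕ) (_ : ChartedSpace (EuclideanSpace ℝ (Fin n)) H)
    (_ : LieGroup 𝓘(ℝ, EuclideanSpace ℝ (Fin n)) ∞ H),
    SimplyConnectedSpace H ∧
    ∃ (s : ℕ) (V : ℕ → Submodule ℝ (GroupLieAlgebra 𝓘(ℝ, EuclideanSpace ℝ (Fin n)) H)),
      IsStratification s V ∧
      ∀ t : ℝ, t ≠ 0 →
        (∀ g h : H, δ t (g * h) = δ t g * δ t h) ∧
        ContMDiff 𝓘(ℝ, EuclideanSpace ℝ (Fin n)) 𝓘(ℝ, EuclideanSpace ℝ (Fin n)) ∞ (δ t) ∧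
        ∀ k, ∀ v ∈ V k,
          mfderiv 𝓘(ℝ, EuclideanSpace ℝ (Fin n)) 𝓘(ℝ, EuclideanSpace ℝ (Fin n)) (δ t) 1 v
            = t ^ k • v

/-- `N` is a scalable subgroup of `(G, δ)`: a closed subgroup with `δ_t(N) = N` for `t ≠ 0`. -/
def IsScalableSubgroup {G : Type*} [Group G] [TopologicalSpace G] (δ : ℝ → G → G)
    (N : Subgroup G) : Prop :=
  IsClosed (N : Set G) ∧ ∀ t : ℝ, t ≠ 0 → δ t '' (N : Set G) = N

/-- `N` is a Carnot subgroup of `(G, δ)`: a scalable subgroup which, with the subspace topology and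
the restrictions of the dilations `δ_t`, is a Carnot group. -/
def IsCarnotSubgroup {G : Type*} [Group G] [TopologicalSpace G] (δ : ℝ → G → G)
    (N : Subgroup G) : Prop :=
  IsScalableSubgroup δ N ∧
    ∃ δN : ℝ → N → N, (∀ (t : ℝ) (g : N), (δN t g : G) = δ t g) ∧ IsCarnotGroup N δN

/-- `N 0 ≤ N 1 ≤ ⋯` is a filtration of `(G, δ)` by Carnot subgroups. -/
structure IsCarnotFiltration {G : Type*} [Group G] [TopologicalSpace G] (δ : ℝ → G → G)
    (N : ℕ → Subgroup G) : Prop where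
  isCarnotSubgroup : ∀ m, IsCarnotSubgroup δ (N m)
  le_succ : ∀ m, N m ≤ N (m + 1)
  dense : closure (⋃ m, (N m : Set G)) = Set.univ

/-- An infinite-dimensional Carnot group: a complete metric scalable group that admits a filtration
by Carnot subgroups. -/
structure IsInfDimCarnotGroup {G : Type*} [Group G] [MetricSpace G] (δ : ℝ → G → G) : Prop
    extends IsMetricScalableGroup δ where
  complete : CompleteSpace G
  exists_filtration : ∃ N : ℕ → Subgroup G, IsCarnotFiltration δ N

/-- The first layer `V₁(G)`: the points `p` such that `t ↦ δ_t(p)` is a one-parameter subgroup. -/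
def firstLayer {G : Type*} [Group G] [TopologicalSpace G] (δ : ℝ → G → G) : Set G :=
  {p : G | (Continuous fun t : ℝ => δ t p) ∧ ∀ s t : ℝ, δ (s + t) p = δ s p * δ t p}

/-- The scalable group generated by `A`: the closure of the group generated by all `δ_t(a)`,
`a ∈ A`, `t ∈ ℝ`. -/
def scalableSpan {G : Type*} [Group G] [TopologicalSpace G] [IsTopologicalGroup G]
    (δ : ℝ → G → G) (A : Set G) : Subgroup G :=
  (Subgroup.closure {g : G | ∃ a ∈ A, ∃ t : ℝ, g = δ t a}).topologicalClosure

/-- The filtration associated to `X`; with indices starting from `0`, `assocFiltration δ X k` is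
generated by `X 0, …, X k`. -/
def assocFiltration {G : Type*} [Group G] [TopologicalSpace G] [IsTopologicalGroup G]
    (δ : ℝ → G → G) (X : ℕ → G) (k : ℕ) : Subgroup G :=
  scalableSpan δ {g : G | ∃ i ≤ k, g = X i}

/-- `X` is a Carnot-spanning set: a sequence in the first layer whose associated subgroups form a
filtration by (finite-dimensional) Carnot subgroups. -/
def IsCarnotSpanning {G : Type*} [Group G] [TopologicalSpace G] [IsTopologicalGroup G]
    (δ : ℝ → G → G) (X : ℕ → G) : Prop :=
  (∀ i, X i ∈ firstLayer δ) ∧ IsCarnotFiltration δ (assocFiltration δ X)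

/-- The class `𝒜(Y)` of Borel sets that are Lebesgue null along all translates of `t ↦ δ_t(Y)`. -/
def nullAlong {G : Type*} [Group G] [MeasurableSpace G] (δ : ℝ → G → G) (Y : G) : Set (Set G) :=
  {E : Set G | MeasurableSet E ∧ ∀ g : G, volume {t : ℝ | g * δ t Y ∈ E} = 0}

/-- The class `𝒜(X)` of Borel sets `E = ⋃ i, E_i` with `E_i ∈ 𝒜(X i)` for all `i`. -/
def aronszajnClass {G : Type*} [Group G] [MeasurableSpace G] (δ : ℝ → G → G) (X : ℕ → G) :
    Set (Set G) :=
  {E : Set G | MeasurableSet E ∧ ∃ F : ℕ → Set G, E = ⋃ i, F i ∧ ∀ i, F i ∈ nullAlong δ (X i)}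

/-- `AC(H)`: the probability measures on `H` that are absolutely continuous with respect to Haar
measure. -/
def IsAC {H : Type*} [Group H] [TopologicalSpace H] [MeasurableSpace H] (μ : Measure H) : Prop :=
  IsProbabilityMeasure μ ∧ ∃ vol : Measure H, vol.IsHaarMeasure ∧ μ ≪ vol

/-- The identity is a density point of `U ⊆ H`, with respect to Haar measure. -/
def IsDensityPointOne {H : Type*} [Group H] [MetricSpace H] [MeasurableSpace H] (U : Set H) :
    Prop :=
  ∃ vol : Measure H, vol.IsHaarMeasure ∧
    Tendsto (fun r : ℝ => vol (U ∩ Metric.ball 1 r) / vol (Metric.ball 1 r)) (𝓝[>] 0) (𝓝 1)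

/-- The family `ν ε`, `ε > 0`, concentrates at the identity as `ε → 0`: if the identity is a
density point of the Borel set `U`, then `ν ε U → 1`. -/
def ConcentratesAtOne {H : Type*} [Group H] [MetricSpace H] [MeasurableSpace H]
    (ν : ℝ → Measure H) : Prop :=
  ∀ U : Set H, MeasurableSet U → IsDensityPointOne U →
    Tendsto (fun ε : ℝ => ν ε U) (𝓝[>] 0) (𝓝 1)

/-- A measure on a subgroup, viewed as a measure on `G`. -/
noncomputable def toAmbient {G : Type*} [Group G] [MeasurableSpace G] {N : Subgroup G}
    (μ : Measure N) : Measure G :=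
  μ.map (fun g : N => (g : G))

/-- The iterated convolution `μ n ∗ ⋯ ∗ μ 1 ∗ μ 0`. -/
noncomputable def iterConv {G : Type*} [Group G] [MeasurableSpace G] (μ : ℕ → Measure G) :
    ℕ → Measure G
  | 0 => μ 0
  | n + 1 => (μ (n + 1)).mconv (iterConv μ n)

/-- Weak convergence of a sequence of probability measures to a probability measure. -/
def WeaklyConverges {G : Type*} [TopologicalSpace G] [MeasurableSpace G]
    (μ : ℕ → Measure G) (μ' : Measure G) : Prop :=
  (∀ n, IsProbabilityMeasure (μ n)) ∧ IsProbabilityMeasure μ' ∧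
    ∀ φ : G →ᵇ ℝ, Tendsto (fun n => ∫ g, φ g ∂(μ n)) atTop (𝓝 (∫ g, φ g ∂μ'))

end CarnotNull

/-! The class 𝒜(X) is a σ-ideal, and the theorem follows from a null-set criterion for it, a density
statement, and a descent along a countable tree of choices.

Null sets. A Borel set Z that is Haar null on every coset of some H_k lies in 𝒜(X)
(`mem_aronszajnClass_of_haar_null`). If it did not, Lebesgue's density theorem along the curves t ↦
g δ_t(X_i), used for one letter at a time, would give, for any prescribed word map w (a product of
one-parameter subgroups δ_t(X_i)), a point x such that at all small scales ρ most points t of a cube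
satisfy x w(ρt) ∈ Z (`exists_le_volume_wordMap`). But some word map with letters i ≤ k is a
submersion at some point, so it pulls Haar null sets back to Lebesgue null sets on an open set;
since w(ρt) = δ_ρ(w(t)) and dilations preserve Haar null sets, this is a contradiction. The
submersion is an infinitesimal Chow theorem: a word of maximal rank has full rank
(`exists_range_wordDiff_eq_top`), provided the velocities of the letters span the first layer, and
they do because the letters generate a dense subgroup (`layer_one_le_span`).

Density. Dilations make Haar measure on H_k doubling. Hence the points x of a Borel set A at which e
is not a density point of x⁻¹A ∩ H_k form a set that is Haar null on each coset, so a member of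
𝒜(X). At every other x ∈ A, ν_k^ε(x⁻¹A) → 1 as ε → 0.

Descent. Let μ be a finite convolution and B a Borel set. If x is a density point of {y : μ(y⁻¹B) >
a} and b < a, then (ν_k^ε ∗ μ)(x⁻¹B) > b for small ε; this is why new factors enter on the left.
Restricting ε to the values 1/(j+1) leaves countably many finite sequences of choices, so one x ∈ E
avoids all exceptional sets at once. From this x the ε_k are chosen one by one, also so small that
the random products converge almost surely, which gives the weak limit ν. Weak limits control only
closed sets, so along the way E is cut down by a scheme of Borel sets, taken from a finer Polish
topology in which E is closed: the closures along a branch then shrink into E, and x⁻¹E keeps ν-mass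
at least 1/2 (`exists_weaklyConverges_pos`). -/

namespace CarnotNull

/-! ### Group operations read in one chart at the identity -/

section Coordinates

variable {H E : Type*} [Group H] [TopologicalSpace H] [NormedAddCommGroup E] [NormedSpace ℝ E]

/-- The group multiplication read in a chart. -/
def localMul (c : OpenPartialHomeomorph H E) (p : E × E) : E := c (c.symm p.1 * c.symm p.2)

/-- A group conjugation read in a chart. -/
def localConj (c : OpenPartialHomeomorph H E) (g : H) (y : E) : E := c (g * c.symm y * g⁻¹)

/-- The differential at the origin of the left translations, read in a chart. -/
noncomputable def leftDiff (c : OpenPartialHomeomorph H E) (x : E) : E →L[ℝ] E :=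
  fderiv ℝ (fun y => localMul c (x, y)) 0

/-- The second differential of the multiplication, in the mixed directions. -/
noncomputable def mixedDiff (c : OpenPartialHomeomorph H E) : E →L[ℝ] E →L[ℝ] E :=
  fderiv ℝ (leftDiff c) 0

/-- The Lie bracket of the local group law read in a chart. -/
noncomputable def localBracket (c : OpenPartialHomeomorph H E) (v w : E) : E :=
  mixedDiff c v w - mixedDiff c w v

/-- `c` is a chart at the identity in which the group operations are smooth. -/
structure IsSmoothCoordinate (c : OpenPartialHomeomorph H E) : Prop where
  one_mem : (1 : H) ∈ c.source
  map_one : c 1 = 0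
  contDiffAt_mul : ContDiffAt ℝ ∞ (localMul c) 0
  contDiffAt_conj_joint :
    ContDiffAt ℝ ∞ (fun p : E × E => localConj c (c.symm p.1) p.2) 0
  contDiffAt_conj : ∀ g, ContDiffAt ℝ ∞ (localConj c g) 0

end Coordinates

namespace IsSmoothCoordinate

variable {H E : Type*} [Group H] [TopologicalSpace H] [NormedAddCommGroup E] [NormedSpace ℝ E]
  {c : OpenPartialHomeomorph H E} (hc : IsSmoothCoordinate c)

include hc

lemma zero_mem : (0 : E) ∈ c.target := hc.map_one ▸ c.map_source hc.one_mem

lemma symm_zero : c.symm 0 = 1 := by rw [← hc.map_one, c.left_inv hc.one_mem]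

lemma eventually_right_inv : ∀ᶠ y in 𝓝 (0 : E), c (c.symm y) = y :=
  c.eventually_right_inverse hc.zero_mem

lemma localMul_zero_left : ∀ᶠ y in 𝓝 (0 : E), localMul c (0, y) = y := by
  filter_upwards [hc.eventually_right_inv] with y hy
  simp [localMul, hc.symm_zero, hy]

lemma localMul_zero_right : ∀ᶠ y in 𝓝 (0 : E), localMul c (y, 0) = y := by
  filter_upwards [hc.eventually_right_inv] with y hy
  simp [localMul, hc.symm_zero, hy]

lemma leftDiff_zero : leftDiff c 0 = ContinuousLinearMap.id ℝ E := by
  rw [leftDiff, Filter.EventuallyEq.fderiv_eq hc.localMul_zero_left, fderiv_fun_id]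

lemma contDiffAt_leftDiff : ContDiffAt ℝ ∞ (leftDiff c) 0 :=
  ContDiffAt.fderiv (f := fun x y => localMul c (x, y)) (g := fun _ => 0)
    hc.contDiffAt_mul contDiffAt_const (by simp)

end IsSmoothCoordinate

/-! ### From the Lie group structure to a chart: dilations and bracket -/

section LieGroupChart

variable {H E : Type*} [Group H] [TopologicalSpace H] [NormedAddCommGroup E] [NormedSpace ℝ E]
  [ChartedSpace E H]

/-- The preferred chart at the identity, translated so that the identity is sent to the origin. -/
noncomputable def originChart (H E : Type*) [Group H] [TopologicalSpace H] [NormedAddCommGroup E]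
    [NormedSpace ℝ E] [ChartedSpace E H] : OpenPartialHomeomorph H E :=
  (chartAt E (1 : H)).transHomeomorph (Homeomorph.addRight (-(chartAt E (1 : H) 1)))

lemma originChart_apply (g : H) :
    originChart H E g = chartAt E (1 : H) g - chartAt E (1 : H) 1 := by
  simp [originChart, sub_eq_add_neg]

lemma originChart_symm_apply (y : E) :
    (originChart H E).symm y = (chartAt E (1 : H)).symm (y + chartAt E (1 : H) 1) := by
  change (chartAt E (1 : H)).symm (y + -(-(chartAt E (1 : H) 1))) = _
  rw [neg_neg]

lemma one_mem_originChart_source : (1 : H) ∈ (originChart H E).source := by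
  simp [originChart]

lemma originChart_one : originChart H E (1 : H) = 0 := by simp [originChart_apply]

lemma originChart_symm_zero : (originChart H E).symm 0 = (1 : H) := by
  rw [← originChart_one (H := H)]
  exact (originChart H E).left_inv one_mem_originChart_source

lemma mfderiv_eq_fderiv_originChart {f : H → H} (hf : MDifferentiableAt 𝓘(ℝ, E) 𝓘(ℝ, E) f 1)
    (h1 : f 1 = 1) (v : E) :
    (mfderiv 𝓘(ℝ, E) 𝓘(ℝ, E) f 1 v : E)
      = fderiv ℝ (fun y => originChart H E (f ((originChart H E).symm y))) 0 v := by
  have key : (fun y => originChart H E (f ((originChart H E).symm y)))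
      = fun y => (fun z => chartAt E (1 : H) (f ((chartAt E (1 : H)).symm z))
          - chartAt E (1 : H) 1) (y + chartAt E (1 : H) 1) := by
    funext y; rw [originChart_apply, originChart_symm_apply]
  have hD : fderiv ℝ (fun y => originChart H E (f ((originChart H E).symm y))) 0
      = fderiv ℝ (fun z => chartAt E (1 : H) (f ((chartAt E (1 : H)).symm z)))
        (chartAt E (1 : H) 1) := by
    rw [key, fderiv_comp_add_right
      (f := fun z => chartAt E (1 : H) (f ((chartAt E (1 : H)).symm z)) - chartAt E (1 : H) 1),
      fderiv_sub_const, zero_add]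
  have h0 : mfderiv 𝓘(ℝ, E) 𝓘(ℝ, E) f 1
      = fderivWithin ℝ (writtenInExtChartAt 𝓘(ℝ, E) 𝓘(ℝ, E) 1 f) (Set.range 𝓘(ℝ, E))
          (extChartAt 𝓘(ℝ, E) (1 : H) 1) := hf.mfderiv
  have h2 : Set.range 𝓘(ℝ, E) = Set.univ := by simp
  have h3 : writtenInExtChartAt 𝓘(ℝ, E) 𝓘(ℝ, E) 1 f
      = fun z => chartAt E (1 : H) (f ((chartAt E (1 : H)).symm z)) := by
    funext z
    simp [writtenInExtChartAt, h1, extChartAt]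
  rw [h2, fderivWithin_univ, h3] at h0
  rw [hD]
  exact congrArg (fun T => T v) h0

lemma zero_mem_originChart_target : (0 : E) ∈ (originChart H E).target := by
  rw [← originChart_one (H := H)]
  exact (originChart H E).map_source one_mem_originChart_source

variable [LieGroup 𝓘(ℝ, E) ∞ H]

lemma contMDiffAt_originChart {g : H} (hg : g ∈ (originChart H E).source) :
    ContMDiffAt 𝓘(ℝ, E) 𝓘(ℝ, E) ∞ (originChart H E) g := by
  have : (originChart H E : H → E) = fun g => chartAt E (1 : H) g - chartAt E (1 : H) 1 := by
    funext g; exact originChart_apply g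
  rw [this]
  have h : ContMDiffAt 𝓘(ℝ, E) 𝓘(ℝ, E) ∞ (chartAt E (1 : H)) g :=
    contMDiffAt_extChartAt' (I := 𝓘(ℝ, E)) (x := (1 : H)) hg
  exact h.sub contMDiffAt_const

lemma contMDiffAt_originChart_symm {y : E} (hy : y ∈ (originChart H E).target) :
    ContMDiffAt 𝓘(ℝ, E) 𝓘(ℝ, E) ∞ (originChart H E).symm y := by
  have : ((originChart H E).symm : E → H)
      = (chartAt E (1 : H)).symm ∘ fun y => y + chartAt E (1 : H) 1 := by
    funext y; exact originChart_symm_apply y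
  rw [this]
  have h : ContMDiffAt 𝓘(ℝ, E) 𝓘(ℝ, E) ∞ (chartAt E (1 : H)).symm (y + chartAt E (1 : H) 1) := by
    have hm : y + chartAt E (1 : H) 1 ∈ (chartAt E (1 : H)).target := by
      have h : y + -(-(chartAt E (1 : H) 1)) ∈ (chartAt E (1 : H)).target := hy
      rwa [neg_neg] at h
    exact (contMDiffOn_chart_symm (I := 𝓘(ℝ, E)) (x := (1 : H))).contMDiffAt
      ((chartAt E (1 : H)).open_target.mem_nhds hm)
  exact h.comp y (contMDiffAt_id.add contMDiffAt_const)

lemma contDiffAt_originChart_comp {F : Type*} [NormedAddCommGroup F] [NormedSpace ℝ F]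
    {f : F → H} {x : F} (hf : ContMDiffAt 𝓘(ℝ, F) 𝓘(ℝ, E) ∞ f x)
    (hx : f x ∈ (originChart H E).source) :
    ContDiffAt ℝ ∞ (fun y => originChart H E (f y)) x :=
  ((contMDiffAt_originChart hx).comp x hf).contDiffAt

lemma isSmoothCoordinate_originChart : IsSmoothCoordinate (originChart H E) := by
  have h0 := contMDiffAt_originChart_symm (zero_mem_originChart_target (H := H) (E := E))
  have hfst : ContMDiffAt 𝓘(ℝ, E × E) 𝓘(ℝ, E) ∞
      (fun p : E × E => (originChart H E).symm p.1) 0 :=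
    ContMDiffAt.comp (0 : E × E) h0 contDiff_fst.contMDiff.contMDiffAt
  have hsnd : ContMDiffAt 𝓘(ℝ, E × E) 𝓘(ℝ, E) ∞
      (fun p : E × E => (originChart H E).symm p.2) 0 :=
    ContMDiffAt.comp (0 : E × E) h0 contDiff_snd.contMDiff.contMDiffAt
  refine ⟨one_mem_originChart_source, originChart_one, ?_, ?_, fun g => ?_⟩
  · refine contDiffAt_originChart_comp (hfst.mul hsnd) ?_
    simp [originChart_symm_zero, one_mem_originChart_source]
  · refine contDiffAt_originChart_comp ((hfst.mul hsnd).mul hfst.inv) ?_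
    simp [originChart_symm_zero, one_mem_originChart_source]
  · refine contDiffAt_originChart_comp ((contMDiffAt_const.mul h0).mul contMDiffAt_const) ?_
    simp [originChart_symm_zero, one_mem_originChart_source]

/-- The left-invariant field at `g` is the differential of the translation by `g`, applied to `v`.
Pulling back by the inverse chart applies the differential of the chart, so the chain rule gives the
differential of the translation read in the chart. -/
lemma mpullback_mulInvariantVectorField_eq_leftDiff {y : E}
    (hy : y ∈ (chartAt E (1 : H)).target) (v : E) :
    VectorField.mpullbackWithin 𝓘(ℝ, E) 𝓘(ℝ, E) (extChartAt 𝓘(ℝ, E) (1 : H)).symm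
      (mulInvariantVectorField (I := 𝓘(ℝ, E)) (G := H) v) (Set.range 𝓘(ℝ, E)) y
      = leftDiff (originChart H E) (y - chartAt E (1 : H) 1) v := by
  have hy' : y ∈ (extChartAt 𝓘(ℝ, E) (1 : H)).target := by simpa [extChartAt] using hy
  have : IsManifold 𝓘(ℝ, E) 1 H := IsManifold.of_le (n := ∞) (by simp)
  set g : H := (extChartAt 𝓘(ℝ, E) (1 : H)).symm y with hg
  have hgs : g ∈ (chartAt E (1 : H)).source := (chartAt E (1 : H)).map_target hy
  have hinv := ContinuousLinearMap.inverse_eq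
    (mfderivWithin_extChartAt_symm_comp_mfderiv_extChartAt (I := 𝓘(ℝ, E)) hy')
    (mfderiv_extChartAt_comp_mfderivWithin_extChartAt_symm (I := 𝓘(ℝ, E)) hy')
  rw [VectorField.mpullbackWithin_apply, hinv]
  change mfderiv 𝓘(ℝ, E) 𝓘(ℝ, E) (extChartAt 𝓘(ℝ, E) (1 : H)) g
    (mfderiv 𝓘(ℝ, E) 𝓘(ℝ, E) (fun b : H => g * b) 1 v) = _
  have hmul : MDifferentiableAt 𝓘(ℝ, E) 𝓘(ℝ, E) (fun b : H => g * b) 1 :=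
    (contMDiff_mul_left (I := 𝓘(ℝ, E)) (n := ∞)).contMDiffAt.mdifferentiableAt (by simp)
  have hchart : MDifferentiableAt 𝓘(ℝ, E) 𝓘(ℝ, E) (extChartAt 𝓘(ℝ, E) (1 : H)) (g * 1) := by
    rw [mul_one]
    exact (contMDiffAt_extChartAt' (I := 𝓘(ℝ, E)) (n := 1) hgs).mdifferentiableAt (by simp)
  have hcomp := mfderiv_comp (I := 𝓘(ℝ, E)) (I' := 𝓘(ℝ, E)) (I'' := 𝓘(ℝ, E)) (1 : H) hchart hmul
  have happ := congrArg (fun T => T v) hcomp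
  have hmd := hchart.comp (1 : H) hmul
  have e1 : (mfderiv 𝓘(ℝ, E) 𝓘(ℝ, E) (extChartAt 𝓘(ℝ, E) (1 : H) ∘ fun b : H => g * b) 1)
      = fderivWithin ℝ (writtenInExtChartAt 𝓘(ℝ, E) 𝓘(ℝ, E) 1
          (extChartAt 𝓘(ℝ, E) (1 : H) ∘ fun b : H => g * b)) (Set.range 𝓘(ℝ, E))
          (extChartAt 𝓘(ℝ, E) (1 : H) 1) := hmd.mfderiv
  have h2 : Set.range 𝓘(ℝ, E) = Set.univ := by simp
  have e2 : writtenInExtChartAt 𝓘(ℝ, E) 𝓘(ℝ, E) 1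
          (extChartAt 𝓘(ℝ, E) (1 : H) ∘ fun b : H => g * b)
      = fun z => chartAt E (1 : H) (g * (chartAt E (1 : H)).symm z) := by
    funext z
    simp [writtenInExtChartAt, extChartAt, chartAt_self_eq]
  rw [h2, fderivWithin_univ, e2] at e1
  have e3 : leftDiff (originChart H E) (y - chartAt E (1 : H) 1)
      = fderiv ℝ (fun z => chartAt E (1 : H) (g * (chartAt E (1 : H)).symm z))
        (chartAt E (1 : H) 1) := by
    have key : (fun z => localMul (originChart H E) (y - chartAt E (1 : H) 1, z))
      = fun w => (fun z => chartAt E (1 : H) (g * (chartAt E (1 : H)).symm z)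
          - chartAt E (1 : H) 1) (w + chartAt E (1 : H) 1) := by
      funext w
      simp only [localMul]
      rw [originChart_apply, originChart_symm_apply, originChart_symm_apply, sub_add_cancel]
      rfl
    rw [leftDiff, key, fderiv_comp_add_right
      (f := fun z => chartAt E (1 : H) (g * (chartAt E (1 : H)).symm z) - chartAt E (1 : H) 1),
      fderiv_sub_const, zero_add]
  rw [e3]
  have e4 := congrArg (fun T => T v) e1
  refine Eq.trans ?_ e4
  refine Eq.trans ?_ happ.symm
  -- The chain rule produces the base point `g * 1`; tangent spaces depend on the base point, so it
  -- is generalized before substituting.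
  have : ∀ k : H, k = g → ∀ u : E, (mfderiv 𝓘(ℝ, E) 𝓘(ℝ, E) (extChartAt 𝓘(ℝ, E) (1 : H)) g) u
    = (mfderiv 𝓘(ℝ, E) 𝓘(ℝ, E) (extChartAt 𝓘(ℝ, E) (1 : H)) k) u := by
    rintro k rfl u; rfl
  exact this (g * 1) (mul_one g) _

lemma lieBracket_leftDiff (e v w : E) :
    VectorField.lieBracket ℝ (fun y => leftDiff (originChart H E) (y - e) v)
      (fun y => leftDiff (originChart H E) (y - e) w) e = localBracket (originChart H E) v w := by
  have hs := isSmoothCoordinate_originChart (H := H) (E := E)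
  have hder : ∀ u z : E, fderiv ℝ (fun y => leftDiff (originChart H E) (y - e) u) e z
      = mixedDiff (originChart H E) z u := fun u z => by
    have hd : DifferentiableAt ℝ (leftDiff (originChart H E)) 0 :=
      hs.contDiffAt_leftDiff.differentiableAt (by simp)
    have h1 : HasFDerivAt (fun y => leftDiff (originChart H E) (y - e))
        (mixedDiff (originChart H E)) e := by
      have h2 : HasFDerivAt (leftDiff (originChart H E)) (mixedDiff (originChart H E)) (e - e) := by
        rw [sub_self]; exact hd.hasFDerivAt
      exact HasFDerivAt.comp (f := fun y => y - e) e h2 ((hasFDerivAt_id e).sub_const e)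
    rw [(h1.clm_apply (hasFDerivAt_const u e)).fderiv]
    simp
  simp only [VectorField.lieBracket_eq]
  rw [hder, hder]
  simp only [sub_self, hs.leftDiff_zero]
  rfl

/-- In the chart the left-invariant fields are `leftDiff` applied to a fixed vector, so their
bracket at the origin is the antisymmetrized mixed second derivative of the product. The
differential of the chart at `1` is the identity, so no change of coordinates remains. -/
lemma bracket_eq_localBracket (v w : GroupLieAlgebra 𝓘(ℝ, E) H) :
    ⁅v, w⁆ = localBracket (originChart H E) v w := by
  have : IsManifold 𝓘(ℝ, E) 1 H := IsManifold.of_le (n := ∞) (by simp)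
  have hid : (mfderiv 𝓘(ℝ, E) 𝓘(ℝ, E) (extChartAt 𝓘(ℝ, E) (1 : H)) 1 : E →L[ℝ] E)
      = ContinuousLinearMap.id ℝ E := by
    have hd : MDifferentiableAt 𝓘(ℝ, E) 𝓘(ℝ, E) (extChartAt 𝓘(ℝ, E) (1 : H)) 1 :=
      (contMDiffAt_extChartAt (I := 𝓘(ℝ, E)) (n := 1)).mdifferentiableAt (by simp)
    refine hd.mfderiv.trans ?_
    have h2 : Set.range 𝓘(ℝ, E) = Set.univ := by simp
    rw [h2, fderivWithin_univ]
    have h3 : writtenInExtChartAt 𝓘(ℝ, E) 𝓘(ℝ, E) 1 (extChartAt 𝓘(ℝ, E) (1 : H))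
        =ᶠ[𝓝 (extChartAt 𝓘(ℝ, E) (1 : H) 1)] id := by
      filter_upwards [extChartAt_target_mem_nhds (I := 𝓘(ℝ, E)) (1 : H)] with y hy
      have : writtenInExtChartAt 𝓘(ℝ, E) 𝓘(ℝ, E) 1 (extChartAt 𝓘(ℝ, E) (1 : H)) y
        = extChartAt 𝓘(ℝ, E) (1 : H) ((extChartAt 𝓘(ℝ, E) (1 : H)).symm y) := by
        simp [writtenInExtChartAt, extChartAt, chartAt_self_eq]
      rw [this, (extChartAt 𝓘(ℝ, E) (1 : H)).right_inv hy]
      rfl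
    rw [h3.fderiv_eq, fderiv_id]
  set e : E := chartAt E (1 : H) 1 with he
  have hinv : (mfderiv 𝓘(ℝ, E) 𝓘(ℝ, E) (extChartAt 𝓘(ℝ, E) (1 : H)) 1 : E →L[ℝ] E).inverse
      = ContinuousLinearMap.id ℝ E := by
    exact (congrArg ContinuousLinearMap.inverse hid).trans ContinuousLinearMap.inverse_id
  have hV : ∀ u : E, VectorField.mpullbackWithin 𝓘(ℝ, E) 𝓘(ℝ, E) (extChartAt 𝓘(ℝ, E) (1 : H)).symm
      (mulInvariantVectorField (I := 𝓘(ℝ, E)) (G := H) u) (Set.range 𝓘(ℝ, E))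
      =ᶠ[𝓝 e] fun y => leftDiff (originChart H E) (y - e) u := fun u => by
    filter_upwards [(chartAt E (1 : H)).open_target.mem_nhds
      ((chartAt E (1 : H)).map_source (mem_chart_source E (1 : H)))] with y hy
    exact mpullback_mulInvariantVectorField_eq_leftDiff hy u
  have hbr := VectorField.mlieBracketWithin_apply (I := 𝓘(ℝ, E))
    (V := mulInvariantVectorField v) (W := mulInvariantVectorField w) (s := Set.univ)
    (x₀ := (1 : H))
  rw [GroupLieAlgebra.bracket_def, ← VectorField.mlieBracketWithin_univ]
  refine hbr.trans ?_
  have hset : ((extChartAt 𝓘(ℝ, E) (1 : H)).symm ⁻¹' Set.univ ∩ Set.range 𝓘(ℝ, E))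
      = Set.univ := by simp
  have hlie : VectorField.lieBracketWithin ℝ
      (VectorField.mpullbackWithin 𝓘(ℝ, E) 𝓘(ℝ, E) (extChartAt 𝓘(ℝ, E) (1 : H)).symm
        (mulInvariantVectorField (I := 𝓘(ℝ, E)) (G := H) v) (Set.range 𝓘(ℝ, E)))
      (VectorField.mpullbackWithin 𝓘(ℝ, E) 𝓘(ℝ, E) (extChartAt 𝓘(ℝ, E) (1 : H)).symm
        (mulInvariantVectorField (I := 𝓘(ℝ, E)) (G := H) w) (Set.range 𝓘(ℝ, E)))
      ((extChartAt 𝓘(ℝ, E) (1 : H)).symm ⁻¹' Set.univ ∩ Set.range 𝓘(ℝ, E)) e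
      = localBracket (originChart H E) v w := by
    rw [hset]
    refine (Filter.EventuallyEq.lieBracketWithin_vectorField_eq_nhds (hV v) (hV w)).trans ?_
    exact (congrFun (VectorField.lieBracketWithin_univ (𝕜 := ℝ)) e).trans (lieBracket_leftDiff e v w)
  exact (congrArg _ hlie).trans (congrArg (fun T : E →L[ℝ] E => T _) hinv)

end LieGroupChart

/-- `V` is a stratification for the bracket read in the chart `c`, and `δ_t` acts on `V k` as the
multiplication by `t ^ k`. -/
structure IsStratifiedChart {H E : Type*} [Group H] [TopologicalSpace H] [NormedAddCommGroup E]
    [NormedSpace ℝ E] (δ : ℝ → H → H) (c : OpenPartialHomeomorph H E) (V : ℕ → Submodule ℝ E) :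
    Prop extends IsSmoothCoordinate c where
  isInternal : DirectSum.IsInternal V
  layer_zero : V 0 = ⊥
  bracket : ∀ k, 1 ≤ k →
    V (k + 1) = Submodule.span ℝ {z : E | ∃ x ∈ V 1, ∃ y ∈ V k, z = localBracket c x y}
  contDiffAt_dil : ∀ t : ℝ, t ≠ 0 → ContDiffAt ℝ ∞ (fun y => c (δ t (c.symm y))) 0
  fderiv_dil : ∀ t : ℝ, t ≠ 0 → ∀ k, ∀ v ∈ V k,
    fderiv ℝ (fun y => c (δ t (c.symm y))) 0 v = t ^ k • v

/-- The rank and spanning arguments below use the Lie structure only through the data of this single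
chart. -/
theorem IsCarnotGroup.exists_isStratifiedChart {H : Type*} [Group H] [TopologicalSpace H]
    {δ : ℝ → H → H} (h : IsCarnotGroup H δ) :
    ∃ (n : ℕ) (c : OpenPartialHomeomorph H (EuclideanSpace ℝ (Fin n)))
      (V : ℕ → Submodule ℝ (EuclideanSpace ℝ (Fin n))), IsStratifiedChart δ c V := by
  obtain ⟨n, _, _, -, s, V, hV, hδ⟩ := h
  have hone : ∀ t : ℝ, t ≠ 0 → δ t 1 = 1 := fun t ht => by
    have := (hδ t ht).1 1 1
    rwa [mul_one, left_eq_mul] at this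
  refine ⟨n, originChart H _, V, { isSmoothCoordinate_originChart with
    isInternal := hV.isInternal
    layer_zero := hV.layer_zero
    bracket := fun k hk => ?_
    contDiffAt_dil := fun t ht => ?_
    fderiv_dil := fun t ht k v hv => ?_ }⟩
  · refine (hV.bracket k hk).trans ?_
    congr 1
    ext z
    refine exists_congr fun x => and_congr Iff.rfl (exists_congr fun y => and_congr Iff.rfl ?_)
    exact ⟨fun h => h.trans (bracket_eq_localBracket x y), fun h => h.trans (bracket_eq_localBracket x y).symm⟩
  · refine contDiffAt_originChart_comp (((hδ t ht).2.1 _).comp 0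
      (contMDiffAt_originChart_symm zero_mem_originChart_target)) ?_
    simp [originChart_symm_zero, hone t ht, one_mem_originChart_source]
  · refine (mfderiv_eq_fderiv_originChart ?_ (hone t ht) v).symm.trans ((hδ t ht).2.2 k v hv)
    exact ((hδ t ht).2.1 1).mdifferentiableAt (by simp)

end CarnotNull

namespace CarnotNull

/-! ### Continuous one-parameter subgroups are strictly differentiable at 0 -/

section Additive

variable {E : Type*} [NormedAddCommGroup E] [NormedSpace ℝ E]

/-- Near additivity turns an increment x(p + h) - x(p) into x(h), which is close to h • v by
differentiability at 0; the base point p thus disappears from the estimate. -/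
lemma HasStrictDerivAt.of_hasDerivAt_of_almost_additive {x : ℝ → E} {v : E}
    (hx : HasDerivAt x v 0) (h0 : x 0 = 0)
    (hadd : ∀ ε > 0, ∃ η > 0, ∀ s t : ℝ, |s| < η → |t| < η →
      ‖x (s + t) - x s - x t‖ ≤ ε * ‖x t‖) : HasStrictDerivAt x v 0 := by
  have hb : ∀ ε > 0, ∃ η > 0, ∀ h : ℝ, |h| < η → ‖x h - h • v‖ ≤ ε * |h| := by
    intro ε hε
    have := (hasDerivAt_iff_isLittleO_nhds_zero.1 hx).def hε
    simp only [zero_add, h0, sub_zero] at this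
    obtain ⟨η, hη, h⟩ := Metric.eventually_nhds_iff.1 this
    refine ⟨η, hη, fun t ht => ?_⟩
    simpa using h (by simpa using ht)
  rw [hasStrictDerivAt_iff_hasStrictFDerivAt, hasStrictFDerivAt_iff_isLittleO,
    Asymptotics.isLittleO_iff]
  intro ε hε
  obtain ⟨η₁, hη₁, h1⟩ := hb (ε / 2) (by positivity)
  -- The constant is chosen to turn the bound ‖x h‖ ≤ (‖v‖ + ε / 2) |h| into an error ε / 2 · |h|.
  obtain ⟨η₂, hη₂, h2⟩ := hadd (ε / 2 / (‖v‖ + ε / 2)) (by positivity)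
  have hnear : ∀ᶠ p : ℝ × ℝ in 𝓝 (0, 0), |p.2| < η₂ ∧ |p.1 - p.2| < min η₁ η₂ := by
    refine Filter.Eventually.and ?_ ?_
    · have : Tendsto (fun p : ℝ × ℝ => |p.2|) (𝓝 (0, 0)) (𝓝 0) := by
        have : Continuous fun p : ℝ × ℝ => |p.2| := by fun_prop
        simpa using this.tendsto (0, 0)
      exact this.eventually_lt_const hη₂
    · have : Tendsto (fun p : ℝ × ℝ => |p.1 - p.2|) (𝓝 (0, 0)) (𝓝 0) := by
        have : Continuous fun p : ℝ × ℝ => |p.1 - p.2| := by fun_prop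
        simpa using this.tendsto (0, 0)
      exact this.eventually_lt_const (lt_min hη₁ hη₂)
  filter_upwards [hnear] with p ⟨hp2, hp⟩
  set h := p.1 - p.2 with hh
  have e1 : p.1 = p.2 + h := by rw [hh]; ring
  have i1 := h1 h (hp.trans_le (min_le_left _ _))
  have i2 := h2 p.2 h hp2 (hp.trans_le (min_le_right _ _))
  have i3 : ‖x h‖ ≤ (‖v‖ + ε / 2) * |h| := by
    calc ‖x h‖ = ‖(x h - h • v) + h • v‖ := by rw [sub_add_cancel]
      _ ≤ ε / 2 * |h| + |h| * ‖v‖ := by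
        refine (norm_add_le _ _).trans (add_le_add i1 ?_)
        rw [norm_smul, Real.norm_eq_abs]
      _ = _ := by ring
  have i4 : ‖x (p.2 + h) - x p.2 - x h‖ ≤ ε / 2 * |h| := by
    refine i2.trans ?_
    calc ε / 2 / (‖v‖ + ε / 2) * ‖x h‖ ≤ ε / 2 / (‖v‖ + ε / 2) * ((‖v‖ + ε / 2) * |h|) := by
          gcongr
      _ = _ := by field_simp
  rw [e1]
  simp only [ContinuousLinearMap.toSpanSingleton_apply, Real.norm_eq_abs]
  calc ‖x (p.2 + h) - x p.2 - h • v‖ = ‖(x (p.2 + h) - x p.2 - x h) + (x h - h • v)‖ := by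
        congr 1; abel
    _ ≤ ε / 2 * |h| + ε / 2 * |h| := (norm_add_le _ _).trans (add_le_add i4 i1)
    _ = ε * |h| := by ring

/-- Integrals of a continuous curve are differentiable, and near additivity transfers this to the
curve: the average over t ∈ [0, a] of x(t + s) - x(t) is x(s) up to a relative error ε, while
divided by s it converges to a⁻¹ x(a). Hence the quotients x(s) / s are Cauchy. -/
lemma exists_hasDerivAt_of_almost_additive [CompleteSpace E] {x : ℝ → E}
    (hcont : ∀ᶠ t in 𝓝 (0 : ℝ), ContinuousAt x t) (h0 : x 0 = 0)
    (hadd : ∀ ε > 0, ∃ η > 0, ∀ s t : ℝ, |s| < η → |t| < η →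
      ‖x (s + t) - x s - x t‖ ≤ ε * ‖x t‖) : ∃ v, HasDerivAt x v 0 := by
  obtain ⟨κ, hκ, hc⟩ := Metric.eventually_nhds_iff.1 hcont
  have hc' : ∀ t : ℝ, |t| < κ → ContinuousAt x t := fun t ht => hc (by simpa using ht)
  -- averaging the additivity relation over `[0, a]`
  have key : ∀ ε > 0, ∃ z : E, ∃ G : ℝ → E, Tendsto G (𝓝[≠] 0) (𝓝 z) ∧
      ∀ᶠ s in 𝓝[≠] (0 : ℝ), ‖G s - s⁻¹ • x s‖ ≤ ε * ‖s⁻¹ • x s‖ := by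
    intro ε hε
    obtain ⟨η, hη, h⟩ := hadd ε hε
    set a := min κ η / 2 with ha
    have hm : 0 < min κ η := lt_min hκ hη
    have ha0 : 0 < a := by positivity
    have ha1 : a + a ≤ κ := by rw [ha]; linarith [min_le_left κ η]
    have ha2 : a < η := by rw [ha]; linarith [min_le_right κ η]
    have hcon : ContinuousOn x (Set.Ioo (-κ) κ) := fun t ht =>
      (hc' t (abs_lt.2 ht)).continuousWithinAt
    have hint : ∀ p q : ℝ, |p| < κ → |q| < κ → IntervalIntegrable x volume p q := by
      intro p q hp hq
      refine (hcon.mono fun t ht => ?_).intervalIntegrable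
      rw [abs_lt] at hp hq
      exact ⟨(lt_min hp.1 hq.1).trans_le ht.1, ht.2.trans_lt (max_lt hp.2 hq.2)⟩
    have hda : HasDerivAt (fun s => ∫ t in a..(a + s), x t) (x a) 0 := by
      have hd : HasDerivAt (fun u => ∫ t in a..u, x t) (x a) (a + 0) := by
        rw [add_zero]
        refine intervalIntegral.integral_hasDerivAt_right (by simp) ?_ (hc' a ?_)
        · refine ContinuousAt.stronglyMeasurableAtFilter isOpen_Ioo
            (s := Set.Ioo (-κ) κ) (fun t ht => hc' t (abs_lt.2 ht)) a ⟨by linarith, by linarith⟩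
        · rw [abs_of_pos ha0]; linarith
      exact HasDerivAt.comp_const_add (f := fun u => ∫ t in a..u, x t) a 0 hd
    have hd0 : HasDerivAt (fun s => ∫ t in (0 : ℝ)..s, x t) (x 0) 0 := by
      refine intervalIntegral.integral_hasDerivAt_right (by simp) ?_ (hc' 0 (by simpa using hκ))
      exact ContinuousAt.stronglyMeasurableAtFilter isOpen_Ioo
            (s := Set.Ioo (-κ) κ) (fun t ht => hc' t (abs_lt.2 ht)) 0 ⟨by linarith, by linarith⟩
    have hd := hda.sub hd0
    rw [h0, sub_zero] at hd
    refine ⟨a⁻¹ • x a,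
      fun s => a⁻¹ • s⁻¹ • ((∫ t in a..(a + s), x t) - ∫ t in (0 : ℝ)..s, x t), ?_, ?_⟩
    · have := hasDerivAt_iff_tendsto_slope_zero.1 hd
      refine Tendsto.const_smul (this.congr fun s => ?_) _
      simp
    · have hev : ∀ᶠ s in 𝓝[≠] (0 : ℝ), |s| < a := by
        refine nhdsWithin_le_nhds ?_
        have : Tendsto (fun s : ℝ => |s|) (𝓝 0) (𝓝 0) := by simpa using continuous_abs.tendsto (0:ℝ)
        exact this.eventually_lt_const ha0
      filter_upwards [hev, self_mem_nhdsWithin] with s hs hs0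
      have hs0 : s ≠ 0 := hs0
      have hsa := abs_lt.1 hs
      have hI : (∫ t in a..(a + s), x t) - (∫ t in (0 : ℝ)..s, x t)
          = (∫ t in (0 : ℝ)..a, (x (t + s) - x t)) := by
        rw [intervalIntegral.integral_sub]
        · rw [intervalIntegral.integral_comp_add_right, zero_add, sub_eq_sub_iff_add_eq_add,
            add_comm, intervalIntegral.integral_add_adjacent_intervals,
            add_comm (∫ t in s..(a + s), x t), intervalIntegral.integral_add_adjacent_intervals]
          · apply hint <;> rw [abs_lt] <;> constructor <;> linarith
          · apply hint <;> rw [abs_lt] <;> constructor <;> linarith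
          · apply hint <;> rw [abs_lt] <;> constructor <;> linarith
          · apply hint <;> rw [abs_lt] <;> constructor <;> linarith
        · have : IntervalIntegrable x volume (0 + s) (a + s) := by
            apply hint <;> rw [abs_lt] <;> constructor <;> linarith
          simpa using this.comp_add_right s
        · apply hint <;> rw [abs_lt] <;> constructor <;> linarith
      have hbound : ‖(∫ t in a..(a + s), x t) - (∫ t in (0 : ℝ)..s, x t) - a • x s‖
          ≤ ε * ‖x s‖ * a := by
        have h3 : a • x s = ∫ t in (0 : ℝ)..a, x s := by simp
        rw [hI, h3, ← intervalIntegral.integral_sub]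
        · refine (intervalIntegral.norm_integral_le_of_norm_le_const (C := ε * ‖x s‖)
            fun t ht => ?_).trans ?_
          · rw [Set.uIoc_of_le ha0.le] at ht
            refine h t s ?_ (hs.trans ha2)
            rw [abs_of_pos ht.1]; linarith [ht.2]
          · simp [abs_of_pos ha0]
        · refine IntervalIntegrable.sub ?_ ?_
          · have : IntervalIntegrable x volume (0 + s) (a + s) := by
              apply hint <;> rw [abs_lt] <;> constructor <;> linarith
            simpa using this.comp_add_right s
          · apply hint <;> rw [abs_lt] <;> constructor <;> linarith
        · simp
      have : a⁻¹ • s⁻¹ • ((∫ t in a..(a + s), x t) - ∫ t in (0 : ℝ)..s, x t) - s⁻¹ • x s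
          = (a⁻¹ * s⁻¹) • ((∫ t in a..(a + s), x t) - (∫ t in (0 : ℝ)..s, x t) - a • x s) := by
        rw [smul_sub _ _ (a • x s), mul_smul, smul_smul (a⁻¹ * s⁻¹) a]
        congr 2
        field_simp
      rw [this, norm_smul, norm_smul, norm_mul, norm_inv, Real.norm_of_nonneg ha0.le]
      calc a⁻¹ * ‖s⁻¹‖ * _ ≤ a⁻¹ * ‖s⁻¹‖ * (ε * ‖x s‖ * a) := by gcongr
        _ = _ := by field_simp
  -- Relative error 1/2 bounds the difference quotients; with this bound, a small relative error
  -- becomes a small absolute one.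
  obtain ⟨z₀, G₀, hG₀, hb₀⟩ := key (1 / 2) (by norm_num)
  obtain ⟨C, hC0, hC⟩ : ∃ C > 0, ∀ᶠ s in 𝓝[≠] (0 : ℝ), ‖s⁻¹ • x s‖ ≤ C := by
    refine ⟨2 * (‖z₀‖ + 1), by positivity, ?_⟩
    filter_upwards [hb₀, hG₀.norm.eventually_lt_const (lt_add_one ‖z₀‖)] with s h1 h2
    have := norm_sub_norm_le (s⁻¹ • x s) (G₀ s)
    rw [norm_sub_rev] at this
    linarith
  have hcau : Cauchy (map (fun s : ℝ => s⁻¹ • x s) (𝓝[≠] 0)) := by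
    rw [Metric.cauchy_iff]
    refine ⟨inferInstance, fun ε hε => ?_⟩
    obtain ⟨z, G, hG, hb⟩ := key (ε / 4 / C) (by positivity)
    refine ⟨Metric.ball z (ε / 2), ?_, fun p hp q hq => ?_⟩
    · have hGz := Metric.tendsto_nhds.1 hG (ε / 4) (by positivity)
      rw [mem_map]
      filter_upwards [hb, hC, hGz] with s h1 h2 h3
      have h4 : ‖G s - s⁻¹ • x s‖ ≤ ε / 4 := by
        refine h1.trans ?_
        calc ε / 4 / C * ‖s⁻¹ • x s‖ ≤ ε / 4 / C * C := by gcongr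
          _ = _ := by field_simp
      rw [Set.mem_preimage, Metric.mem_ball]
      calc dist (s⁻¹ • x s) z ≤ dist (s⁻¹ • x s) (G s) + dist (G s) z := dist_triangle _ _ _
        _ < ε / 4 + ε / 4 := by
          rw [dist_comm, dist_eq_norm]; exact add_lt_add_of_le_of_lt h4 h3
        _ = ε / 2 := by ring
    · have := dist_triangle_right p q z
      rw [Metric.mem_ball] at hp hq
      linarith
  obtain ⟨v, hv⟩ := cauchy_map_iff_exists_tendsto.1 hcau
  refine ⟨v, hasDerivAt_iff_tendsto_slope_zero.2 ?_⟩
  simpa [h0] using hv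

end Additive

namespace IsSmoothCoordinate

variable {H E : Type*} [Group H] [TopologicalSpace H] [NormedAddCommGroup E] [NormedSpace ℝ E]
  {c : OpenPartialHomeomorph H E} (hc : IsSmoothCoordinate c)

include hc

lemma hasStrictFDerivAt_localMul : HasStrictFDerivAt (localMul c)
    (ContinuousLinearMap.fst ℝ E E + ContinuousLinearMap.snd ℝ E E) 0 := by
  have h := hc.contDiffAt_mul.hasStrictFDerivAt (by simp)
  suffices e : ContinuousLinearMap.fst ℝ E E + ContinuousLinearMap.snd ℝ E E
      = fderiv ℝ (localMul c) 0 by rw [e]; exact h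
  have hd := h.hasFDerivAt
  have h1 : HasFDerivAt (fun y => localMul c (y, 0)) (ContinuousLinearMap.id ℝ E) 0 :=
    (hasFDerivAt_id _).congr_of_eventuallyEq hc.localMul_zero_right
  have h2 : HasFDerivAt (fun y => localMul c (0, y)) (ContinuousLinearMap.id ℝ E) 0 :=
    (hasFDerivAt_id _).congr_of_eventuallyEq hc.localMul_zero_left
  have h3 := h1.unique (HasFDerivAt.comp (f := fun y : E => (y, (0 : E))) 0 hd
    (hasFDerivAt_prodMk_left 0 0))
  have h4 := h2.unique (HasFDerivAt.comp (f := fun y : E => ((0 : E), y)) 0 hd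
    (hasFDerivAt_prodMk_right 0 0))
  ext p
  · simpa using DFunLike.congr_fun h3 p
  · simpa using DFunLike.congr_fun h4 p

lemma continuousAt_symm : ContinuousAt c.symm 0 := c.continuousAt_symm hc.zero_mem

lemma eventually_mem : ∀ᶠ g in 𝓝 (1 : H), g ∈ c.source :=
  c.open_source.mem_nhds hc.one_mem

/-- The product in the chart is strictly differentiable at the origin with derivative (u, w) ↦ u +
w. Comparing its values at (x_s, x_t) and (x_s, 0) bounds the additivity defect by ε ‖x_t‖. -/
lemma exists_hasStrictDerivAt [CompleteSpace E] {γ : ℝ → H} (hγ : Continuous γ)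
    (hadd : ∀ s t, γ (s + t) = γ s * γ t) : ∃ v, HasStrictDerivAt (fun t => c (γ t)) v 0 := by
  have hγ0 : γ 0 = 1 := by simpa using hadd 0 0
  have hx0 : c (γ 0) = 0 := by rw [hγ0, hc.map_one]
  have hmem : ∀ᶠ t in 𝓝 (0 : ℝ), γ t ∈ c.source := by
    have := hγ.tendsto 0
    rw [hγ0] at this
    exact this.eventually hc.eventually_mem
  have hcont : ∀ᶠ t in 𝓝 (0 : ℝ), ContinuousAt (fun t => c (γ t)) t := by
    filter_upwards [hmem] with t ht
    exact (c.continuousAt ht).comp hγ.continuousAt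
  have hlim : Tendsto (fun t => c (γ t)) (𝓝 0) (𝓝 0) := by
    have := hcont.self_of_nhds.tendsto
    rwa [hx0] at this
  have hmul : ∀ ε > 0, ∃ η > 0, ∀ s t : ℝ, |s| < η → |t| < η →
      ‖c (γ (s + t)) - c (γ s) - c (γ t)‖ ≤ ε * ‖c (γ t)‖ := by
    intro ε hε
    have hst := hc.hasStrictFDerivAt_localMul
    rw [hasStrictFDerivAt_iff_isLittleO, Asymptotics.isLittleO_iff] at hst
    have h1 := hst hε
    have ht : Tendsto (fun p : ℝ × ℝ => ((c (γ p.1), c (γ p.2)), (c (γ p.1), (0 : E))))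
        (𝓝 (0, 0)) (𝓝 (0, 0)) := by
      have h1 : Tendsto (fun p : ℝ × ℝ => c (γ p.1)) (𝓝 (0, 0)) (𝓝 0) :=
        hlim.comp (continuous_fst.tendsto (0, 0))
      have h2 : Tendsto (fun p : ℝ × ℝ => c (γ p.2)) (𝓝 (0, 0)) (𝓝 0) :=
        hlim.comp (continuous_snd.tendsto (0, 0))
      exact (h1.prodMk_nhds h2).prodMk_nhds (h1.prodMk_nhds tendsto_const_nhds)
    have h2 : ∀ᶠ p : ℝ × ℝ in 𝓝 (0, 0), γ p.1 ∈ c.source ∧ γ p.2 ∈ c.source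
        ∧ localMul c (c (γ p.1), 0) = c (γ p.1) :=
      ((continuous_fst.tendsto (0, 0)).eventually hmem).and
        (((continuous_snd.tendsto (0, 0)).eventually hmem).and
          ((hlim.comp (continuous_fst.tendsto (0, 0))).eventually hc.localMul_zero_right))
    obtain ⟨η, hη, h⟩ := Metric.eventually_nhds_iff.1 ((ht.eventually h1).and h2)
    refine ⟨η, hη, fun s t hs ht => ?_⟩
    obtain ⟨i1, i2, i3, i4⟩ := h (y := (s, t)) (by
      rw [Prod.dist_eq]; simpa using ⟨hs, ht⟩)
    simp only at i1 i2 i3 i4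
    rw [i4] at i1
    have e : localMul c (c (γ s), c (γ t)) = c (γ (s + t)) := by
      simp only [localMul]
      rw [c.left_inv i2, c.left_inv i3, hadd]
    rw [e] at i1
    simpa using i1
  obtain ⟨v, hv⟩ := exists_hasDerivAt_of_almost_additive hcont hx0 hmul
  exact ⟨v, HasStrictDerivAt.of_hasDerivAt_of_almost_additive hv hx0 hmul⟩

end IsSmoothCoordinate
end CarnotNull

namespace CarnotNull

lemma two_le_smooth : (2 : WithTop ℕ∞) ≤ ∞ :=
  ENat.LEInfty.out

/-! ### The adjoint representation and its differential -/

section Adjoint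

variable {H E : Type*} [Group H] [TopologicalSpace H] [NormedAddCommGroup E] [NormedSpace ℝ E]

/-- The adjoint representation, read in a chart. -/
noncomputable def adDiff (c : OpenPartialHomeomorph H E) (g : H) : E →L[ℝ] E :=
  fderiv ℝ (localConj c g) 0

/-- The differential at the origin of the right translations, read in a chart. -/
noncomputable def rightDiff (c : OpenPartialHomeomorph H E) (x : E) : E →L[ℝ] E :=
  fderiv ℝ (fun y => localMul c (y, x)) 0

namespace IsSmoothCoordinate

variable {c : OpenPartialHomeomorph H E} (hc : IsSmoothCoordinate c)

include hc

lemma localConj_zero (g : H) : localConj c g 0 = 0 := by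
  simp [localConj, hc.symm_zero, hc.map_one]

lemma hasFDerivAt_localConj (g : H) : HasFDerivAt (localConj c g) (adDiff c g) 0 :=
  ((hc.contDiffAt_conj g).differentiableAt (by simp)).hasFDerivAt

lemma hasStrictFDerivAt_localConj (g : H) : HasStrictFDerivAt (localConj c g) (adDiff c g) 0 :=
  (hc.contDiffAt_conj g).hasStrictFDerivAt (by simp)

lemma eventually_conj_mem [IsTopologicalGroup H] (g : H) :
    ∀ᶠ y in 𝓝 (0 : E), g * c.symm y * g⁻¹ ∈ c.source := by
  have h : ContinuousAt (fun y => g * c.symm y * g⁻¹) 0 :=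
    (continuousAt_const.mul hc.continuousAt_symm).mul continuousAt_const
  have h' : Tendsto (fun y => g * c.symm y * g⁻¹) (𝓝 0) (𝓝 1) := by
    have := h.tendsto
    simpa [hc.symm_zero] using this
  exact h'.eventually hc.eventually_mem

lemma adDiff_one : adDiff c 1 = ContinuousLinearMap.id ℝ E := by
  have : localConj c 1 =ᶠ[𝓝 0] fun y => y := by
    filter_upwards [hc.eventually_right_inv] with y hy
    simp [localConj, hy]
  rw [adDiff, this.fderiv_eq, fderiv_fun_id]

lemma adDiff_mul [IsTopologicalGroup H] (g h : H) :
    adDiff c (g * h) = (adDiff c g).comp (adDiff c h) := by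
  have : localConj c (g * h) =ᶠ[𝓝 0] localConj c g ∘ localConj c h := by
    filter_upwards [hc.eventually_conj_mem h] with y hy
    simp only [localConj, Function.comp]
    rw [c.left_inv hy]
    group
  have h2 : HasFDerivAt (localConj c g) (adDiff c g) (localConj c h 0) := by
    rw [hc.localConj_zero]; exact hc.hasFDerivAt_localConj g
  have h3 := (h2.comp 0 (hc.hasFDerivAt_localConj h)).congr_of_eventuallyEq this
  exact h3.fderiv

lemma adDiff_apply_inv [IsTopologicalGroup H] (g : H) (v : E) :
    adDiff c g (adDiff c g⁻¹ v) = v := by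
  have := hc.adDiff_mul g g⁻¹
  rw [mul_inv_cancel, hc.adDiff_one] at this
  exact (DFunLike.congr_fun this v).symm

lemma rightDiff_zero : rightDiff c 0 = ContinuousLinearMap.id ℝ E := by
  rw [rightDiff, Filter.EventuallyEq.fderiv_eq hc.localMul_zero_right, fderiv_fun_id]

lemma eventually_contDiffAt_localMul : ∀ᶠ p in 𝓝 (0 : E × E), ContDiffAt ℝ 2 (localMul c) p :=
  (hc.contDiffAt_mul.of_le two_le_smooth).eventually (by simp)

/-- Differentiate x y = (x y x⁻¹) x in y at the identity. -/
lemma leftDiff_eq_comp_adDiff [IsTopologicalGroup H] :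
    ∀ᶠ x in 𝓝 (0 : E), leftDiff c x = (rightDiff c x).comp (adDiff c (c.symm x)) := by
  have h1 : Tendsto (fun x : E => ((0 : E), x)) (𝓝 0) (𝓝 0) := by
    have : Continuous fun x : E => ((0 : E), x) := by fun_prop
    exact this.tendsto' 0 0 rfl
  filter_upwards [h1.eventually hc.eventually_contDiffAt_localMul] with x hx
  have hd : DifferentiableAt ℝ (fun y => localMul c (y, x)) (localConj c (c.symm x) 0) := by
    rw [hc.localConj_zero]
    exact DifferentiableAt.comp (f := fun y : E => (y, x)) (0 : E)
      (hx.differentiableAt (by simp)) (by fun_prop)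
  have he : (fun y => localMul c (x, y)) =ᶠ[𝓝 0]
      (fun y => localMul c (y, x)) ∘ localConj c (c.symm x) := by
    filter_upwards [hc.eventually_conj_mem (c.symm x)] with y hy
    simp only [localMul, localConj, Function.comp]
    rw [c.left_inv hy, inv_mul_cancel_right]
  rw [leftDiff, he.fderiv_eq, fderiv_comp _ hd (hc.hasFDerivAt_localConj _).differentiableAt,
    hc.localConj_zero]
  rfl

lemma hasFDerivAt_leftDiff : HasFDerivAt (leftDiff c) (mixedDiff c) 0 :=
  (hc.contDiffAt_leftDiff.differentiableAt (by simp)).hasFDerivAt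

lemma differentiableAt_fderiv_localMul : DifferentiableAt ℝ (fderiv ℝ (localMul c)) 0 :=
  (hc.contDiffAt_mul.fderiv_right (m := 1) (one_add_one_eq_two.trans_le two_le_smooth)).differentiableAt (by simp)

lemma mixedDiff_apply (v w : E) :
    mixedDiff c v w = fderiv ℝ (fderiv ℝ (localMul c)) 0 (v, 0) (0, w) := by
  have h1 : Tendsto (fun x : E => (x, (0 : E))) (𝓝 0) (𝓝 0) := by
    have : Continuous fun x : E => (x, (0 : E)) := by fun_prop
    exact this.tendsto' 0 0 rfl
  have he : leftDiff c =ᶠ[𝓝 0]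
      fun x => (fderiv ℝ (localMul c) (x, 0)).comp (ContinuousLinearMap.inr ℝ E E) := by
    filter_upwards [h1.eventually hc.eventually_contDiffAt_localMul] with x hx
    exact (HasFDerivAt.comp (f := fun y : E => (x, y)) 0
      (hx.differentiableAt (by simp)).hasFDerivAt (hasFDerivAt_prodMk_right x 0)).fderiv
  have hd : HasFDerivAt (fun x : E => fderiv ℝ (localMul c) (x, (0 : E)))
      ((fderiv ℝ (fderiv ℝ (localMul c)) 0).comp (ContinuousLinearMap.inl ℝ E E)) 0 :=
    HasFDerivAt.comp (f := fun x : E => (x, (0 : E))) 0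
      hc.differentiableAt_fderiv_localMul.hasFDerivAt (hasFDerivAt_prodMk_left 0 0)
  have hd2 := (hd.clm_comp (hasFDerivAt_const (ContinuousLinearMap.inr ℝ E E) 0))
  have h3 := hc.hasFDerivAt_leftDiff.unique (hd2.congr_of_eventuallyEq he)
  simpa using DFunLike.congr_fun (DFunLike.congr_fun h3 v) w

/-- Symmetry of the second derivative of the product: left and right translations have the same
mixed second derivative, with the arguments exchanged. -/
lemma hasFDerivAt_rightDiff : HasFDerivAt (rightDiff c) (mixedDiff c).flip 0 := by
  have h1 : Tendsto (fun x : E => ((0 : E), x)) (𝓝 0) (𝓝 0) := by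
    have : Continuous fun x : E => ((0 : E), x) := by fun_prop
    exact this.tendsto' 0 0 rfl
  have he : rightDiff c =ᶠ[𝓝 0]
      fun x => (fderiv ℝ (localMul c) (0, x)).comp (ContinuousLinearMap.inl ℝ E E) := by
    filter_upwards [h1.eventually hc.eventually_contDiffAt_localMul] with x hx
    exact (HasFDerivAt.comp (f := fun y : E => (y, x)) 0
      (hx.differentiableAt (by simp)).hasFDerivAt (hasFDerivAt_prodMk_left 0 x)).fderiv
  have hd : HasFDerivAt (fun x : E => fderiv ℝ (localMul c) ((0 : E), x))
      ((fderiv ℝ (fderiv ℝ (localMul c)) 0).comp (ContinuousLinearMap.inr ℝ E E)) 0 :=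
    HasFDerivAt.comp (f := fun x : E => ((0 : E), x)) 0
      hc.differentiableAt_fderiv_localMul.hasFDerivAt (hasFDerivAt_prodMk_right 0 0)
  have hd2 := (hd.clm_comp (hasFDerivAt_const (ContinuousLinearMap.inl ℝ E E) 0))
  refine (hd2.congr_of_eventuallyEq he).congr_fderiv ?_
  have hsymm : IsSymmSndFDerivAt ℝ (localMul c) 0 :=
    hc.contDiffAt_mul.isSymmSndFDerivAt (by simpa using two_le_smooth)
  ext v w
  rw [ContinuousLinearMap.flip_apply, hc.mixedDiff_apply, hsymm.eq]
  simp

/-- The differential of the adjoint representation is the bracket. -/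
lemma hasFDerivAt_adDiff_symm [IsTopologicalGroup H] :
    HasFDerivAt (fun x => adDiff c (c.symm x)) (mixedDiff c - (mixedDiff c).flip) 0 := by
  have hcd : ContDiffAt ℝ ∞ (fun x => adDiff c (c.symm x)) 0 :=
    ContDiffAt.fderiv (f := fun x y => localConj c (c.symm x) y) (g := fun _ => 0)
      hc.contDiffAt_conj_joint contDiffAt_const (by simp)
  have hd := (hcd.differentiableAt (by simp)).hasFDerivAt
  refine hd.congr_fderiv ?_
  have h1 := (hc.hasFDerivAt_rightDiff.clm_comp hd).congr_of_eventuallyEq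
    hc.leftDiff_eq_comp_adDiff
  -- Two values for the derivative of L_x = R_x ∘ Ad(x) at the origin; comparing them leaves the
  -- antisymmetrization as the derivative of Ad.
  have h2 := hc.hasFDerivAt_leftDiff.unique h1
  ext v w
  have h3 := DFunLike.congr_fun (DFunLike.congr_fun h2 v) w
  simp only [hc.symm_zero, hc.adDiff_one, hc.rightDiff_zero, add_apply,
    ContinuousLinearMap.comp_apply, ContinuousLinearMap.compL_apply,
    ContinuousLinearMap.flip_apply, sub_apply,
    ContinuousLinearMap.id_comp, ContinuousLinearMap.comp_id] at h3 ⊢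
  rw [h3]; abel

end IsSmoothCoordinate

end Adjoint

/-! ### Word maps and their left-trivialized differentials -/

section WordMap

variable {H : Type*} [Group H] {ι : Type*}

/-- The product `γ (i (n - 1)) (t (n - 1)) ⋯ γ (i 0) (t 0)`. -/
def wordMap (γ : ι → ℝ → H) : (n : ℕ) → (Fin n → ι) → (Fin n → ℝ) → H
  | 0, _, _ => 1
  | n + 1, i, t => wordMap γ n (Fin.tail i) (Fin.tail t) * γ (i 0) (t 0)

lemma continuous_wordMap [TopologicalSpace H] [ContinuousMul H] {γ : ι → ℝ → H}
    (hγ : ∀ i, Continuous (γ i)) : ∀ (n : ℕ) (i : Fin n → ι), Continuous (wordMap γ n i)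
  | 0, _ => continuous_const
  | n + 1, i => by
    have h1 := continuous_wordMap hγ n (Fin.tail i)
    have h2 : Continuous fun t : Fin (n + 1) → ℝ => (Fin.tail t : Fin n → ℝ) :=
      continuous_pi fun j => continuous_apply _
    exact (h1.comp h2).mul ((hγ (i 0)).comp (continuous_apply 0))

/-- The restriction of a tuple to all its entries but the first, as a linear map. -/
def tailCLM (n : ℕ) : (Fin (n + 1) → ℝ) →L[ℝ] (Fin n → ℝ) :=
  ContinuousLinearMap.pi fun j => ContinuousLinearMap.proj j.succ

lemma tailCLM_apply (n : ℕ) (t : Fin (n + 1) → ℝ) : tailCLM n t = Fin.tail t := rfl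

variable {E : Type*} [TopologicalSpace H] [NormedAddCommGroup E] [NormedSpace ℝ E]

/-- The left-trivialized differential of a word map. -/
noncomputable def wordDiff (c : OpenPartialHomeomorph H E) (γ : ι → ℝ → H) (v : ι → E) :
    (n : ℕ) → (Fin n → ι) → (Fin n → ℝ) → (Fin n → ℝ) →L[ℝ] E
  | 0, _, _ => 0
  | n + 1, i, t => ((adDiff c (γ (i 0) (t 0))⁻¹).comp
      (wordDiff c γ v n (Fin.tail i) (Fin.tail t))).comp (tailCLM n) +
      (ContinuousLinearMap.proj (R := ℝ) (φ := fun _ : Fin (n + 1) => ℝ) 0).smulRight (v (i 0))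

/-- Appending a letter on the right conjugates the old range and adds the velocity of the new
letter; this recursion is all the rank argument needs. -/
lemma range_wordDiff_succ (c : OpenPartialHomeomorph H E) (γ : ι → ℝ → H) (v : ι → E) (n : ℕ)
    (i : Fin (n + 1) → ι) (t : Fin (n + 1) → ℝ) :
    (wordDiff c γ v (n + 1) i t).range =
      ((wordDiff c γ v n (Fin.tail i) (Fin.tail t)).range).map
        (adDiff c (γ (i 0) (t 0))⁻¹ : E →ₗ[ℝ] E) ⊔ Submodule.span ℝ {v (i 0)} := by
  apply le_antisymm
  · rintro _ ⟨s, rfl⟩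
    refine Submodule.add_mem_sup ⟨_, ⟨tailCLM n s, rfl⟩, rfl⟩ ?_
    exact Submodule.smul_mem _ _ (Submodule.mem_span_singleton_self _)
  · refine sup_le ?_ ?_
    · rintro _ ⟨_, ⟨s, rfl⟩, rfl⟩
      refine ⟨Fin.cons 0 s, ?_⟩
      simp [wordDiff, tailCLM_apply]
    · rw [Submodule.span_singleton_le_iff_mem]
      refine ⟨Fin.cons 1 0, ?_⟩
      simp [wordDiff, tailCLM_apply]

/-- With w = w' γ and base point t₀, w(t₀)⁻¹ w(t) is the conjugate by γ(t₀ 0)⁻¹ of w'(t₀)⁻¹ w'(t),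
times γ(t 0 - t₀ 0). Both factors are near the identity, where the product is addition to first
order. -/
lemma IsSmoothCoordinate.hasStrictFDerivAt_wordMap [IsTopologicalGroup H]
    {c : OpenPartialHomeomorph H E} (hc : IsSmoothCoordinate c) {γ : ι → ℝ → H}
    (hγ : ∀ i, Continuous (γ i)) (hadd : ∀ i s t, γ i (s + t) = γ i s * γ i t) {v : ι → E}
    (hv : ∀ i, HasStrictDerivAt (fun t => c (γ i t)) (v i) 0) :
    ∀ (n : ℕ) (i : Fin n → ι) (t₀ : Fin n → ℝ),
      HasStrictFDerivAt (fun t => c ((wordMap γ n i t₀)⁻¹ * wordMap γ n i t))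
        (wordDiff c γ v n i t₀) t₀
  | 0, i, t₀ => by simpa [wordMap, wordDiff] using hasStrictFDerivAt_const (c 1) t₀
  | n + 1, i, t₀ => by
    have ih := hasStrictFDerivAt_wordMap hc hγ hadd hv n (Fin.tail i) (Fin.tail t₀)
    set w := wordMap γ n (Fin.tail i) with hw
    have hγ0 : γ (i 0) 0 = 1 := by simpa using hadd (i 0) 0 0
    set f : (Fin (n + 1) → ℝ) → E := fun t => c ((w (Fin.tail t₀))⁻¹ * w (Fin.tail t)) with hf
    have hf0 : f t₀ = 0 := by simp [hf, hc.map_one]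
    have h1 : HasStrictFDerivAt f
        ((wordDiff c γ v n (Fin.tail i) (Fin.tail t₀)).comp (tailCLM n)) t₀ :=
      HasStrictFDerivAt.comp (f := fun t : Fin (n + 1) → ℝ => (Fin.tail t : Fin n → ℝ)) t₀ ih
        (tailCLM n).hasStrictFDerivAt
    have h2 : HasStrictFDerivAt (fun t => localConj c (γ (i 0) (t₀ 0))⁻¹ (f t))
        ((adDiff c (γ (i 0) (t₀ 0))⁻¹).comp
          ((wordDiff c γ v n (Fin.tail i) (Fin.tail t₀)).comp (tailCLM n))) t₀ := by
      refine HasStrictFDerivAt.comp t₀ ?_ h1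
      rw [hf0]; exact hc.hasStrictFDerivAt_localConj _
    have h3 : HasStrictFDerivAt (fun t : Fin (n + 1) → ℝ => c (γ (i 0) (t 0 - t₀ 0)))
        ((ContinuousLinearMap.proj (R := ℝ) (φ := fun _ : Fin (n + 1) => ℝ) 0).smulRight
          (v (i 0))) t₀ := by
      have h4 : HasStrictFDerivAt (fun t : Fin (n + 1) → ℝ => t 0 - t₀ 0)
          (ContinuousLinearMap.proj (R := ℝ) (φ := fun _ : Fin (n + 1) => ℝ) 0) t₀ :=
        (ContinuousLinearMap.proj (R := ℝ) (φ := fun _ : Fin (n + 1) => ℝ)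
          0).hasStrictFDerivAt.sub_const _
      have h5 : HasStrictDerivAt (fun t => c (γ (i 0) t)) (v (i 0)) (t₀ 0 - t₀ 0) := by
        rw [sub_self]; exact hv _
      refine (HasStrictFDerivAt.comp (f := fun t : Fin (n + 1) → ℝ => t 0 - t₀ 0) t₀
        h5.hasStrictFDerivAt h4).congr_fderiv ?_
      ext s; simp
    have h6 := HasStrictFDerivAt.comp (f := fun t => (localConj c (γ (i 0) (t₀ 0))⁻¹ (f t),
      c (γ (i 0) (t 0 - t₀ 0)))) (g := localMul c) t₀
      (g' := ContinuousLinearMap.fst ℝ E E + ContinuousLinearMap.snd ℝ E E) (by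
        simp only [hf0, hc.localConj_zero, sub_self, hγ0, hc.map_one]
        exact hc.hasStrictFDerivAt_localMul) (h2.prodMk h3)
    refine (h6.congr_of_eventuallyEq ?_).congr_fderiv ?_
    · have hcw : Continuous fun t : Fin (n + 1) → ℝ => w (Fin.tail t) :=
        (continuous_wordMap hγ n _).comp (continuous_pi fun j => continuous_apply _)
      have m1 : ∀ᶠ t in 𝓝 t₀, (w (Fin.tail t₀))⁻¹ * w (Fin.tail t) ∈ c.source := by
        have : Tendsto (fun t => (w (Fin.tail t₀))⁻¹ * w (Fin.tail t)) (𝓝 t₀) (𝓝 1) :=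
          (continuous_const.mul hcw).tendsto' t₀ 1 (by simp)
        exact this.eventually hc.eventually_mem
      have m2 : ∀ᶠ t in 𝓝 t₀, (γ (i 0) (t₀ 0))⁻¹ *
          ((w (Fin.tail t₀))⁻¹ * w (Fin.tail t)) * (γ (i 0) (t₀ 0))⁻¹⁻¹ ∈ c.source := by
        have : Tendsto (fun t => (γ (i 0) (t₀ 0))⁻¹ *
          ((w (Fin.tail t₀))⁻¹ * w (Fin.tail t)) * (γ (i 0) (t₀ 0))⁻¹⁻¹) (𝓝 t₀) (𝓝 1) :=
          ((continuous_const.mul (continuous_const.mul hcw)).mul continuous_const).tendsto' t₀ 1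
            (by simp)
        exact this.eventually hc.eventually_mem
      have m3 : ∀ᶠ t in 𝓝 t₀, γ (i 0) (t 0 - t₀ 0) ∈ c.source := by
        have : Tendsto (fun t : Fin (n + 1) → ℝ => γ (i 0) (t 0 - t₀ 0)) (𝓝 t₀) (𝓝 1) :=
          ((hγ (i 0)).comp ((continuous_apply 0).sub continuous_const)).tendsto' t₀ 1
            (by simp [hγ0])
        exact this.eventually hc.eventually_mem
      filter_upwards [m1, m2, m3] with t k1 k2 k3
      simp only [localMul, localConj, hf]
      rw [c.left_inv k1, c.left_inv k2, c.left_inv k3]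
      have : γ (i 0) (t 0) = γ (i 0) (t₀ 0) * γ (i 0) (t 0 - t₀ 0) := by
        rw [← hadd, add_sub_cancel]
      simp only [wordMap, ← hw]
      rw [this]
      congr 1
      group
    · ext s
      simp [wordDiff]

end WordMap
end CarnotNull

namespace CarnotNull

/-! ### Some word map is a submersion at some point -/

section Rank

variable {H E ι : Type*} [Group H] [TopologicalSpace H] [IsTopologicalGroup H]
  [NormedAddCommGroup E] [NormedSpace ℝ E] [FiniteDimensional ℝ E]

lemma HasDerivAt.mem_of_forall_mem {x : ℝ → E} {v : E} {P : Submodule ℝ E} {a : ℝ}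
    (hx : HasDerivAt x v a) (hP : ∀ t, x t ∈ P) : v ∈ P := by
  have h := hasDerivAt_iff_tendsto_slope_zero.1 hx
  exact P.closed_of_finiteDimensional.mem_of_tendsto h
    (Eventually.of_forall fun t => P.smul_mem _ (P.sub_mem (hP _) (hP _)))

/-- Let P be the intersection of all ranges of maximal rank. A further letter cannot raise the rank,
which forces P to contain every velocity and to be stable under Ad(γ_j(s)), hence under the brackets
with the v_j. So P contains V 1 and, by the stratification, everything. -/
theorem IsStratifiedChart.exists_range_wordDiff_eq_top {δ : ℝ → H → H}
    {c : OpenPartialHomeomorph H E} {V : ℕ → Submodule ℝ E} (hc : IsStratifiedChart δ c V)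
    {γ : ι → ℝ → H} (hadd : ∀ i s t, γ i (s + t) = γ i s * γ i t)
    {v : ι → E} (hv : ∀ i, HasStrictDerivAt (fun t => c (γ i t)) (v i) 0)
    (hγ : ∀ i, Continuous (γ i)) (hspan : V 1 ≤ Submodule.span ℝ (Set.range v)) :
    ∃ (n : ℕ) (i : Fin n → ι) (t : Fin n → ℝ), (wordDiff c γ v n i t).range = ⊤ := by
  have hsc := hc.toIsSmoothCoordinate
  have hγ0 : ∀ i, γ i 0 = 1 := fun i => by simpa using hadd i 0 0
  have hγneg : ∀ i s, γ i (-s) = (γ i s)⁻¹ := fun i s => by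
    rw [eq_inv_iff_mul_eq_one, ← hadd, neg_add_cancel, hγ0]
  -- a word of maximal rank
  let S : Set ℕ := {k | ∃ (n : ℕ) (i : Fin n → ι) (t : Fin n → ℝ),
    Module.finrank ℝ (wordDiff c γ v n i t).range = k}
  have hSne : S.Nonempty := ⟨_, 0, fun _ => Fin.elim0 ‹_›, 0, rfl⟩
  have hSbdd : BddAbove S := ⟨Module.finrank ℝ E, by
    rintro _ ⟨n, i, t, rfl⟩; exact Submodule.finrank_le _⟩
  set K := sSup S with hK
  have hle : ∀ (n : ℕ) (i : Fin n → ι) (t : Fin n → ℝ),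
      Module.finrank ℝ (wordDiff c γ v n i t).range ≤ K := fun n i t =>
    le_csSup hSbdd ⟨n, i, t, rfl⟩
  let M : Set (Submodule ℝ E) := {R | ∃ (n : ℕ) (i : Fin n → ι) (t : Fin n → ℝ),
    (wordDiff c γ v n i t).range = R ∧ Module.finrank ℝ R = K}
  have hstep : ∀ R ∈ M, ∀ j s,
      R.map (adDiff c (γ j s)⁻¹ : E →ₗ[ℝ] E) ∈ M ∧
      v j ∈ R.map (adDiff c (γ j s)⁻¹ : E →ₗ[ℝ] E) := by
    rintro _ ⟨n, i, t, rfl, hR⟩ j s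
    have hr := range_wordDiff_succ c γ v n (Fin.cons j i) (Fin.cons s t)
    simp only [Fin.cons_zero, Fin.tail_cons] at hr
    have hinj : Function.Injective (adDiff c (γ j s)⁻¹ : E →ₗ[ℝ] E) := by
      intro x y hxy
      have := congrArg (adDiff c (γ j s)⁻¹⁻¹) hxy
      have h2 : ∀ u, adDiff c (γ j s)⁻¹⁻¹ (adDiff c (γ j s)⁻¹ u) = u := fun u => by
        rw [inv_inv]; exact hsc.adDiff_apply_inv _ _
      exact (h2 x).symm.trans (this.trans (h2 y))
    have hfr : Module.finrank ℝ ((wordDiff c γ v n i t).range.map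
        (adDiff c (γ j s)⁻¹ : E →ₗ[ℝ] E)) = K := by
      rw [← hR]; exact (Submodule.equivMapOfInjective _ hinj _).finrank_eq.symm
    -- Conjugation preserves the dimension, so by maximality the conjugated range already equals the
    -- range of the longer word, which contains `v j`.
    have heq : (wordDiff c γ v n i t).range.map (adDiff c (γ j s)⁻¹ : E →ₗ[ℝ] E)
        = (wordDiff c γ v (n + 1) (Fin.cons j i) (Fin.cons s t)).range := by
      refine Submodule.eq_of_le_of_finrank_le (hr ▸ le_sup_left) ?_
      rw [hfr]; exact hle _ _ _
    refine ⟨⟨n + 1, Fin.cons j i, Fin.cons s t, heq.symm, hfr⟩, ?_⟩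
    rw [heq, hr]
    exact Submodule.mem_sup_right (Submodule.mem_span_singleton_self _)
  set P : Submodule ℝ E := sInf M with hP
  have hPv : ∀ j, v j ∈ P := fun j => by
    rw [hP, Submodule.mem_sInf]
    intro R hR
    have := (hstep R hR j 0).2
    simpa [hγ0, hsc.adDiff_one] using this
  have hPad : ∀ u ∈ P, ∀ j s, adDiff c (γ j s) u ∈ P := fun u hu j s => by
    rw [hP, Submodule.mem_sInf]
    intro R hR
    obtain ⟨w, hw, rfl⟩ := (Submodule.mem_sInf.1 hu) _ (hstep R hR j s).1
    have := hsc.adDiff_apply_inv (γ j s) w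
    exact this.symm ▸ hw
  have hPbr : ∀ u ∈ P, ∀ j, localBracket c (v j) u ∈ P := fun u hu j => by
    have hmem : ∀ᶠ t in 𝓝 (0 : ℝ), γ j t ∈ c.source := by
      have := (hγ j).tendsto 0
      rw [hγ0] at this
      exact this.eventually hsc.eventually_mem
    have h0 : HasFDerivAt (fun x => adDiff c (c.symm x)) (mixedDiff c - (mixedDiff c).flip)
        (c (γ j 0)) := by
      rw [hγ0, hsc.map_one]; exact hsc.hasFDerivAt_adDiff_symm
    have h1 := h0.comp_hasDerivAt (0 : ℝ) (hv j).hasDerivAt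
    have h2 := h1.clm_apply (hasDerivAt_const (0 : ℝ) u)
    have h3 : HasDerivAt (fun t => adDiff c (γ j t) u)
        ((mixedDiff c - (mixedDiff c).flip) (v j) u) 0 := by
      refine (h2.congr_of_eventuallyEq ?_).congr_deriv (by simp)
      filter_upwards [hmem] with t ht
      simp only [Function.comp]
      rw [c.left_inv ht]
    -- The curve t ↦ Ad(γ_j(t)) u stays in the closed subspace P, so its derivative at 0, the
    -- bracket [v_j, u], lies in P.
    exact HasDerivAt.mem_of_forall_mem h3 fun t => hPad u hu j t
  have hV1 : V 1 ≤ P := hspan.trans (Submodule.span_le.2 (Set.range_subset_iff.2 hPv))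
  have hPbr' : ∀ x ∈ V 1, ∀ u ∈ P, localBracket c x u ∈ P := fun x hx u hu => by
    refine Submodule.span_induction (p := fun x _ => localBracket c x u ∈ P)
      ?_ ?_ ?_ ?_ (hspan hx)
    · rintro _ ⟨j, rfl⟩; exact hPbr u hu j
    · simp [localBracket]
    · intro x y _ _ hx hy
      have : localBracket c (x + y) u = localBracket c x u + localBracket c y u := by
        simp only [localBracket, map_add, add_apply]; abel
      rw [this]; exact P.add_mem hx hy
    · intro a x _ hx
      have : localBracket c (a • x) u = a • localBracket c x u := by
        simp only [localBracket, map_smul, smul_apply, smul_sub]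
      rw [this]; exact P.smul_mem _ hx
  have hVk : ∀ k, V (k + 1) ≤ P := fun k => by
    induction k with
    | zero => exact hV1
    | succ k ih =>
      rw [hc.bracket (k + 1) (by omega), Submodule.span_le]
      rintro _ ⟨x, hx, y, hy, rfl⟩
      exact hPbr' x hx y (ih hy)
  have hPtop : P = ⊤ := by
    rw [eq_top_iff, ← hc.isInternal.submodule_iSup_eq_top, iSup_le_iff]
    rintro (_ | k)
    · rw [hc.layer_zero]; exact bot_le
    · exact hVk k
  obtain ⟨n, i, t, hnit⟩ := Nat.sSup_mem hSne hSbdd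
  refine ⟨n, i, t, ?_⟩
  have : (wordDiff c γ v n i t).range ∈ M := ⟨n, i, t, rfl, hnit⟩
  exact top_le_iff.1 (hPtop ▸ sInf_le this)

end Rank

/-! ### Second-order Taylor bound -/

section Quadratic

variable {E F : Type*} [NormedAddCommGroup E] [NormedSpace ℝ E] [NormedAddCommGroup F]
  [NormedSpace ℝ F]

lemma ContDiffAt.exists_norm_sub_fderiv_le_sq {f : E → F} (hf : ContDiffAt ℝ ∞ f 0)
    (h0 : f 0 = 0) :
    ∃ K : ℝ, 0 ≤ K ∧ ∃ ρ > 0, ∀ y, ‖y‖ ≤ ρ → ‖f y - fderiv ℝ f 0 y‖ ≤ K * ‖y‖ ^ 2 := by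
  have h1 : ContDiffAt ℝ 1 (fderiv ℝ f) 0 :=
    hf.fderiv_right (one_add_one_eq_two.trans_le two_le_smooth)
  obtain ⟨K, t, ht, hlip⟩ := h1.exists_lipschitzOnWith
  have h2 : ∀ᶠ y in 𝓝 (0 : E), DifferentiableAt ℝ f y := by
    filter_upwards [(hf.of_le two_le_smooth).eventually (by simp)] with y hy
    exact hy.differentiableAt (by simp)
  obtain ⟨ρ, hρ, hsub⟩ := Metric.nhds_basis_closedBall.mem_iff.1 (inter_mem ht h2)
  refine ⟨K, K.2, ρ, hρ, fun y hy => ?_⟩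
  have hcl : ∀ z ∈ Metric.closedBall (0 : E) ‖y‖, z ∈ Metric.closedBall (0 : E) ρ := fun z hz =>
    Metric.closedBall_subset_closedBall hy hz
  have := (convex_closedBall (0 : E) ‖y‖).norm_image_sub_le_of_norm_hasFDerivWithin_le'
    (f := f) (f' := fderiv ℝ f) (φ := fderiv ℝ f 0) (C := K * ‖y‖) (x := 0) (y := y)
    (fun z hz => ((hsub (hcl z hz)).2 : DifferentiableAt ℝ f z).hasFDerivAt.hasFDerivWithinAt)
    (fun z hz => ?_) (by simp) (by simp)
  · rw [h0] at this
    calc ‖f y - fderiv ℝ f 0 y‖ ≤ K * ‖y‖ * ‖y‖ := by simpa using this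
      _ = _ := by ring
  · have h3 := hlip.dist_le_mul z (hsub (hcl z hz)).1 0 (hsub (by simpa using hρ.le)).1
    rw [dist_eq_norm, dist_zero_right] at h3
    refine h3.trans ?_
    have : ‖z‖ ≤ ‖y‖ := by simpa using hz
    gcongr

end Quadratic

end CarnotNull

namespace CarnotNull

namespace IsScalableGroup

variable {G : Type*} [Group G] [TopologicalSpace G] {δ : ℝ → G → G} (hδ : IsScalableGroup δ)

include hδ

lemma dil_one (t : ℝ) : δ t 1 = 1 := by
  rcases eq_or_ne t 0 with rfl | ht
  · exact hδ.zero 1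
  · have := hδ.map_mul t ht 1 1
    rwa [mul_one, left_eq_mul] at this

lemma one_dil (g : G) : δ 1 g = g := by
  apply (hδ.bijective 1 one_ne_zero).1
  rw [hδ.comp, mul_one]

lemma continuous_dil (t : ℝ) : Continuous (δ t) :=
  hδ.continuous_uncurry.comp (continuous_const.prodMk continuous_id)

lemma continuous_dil_left (g : G) : Continuous fun t => δ t g :=
  hδ.continuous_uncurry.comp (continuous_id.prodMk continuous_const)

lemma tendsto_dil_pow {r : ℝ} (h0 : 0 ≤ r) (h1 : r < 1) (g : G) :
    Tendsto (fun k : ℕ => δ (r ^ k) g) atTop (𝓝 1) := by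
  have := (hδ.continuous_dil_left g).tendsto 0
  rw [hδ.zero] at this
  exact this.comp (tendsto_pow_atTop_nhds_zero_of_lt_one h0 h1)

end IsScalableGroup

/-! ### Dilations read in a stratified chart -/

section Spanning

variable {H E ι : Type*} [Group H] [TopologicalSpace H]
  [NormedAddCommGroup E] [NormedSpace ℝ E] [FiniteDimensional ℝ E]

/-- The differential at the origin of a dilation, read in a chart. -/
noncomputable def dilDiff (δ : ℝ → H → H) (c : OpenPartialHomeomorph H E) (r : ℝ) : E →L[ℝ] E :=
  fderiv ℝ (fun y => c (δ r (c.symm y))) 0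

namespace IsStratifiedChart

variable {δ : ℝ → H → H} {c : OpenPartialHomeomorph H E} {V : ℕ → Submodule ℝ E}
  (hc : IsStratifiedChart δ c V)

/-- A basis adapted to a stratification. -/
noncomputable def layerBasis (hV : DirectSum.IsInternal V) :
    Module.Basis (Σ k, Fin (Module.finrank ℝ (V k))) ℝ E :=
  hV.collectedBasis fun k => Module.finBasis ℝ (V k)

include hc

lemma dilDiff_layerBasis {r : ℝ} (hr : r ≠ 0) (a : Σ k, Fin (Module.finrank ℝ (V k))) :
    dilDiff δ c r (layerBasis hc.isInternal a) = r ^ a.1 • layerBasis hc.isInternal a :=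
  hc.fderiv_dil r hr a.1 _ (hc.isInternal.collectedBasis_mem _ a)

lemma coord_dilDiff {r : ℝ} (hr : r ≠ 0) (a : Σ k, Fin (Module.finrank ℝ (V k))) (u : E) :
    (layerBasis hc.isInternal).coord a (dilDiff δ c r u)
      = r ^ a.1 * (layerBasis hc.isInternal).coord a u := by
  have : ((layerBasis hc.isInternal).coord a).comp (dilDiff δ c r : E →ₗ[ℝ] E)
      = r ^ a.1 • (layerBasis hc.isInternal).coord a := by
    refine (layerBasis hc.isInternal).ext fun b => ?_
    simp only [LinearMap.comp_apply, ContinuousLinearMap.coe_coe, hc.dilDiff_layerBasis hr,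
      map_smul, LinearMap.smul_apply, Module.Basis.coord_apply, Module.Basis.repr_self, smul_eq_mul]
    rcases eq_or_ne b a with rfl | hab
    · rfl
    · simp [hab]
  simpa using DFunLike.congr_fun this u

omit [FiniteDimensional ℝ E] in
lemma one_le_fst (a : Σ k, Fin (Module.finrank ℝ (V k))) : 1 ≤ a.1 := by
  rcases a with ⟨_ | k, j⟩
  · have h0 : Module.finrank ℝ (V 0) = 0 := by rw [hc.layer_zero, finrank_bot]
    exact (Fin.cast h0 j).elim0
  · simp

/-- The numbers 2 ^ k are distinct, so an eigenvector of the dilation by 2 with eigenvalue 2 has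
only components in the first layer. -/
lemma coord_eq_zero {u : E} (hu : dilDiff δ c 2 u = (2 : ℝ) • u)
    {a : Σ k, Fin (Module.finrank ℝ (V k))} (ha : a.1 ≠ 1) :
    (layerBasis hc.isInternal).coord a u = 0 := by
  have h := hc.coord_dilDiff (two_ne_zero) a u
  rw [hu, map_smul, smul_eq_mul] at h
  have h2 : (2 : ℝ) ^ a.1 ≠ 2 := fun h3 => ha <| by
    have : (2 : ℝ) ^ a.1 = 2 ^ 1 := by rw [h3, pow_one]
    exact pow_right_injective₀ (by norm_num : (0 : ℝ) < 2) (by norm_num) this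
  have h4 : ((2 : ℝ) ^ a.1 - 2) * (layerBasis hc.isInternal).coord a u = 0 := by
    rw [sub_mul, ← h, sub_self]
  exact (mul_eq_zero.1 h4).resolve_left (sub_ne_zero.2 h2)

/-- Every nonzero layer has weight at least 1, so each coordinate shrinks by at least the factor r.
-/
lemma exists_norm_dilDiff_le : ∃ C : ℝ, 1 ≤ C ∧ ∀ r : ℝ, 0 < r → r ≤ 1 → ∀ u,
    ‖dilDiff δ c r u‖ ≤ C * r * ‖u‖ := by
  have : Finite (Σ k, Fin (Module.finrank ℝ (V k))) :=
    Module.Finite.finite_basis (layerBasis hc.isInternal)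
  have := Fintype.ofFinite (Σ k, Fin (Module.finrank ℝ (V k)))
  set b := layerBasis hc.isInternal with hb
  set N : (Σ k, Fin (Module.finrank ℝ (V k))) → ℝ := fun a =>
    ‖LinearMap.toContinuousLinearMap (b.coord a)‖ * ‖b a‖ with hN
  have hN0 : ∀ a, 0 ≤ N a := fun a => by positivity
  refine ⟨1 + ∑ a, N a, le_add_of_nonneg_right (Finset.sum_nonneg fun a _ => hN0 a),
    fun r hr hr1 u => ?_⟩
  rw [← b.sum_repr (dilDiff δ c r u)]
  refine (norm_sum_le _ _).trans ?_
  have : ∀ a, ‖b.repr (dilDiff δ c r u) a • b a‖ ≤ N a * (r * ‖u‖) := fun a => by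
    have h1 : b.repr (dilDiff δ c r u) a = r ^ a.1 * b.coord a u := hc.coord_dilDiff hr.ne' a u
    have h2 : |b.coord a u| ≤ ‖LinearMap.toContinuousLinearMap (b.coord a)‖ * ‖u‖ :=
      (LinearMap.toContinuousLinearMap (b.coord a)).le_opNorm u
    have h3 : r ^ a.1 ≤ r := by
      simpa using pow_le_pow_of_le_one hr.le hr1 (hc.one_le_fst a)
    rw [h1, norm_smul, norm_mul, Real.norm_eq_abs, Real.norm_eq_abs, abs_of_pos (by positivity)]
    calc r ^ a.1 * |b.coord a u| * ‖b a‖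
        ≤ r * (‖LinearMap.toContinuousLinearMap (b.coord a)‖ * ‖u‖) * ‖b a‖ := by gcongr
      _ = N a * (r * ‖u‖) := by rw [hN]; ring
  calc _ ≤ ∑ a, N a * (r * ‖u‖) := Finset.sum_le_sum fun a _ => this a
    _ = (∑ a, N a) * (r * ‖u‖) := by rw [Finset.sum_mul]
    _ ≤ (1 + ∑ a, N a) * (r * ‖u‖) := by gcongr; linarith
    _ = _ := by ring

/-- Near the origin, a small dilation read in the chart contracts and is close to its
differential. -/
lemma exists_contracting_dil (hδ : IsScalableGroup δ) :
    ∃ r θ K ρ : ℝ, 0 < r ∧ r < 1 ∧ 0 < θ ∧ θ < 1 ∧ θ ^ 2 < r ∧ 0 ≤ K ∧ 0 < ρ ∧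
      Metric.closedBall 0 ρ ⊆ c.target ∧ ∀ y, ‖y‖ ≤ ρ →
        c.symm (c (δ r (c.symm y))) = δ r (c.symm y) ∧
        ‖c (δ r (c.symm y)) - dilDiff δ c r y‖ ≤ K * ‖y‖ ^ 2 ∧
        ‖c (δ r (c.symm y))‖ ≤ θ * ‖y‖ := by
  obtain ⟨C, hC1, hC⟩ := hc.exists_norm_dilDiff_le
  have hC0 : 0 < C := zero_lt_one.trans_le hC1
  -- With θ = 2Cr this gives θ ^ 2 = r / 2 < r: quadratic errors along the iterates, of size θ ^
  -- (2k), are then negligible against the weight-one scale r ^ k.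
  set r : ℝ := 1 / (8 * C ^ 2) with hr
  have hr0 : 0 < r := by positivity
  have hr1 : r < 1 := by
    rw [hr, div_lt_one (by positivity)]; nlinarith
  have hsc := hc.toIsSmoothCoordinate
  have hΔ0 : c (δ r (c.symm 0)) = 0 := by rw [hsc.symm_zero, hδ.dil_one, hsc.map_one]
  obtain ⟨K, hK, ρ₁, hρ₁, hquad⟩ := ContDiffAt.exists_norm_sub_fderiv_le_sq
    (hc.contDiffAt_dil r hr0.ne') hΔ0
  have hmem : ∀ᶠ y in 𝓝 (0 : E), δ r (c.symm y) ∈ c.source := by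
    have : Tendsto (fun y => δ r (c.symm y)) (𝓝 0) (𝓝 1) := by
      have h := (hδ.continuous_dil r).continuousAt.comp (f := c.symm) hsc.continuousAt_symm
      have := h.tendsto
      simpa [Function.comp_def, hsc.symm_zero, hδ.dil_one] using this
    exact this.eventually hsc.eventually_mem
  obtain ⟨ρ₂, hρ₂, hsub⟩ := Metric.nhds_basis_closedBall.mem_iff.1
    (inter_mem hmem (c.open_target.mem_nhds hsc.zero_mem))
  have hθ : (2 * C * r) ^ 2 < r := by
    have : (2 * C * r) ^ 2 = r * (4 * C ^ 2 * r) := by ring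
    rw [this]
    have h2 : 4 * C ^ 2 * r = 1 / 2 := by rw [hr]; field_simp; norm_num
    rw [h2]; linarith
  have hθ0 : 0 < 2 * C * r := by positivity
  -- The last bound on the radius gives K ‖y‖ ≤ C r, so the linear part and the quadratic error
  -- contribute at most C r ‖y‖ each.
  refine ⟨r, 2 * C * r, K, min (min ρ₁ ρ₂) (C * r / (K + 1)), hr0, hr1, hθ0, ?_, hθ, hK,
    by positivity, ?_, fun y hy => ?_⟩
  · nlinarith
  · exact (Metric.closedBall_subset_closedBall ((min_le_left _ _).trans (min_le_right _ _))).trans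
      fun y hy => (hsub hy).2
  · have hy1 : ‖y‖ ≤ ρ₁ := hy.trans ((min_le_left _ _).trans (min_le_left _ _))
    have hy2 : ‖y‖ ≤ ρ₂ := hy.trans ((min_le_left _ _).trans (min_le_right _ _))
    have hy3 : ‖y‖ ≤ C * r / (K + 1) := hy.trans (min_le_right _ _)
    refine ⟨c.left_inv (hsub (by simpa using hy2)).1, hquad y hy1, ?_⟩
    have h1 := norm_sub_norm_le (c (δ r (c.symm y))) (dilDiff δ c r y)
    have h2 := hquad y hy1
    have h3 := hC r hr0 hr1.le y
    have h4 : K * ‖y‖ ≤ C * r := by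
      rw [le_div_iff₀ (by positivity)] at hy3
      nlinarith [norm_nonneg y]
    have h5 : K * ‖y‖ ^ 2 ≤ C * r * ‖y‖ := by
      rw [pow_two, ← mul_assoc]; gcongr
    change ‖_ - dilDiff δ c r y‖ ≤ _ at h2
    linarith

end IsStratifiedChart

end Spanning
end CarnotNull

namespace CarnotNull

/-! ### The velocities of a dense family of one-parameter subgroups span the first layer -/

section Spanning

variable {H E ι : Type*} [Group H] [TopologicalSpace H] [IsTopologicalGroup H]
  [NormedAddCommGroup E] [NormedSpace ℝ E] [FiniteDimensional ℝ E]

namespace IsStratifiedChart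

variable {δ : ℝ → H → H} {c : OpenPartialHomeomorph H E} {V : ℕ → Submodule ℝ E}
  (hc : IsStratifiedChart δ c V)

include hc

/-- The renormalized functions a_k(p) = r^(-k) α(c(δ_{r^k} p)) are asymptotically additive in p and
tend to 0 on the generators. They stay within O(‖y‖²) of α(y) near the identity, uniformly in k.
Density then gives a_k → 0 everywhere, so |α(y)| = O(‖y‖²) near 0 and the linear α vanishes. -/
lemma functional_eq_zero (hδ : IsScalableGroup δ) {γ : ι → ℝ → H}
    (hadd : ∀ i s t, γ i (s + t) = γ i s * γ i t) (hdil : ∀ i r t, δ r (γ i t) = γ i (r * t))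
    {v : ι → E} (hv : ∀ i, HasStrictDerivAt (fun t => c (γ i t)) (v i) 0)
    (hdense : Dense (Subgroup.closure {g | ∃ i t, g = γ i t} : Set H))
    (α : E →L[ℝ] ℝ) (hα : ∀ r : ℝ, r ≠ 0 → ∀ u, α (dilDiff δ c r u) = r * α u)
    (hαv : ∀ i, α (v i) = 0) : α = 0 := by
  have hsc := hc.toIsSmoothCoordinate
  obtain ⟨r, θ, K, ρ, hr0, hr1, hθ0, hθ1, hθr, hK, hρ, htgt, hloc⟩ := hc.exists_contracting_dil hδ
  have hγ0 : ∀ i, γ i 0 = 1 := fun i => by simpa using hadd i 0 0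
  set q : ℝ := θ ^ 2 / r with hq
  have hq0 : 0 ≤ q := by positivity
  have hq1 : q < 1 := (div_lt_one hr0).2 hθr
  let a : ℕ → H → ℝ := fun k p => (r ^ k)⁻¹ * α (c (δ (r ^ k) p))
  have hiter : ∀ y, ‖y‖ ≤ ρ → ∀ k : ℕ, ‖c (δ (r ^ k) (c.symm y))‖ ≤ θ ^ k * ‖y‖ ∧
      c.symm (c (δ (r ^ k) (c.symm y))) = δ (r ^ k) (c.symm y) := by
    intro y hy k
    induction k with
    | zero =>
      have hy' : y ∈ c.target := htgt (by simpa using hy)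
      simp [hδ.one_dil, c.right_inv hy']
    | succ k ih =>
      obtain ⟨h1, h2⟩ := ih
      have h3 : ‖c (δ (r ^ k) (c.symm y))‖ ≤ ρ := h1.trans
        ((mul_le_of_le_one_left (norm_nonneg _) (pow_le_one₀ hθ0.le hθ1.le)).trans hy)
      obtain ⟨h4, -, h5⟩ := hloc _ h3
      rw [h2, hδ.comp, ← pow_succ'] at h4 h5
      refine ⟨h5.trans ?_, h4⟩
      rw [pow_succ', mul_assoc]
      gcongr
  set B : ℝ := ‖α‖ * K * r⁻¹ * (1 - q)⁻¹ with hB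
  -- By weight one, a_(k+1) - a_k sees only the quadratic error of one dilation, of size (θ ^ 2 / r)
  -- ^ k ‖y‖²; the geometric series is summed from a_0 = α.
  have hnear : ∀ y, ‖y‖ ≤ ρ → ∀ k, |a k (c.symm y) - α y| ≤ B * ‖y‖ ^ 2 := by
    intro y hy k
    have hstep : ∀ k, |a (k + 1) (c.symm y) - a k (c.symm y)|
        ≤ ‖α‖ * K * r⁻¹ * ‖y‖ ^ 2 * q ^ k := fun k => by
      obtain ⟨h1, h2⟩ := hiter y hy k
      have h3 : ‖c (δ (r ^ k) (c.symm y))‖ ≤ ρ := h1.trans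
        ((mul_le_of_le_one_left (norm_nonneg _) (pow_le_one₀ hθ0.le hθ1.le)).trans hy)
      obtain ⟨-, h4, -⟩ := hloc _ h3
      rw [h2, hδ.comp, ← pow_succ'] at h4
      set z := c (δ (r ^ k) (c.symm y)) with hz
      have e : a (k + 1) (c.symm y) - a k (c.symm y)
          = (r ^ (k + 1))⁻¹ * α (c (δ (r ^ (k + 1)) (c.symm y)) - dilDiff δ c r z) := by
        simp only [a, map_sub, hα r hr0.ne']
        rw [← hz]
        field_simp
        ring
      rw [e, abs_mul, abs_of_pos (by positivity)]
      have h5 := α.le_opNorm (c (δ (r ^ (k + 1)) (c.symm y)) - dilDiff δ c r z)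
      rw [Real.norm_eq_abs] at h5
      calc (r ^ (k + 1))⁻¹ * |α (c (δ (r ^ (k + 1)) (c.symm y)) - dilDiff δ c r z)|
          ≤ (r ^ (k + 1))⁻¹ * (‖α‖ * (K * (θ ^ k * ‖y‖) ^ 2)) := by
            refine mul_le_mul_of_nonneg_left (h5.trans ?_) (by positivity)
            refine mul_le_mul_of_nonneg_left (h4.trans ?_) (norm_nonneg _)
            gcongr
        _ = _ := by
          rw [hq, div_pow, pow_succ', mul_pow, pow_right_comm]
          field_simp
    have hsum : ∀ k, |a k (c.symm y) - α y|
        ≤ ‖α‖ * K * r⁻¹ * ‖y‖ ^ 2 * ∑ j ∈ Finset.range k, q ^ j := fun k => by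
      induction k with
      | zero =>
        have hy' : y ∈ c.target := htgt (by simpa using hy)
        simp [a, hδ.one_dil, c.right_inv hy']
      | succ k ih =>
        rw [Finset.sum_range_succ, mul_add]
        have := abs_add_le (a (k + 1) (c.symm y) - a k (c.symm y)) (a k (c.symm y) - α y)
        rw [sub_add_sub_cancel] at this
        linarith [hstep k]
    have hgeo : ∑ j ∈ Finset.range k, q ^ j ≤ (1 - q)⁻¹ := by
      rw [← tsum_geometric_of_lt_one hq0 hq1]
      exact (summable_geometric_of_lt_one hq0 hq1).sum_le_tsum _ fun j _ => by positivity
    calc _ ≤ _ := hsum k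
      _ ≤ ‖α‖ * K * r⁻¹ * ‖y‖ ^ 2 * (1 - q)⁻¹ := by gcongr
      _ = _ := by rw [hB]; ring
  have hdecay : ∀ p, ∃ M : ℝ, 0 ≤ M ∧ ∀ᶠ k : ℕ in atTop,
      ‖c (δ (r ^ k) p)‖ ≤ M * θ ^ k ∧ δ (r ^ k) p ∈ c.source := by
    intro p
    have ht := hδ.tendsto_dil_pow hr0.le hr1 p
    have hc0 : Tendsto (fun k : ℕ => c (δ (r ^ k) p)) atTop (𝓝 0) := by
      have := (c.continuousAt hsc.one_mem).tendsto.comp ht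
      rwa [hsc.map_one] at this
    have h1 := hc0.norm.eventually_lt_const (by simpa using hρ)
    have h2 := ht.eventually hsc.eventually_mem
    obtain ⟨k₀, hk₀⟩ := (h1.and h2).exists
    set y := c (δ (r ^ k₀) p) with hy
    have hys : c.symm y = δ (r ^ k₀) p := c.left_inv hk₀.2
    refine ⟨‖y‖ / θ ^ k₀, by positivity, ?_⟩
    filter_upwards [h2, eventually_ge_atTop k₀] with k hk hkk
    refine ⟨?_, hk⟩
    obtain ⟨j, rfl⟩ := Nat.exists_eq_add_of_le hkk
    have := (hiter y hk₀.1.le j).1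
    rw [hys, hδ.comp, ← pow_add, add_comm j] at this
    refine this.trans (le_of_eq ?_)
    rw [pow_add]; field_simp
  -- In the chart the product is x + y plus a quadratic error; after k dilations this error is O(θ ^
  -- (2k)) and is divided by r ^ k.
  have hmul : ∀ p g, Tendsto (fun k => a k (p * g) - a k p - a k g) atTop (𝓝 0) := by
    intro p g
    obtain ⟨M, hM0, hM⟩ := hdecay p
    obtain ⟨N, hN0, hN⟩ := hdecay g
    obtain ⟨K₂, hK₂, ρ₂, hρ₂, hquad⟩ := ContDiffAt.exists_norm_sub_fderiv_le_sq
      hsc.contDiffAt_mul hsc.localMul_zero_left.self_of_nhds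
    rw [hsc.hasStrictFDerivAt_localMul.hasFDerivAt.fderiv] at hquad
    have hθk : Tendsto (fun k : ℕ => (M + N) * θ ^ k) atTop (𝓝 0) := by
      simpa using (tendsto_pow_atTop_nhds_zero_of_lt_one hθ0.le hθ1).const_mul (M + N)
    have hqk : Tendsto (fun k : ℕ => ‖α‖ * (K₂ * (M + N) ^ 2) * q ^ k) atTop (𝓝 0) := by
      simpa using (tendsto_pow_atTop_nhds_zero_of_lt_one hq0 hq1).const_mul _
    refine squeeze_zero_norm' ?_ hqk
    filter_upwards [hM, hN, hθk.eventually_lt_const hρ₂] with k ⟨h1, h2⟩ ⟨h3, h4⟩ h5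
    set x := c (δ (r ^ k) p) with hx
    set y := c (δ (r ^ k) g) with hy
    have hxy : ‖(x, y)‖ ≤ (M + N) * θ ^ k := by
      rw [Prod.norm_def]
      refine max_le (h1.trans ?_) (h3.trans ?_) <;> gcongr <;> linarith
    have h6 := hquad (x, y) (hxy.trans h5.le)
    have h7 : localMul c (x, y) = c (δ (r ^ k) (p * g)) := by
      simp only [localMul]
      rw [hx, hy, c.left_inv h2, c.left_inv h4, ← hδ.map_mul _ (by positivity)]
    rw [h7] at h6
    have e : a k (p * g) - a k p - a k g
        = (r ^ k)⁻¹ * α (c (δ (r ^ k) (p * g)) - (x + y)) := by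
      simp only [a, map_sub, map_add]; ring
    rw [e, norm_mul, Real.norm_of_nonneg (by positivity)]
    have h8 := α.le_opNorm (c (δ (r ^ k) (p * g)) - (x + y))
    have h9 : ‖c (δ (r ^ k) (p * g)) - (x + y)‖ ≤ K₂ * ((M + N) * θ ^ k) ^ 2 :=
      (show ‖c (δ (r ^ k) (p * g)) - (x + y)‖ ≤ K₂ * ‖(x, y)‖ ^ 2 from h6).trans (by gcongr)
    calc (r ^ k)⁻¹ * ‖α (c (δ (r ^ k) (p * g)) - (x + y))‖
        ≤ (r ^ k)⁻¹ * (‖α‖ * (K₂ * ((M + N) * θ ^ k) ^ 2)) :=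
          mul_le_mul_of_nonneg_left (h8.trans (mul_le_mul_of_nonneg_left h9 (norm_nonneg _)))
            (by positivity)
      _ = _ := by rw [hq, div_pow, mul_pow, pow_right_comm]; field_simp
  have hone : ∀ k, a k 1 = 0 := fun k => by simp [a, hδ.dil_one, hsc.map_one]
  have hgen : ∀ g ∈ Subgroup.closure {g | ∃ i t, g = γ i t},
      Tendsto (fun k => a k g) atTop (𝓝 0) := by
    intro g hg
    induction hg using Subgroup.closure_induction with
    | mem g hg =>
      obtain ⟨i, t, rfl⟩ := hg
      have hd : HasDerivAt (fun s => c (γ i (s * t))) (t • v i) 0 := by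
        have h0 : HasDerivAt (fun s => c (γ i s)) (v i) (0 * t) := by
          rw [zero_mul]; exact (hv i).hasDerivAt
        exact HasDerivAt.scomp (h := fun s : ℝ => s * t) 0 h0
          (((hasDerivAt_id (0 : ℝ)).mul_const t).congr_deriv (one_mul t))
      have h1 := hasDerivAt_iff_tendsto_slope_zero.1 hd
      have h2 : Tendsto (fun k : ℕ => r ^ k) atTop (𝓝[≠] 0) :=
        tendsto_nhdsWithin_iff.2 ⟨tendsto_pow_atTop_nhds_zero_of_lt_one hr0.le hr1,
          Eventually.of_forall fun k => (pow_pos hr0 k).ne'⟩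
      have h3 := (α.continuous.tendsto _).comp (h1.comp h2)
      rw [map_smul, hαv, smul_zero] at h3
      refine h3.congr fun k => ?_
      simp [a, hdil, hγ0, hsc.map_one]
    | one => simp [hone]
    | mul p g _ _ hp hg =>
      have := ((hmul p g).add hp).add hg
      simp only [add_zero] at this
      exact this.congr fun k => by ring
    | inv g _ hg =>
      have := ((hmul g g⁻¹).add hg).neg
      simpa [hone] using this
  -- Write p = (p g⁻¹) g with g in the dense subgroup and p g⁻¹ so close to 1 that `hnear` makes its
  -- contribution small for all k.
  have hall : ∀ p, Tendsto (fun k => a k p) atTop (𝓝 0) := by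
    intro p
    rw [Metric.tendsto_nhds]
    intro ε hε
    have hcq : Tendsto (fun g => c (p * g⁻¹)) (𝓝 p) (𝓝 0) := by
      have h1 : Tendsto (fun g => p * g⁻¹) (𝓝 p) (𝓝 1) :=
        (continuous_const.mul continuous_inv).tendsto' p 1 (by simp)
      have := (c.continuousAt hsc.one_mem).tendsto.comp h1
      rwa [hsc.map_one] at this
    have hsm : ∀ᶠ g in 𝓝 p, p * g⁻¹ ∈ c.source := by
      have h1 : Tendsto (fun g => p * g⁻¹) (𝓝 p) (𝓝 1) :=
        (continuous_const.mul continuous_inv).tendsto' p 1 (by simp)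
      exact h1.eventually hsc.eventually_mem
    have hbd : Tendsto (fun g => |α (c (p * g⁻¹))| + B * ‖c (p * g⁻¹)‖ ^ 2) (𝓝 p) (𝓝 0) := by
      have h1 : Continuous fun y : E => |α y| + B * ‖y‖ ^ 2 := by fun_prop
      exact (h1.tendsto' 0 0 (by simp)).comp hcq
    have hev := (hbd.eventually_lt_const (half_pos hε)).and
      (hsm.and (hcq.norm.eventually_lt_const (by simpa using hρ)))
    obtain ⟨g, hgΓ, hg⟩ := hdense.inter_nhds_nonempty hev
    obtain ⟨h1, h2, h3⟩ := hg
    have h4 := (hmul (p * g⁻¹) g).add (hgen g hgΓ)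
    simp only [inv_mul_cancel_right, add_zero] at h4
    filter_upwards [Metric.tendsto_nhds.1 h4 _ (half_pos hε)] with k hk
    have h5 := hnear _ h3.le k
    rw [c.left_inv h2] at h5
    rw [Real.dist_eq, sub_zero] at hk ⊢
    have h6 := abs_sub_abs_le_abs_sub (a k (p * g⁻¹)) (α (c (p * g⁻¹)))
    have h7 : a k p = (a k p - a k (p * g⁻¹) - a k g + a k g) + a k (p * g⁻¹) := by ring
    rw [h7]
    refine (abs_add_le _ _).trans_lt ?_
    linarith
  ext u
  by_contra hne
  have hne : α u ≠ 0 := hne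
  have hlim : ∀ y, ‖y‖ ≤ ρ → |α y| ≤ B * ‖y‖ ^ 2 := fun y hy => by
    have h1 : Tendsto (fun k => |a k (c.symm y) - α y|) atTop (𝓝 |0 - α y|) :=
      ((hall (c.symm y)).sub_const _).abs
    rw [zero_sub, abs_neg] at h1
    exact le_of_tendsto' h1 fun k => hnear y hy k
  have h1 : ∀ᶠ ε : ℝ in 𝓝[>] 0, |α u| ≤ B * ‖u‖ ^ 2 * ε := by
    have h2 : Tendsto (fun ε : ℝ => ‖ε • u‖) (𝓝 0) (𝓝 0) :=
      (by fun_prop : Continuous fun ε : ℝ => ‖ε • u‖).tendsto' 0 0 (by simp)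
    filter_upwards [nhdsWithin_le_nhds (h2.eventually_lt_const hρ), self_mem_nhdsWithin]
      with ε h3 h4
    have h4 : 0 < ε := h4
    have h5 := hlim _ h3.le
    rw [map_smul, smul_eq_mul, abs_mul, abs_of_pos h4, norm_smul, Real.norm_of_nonneg h4.le] at h5
    have h6 : ε * |α u| ≤ ε * (B * ‖u‖ ^ 2 * ε) := by linarith [h5]
    exact le_of_mul_le_mul_left h6 h4
  have h2 : Tendsto (fun ε : ℝ => B * ‖u‖ ^ 2 * ε) (𝓝[>] 0) (𝓝 0) :=
    ((by fun_prop : Continuous fun ε : ℝ => B * ‖u‖ ^ 2 * ε).tendsto' 0 0 (by simp)).mono_left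
      nhdsWithin_le_nhds
  have h3 := ge_of_tendsto h2 h1
  exact hne (abs_eq_zero.1 (le_antisymm h3 (abs_nonneg _)))

-- Differentiate δ_r(γ(t)) = γ(rt) at t = 0.
omit [IsTopologicalGroup H] [FiniteDimensional ℝ E] in
lemma dilDiff_deriv {γ : ℝ → H} (hγ : Continuous γ)
    (hadd : ∀ s t, γ (s + t) = γ s * γ t) (hdil : ∀ r t, δ r (γ t) = γ (r * t))
    {v : E} (hv : HasStrictDerivAt (fun t => c (γ t)) v 0) {r : ℝ} (hr : r ≠ 0) :
    dilDiff δ c r v = r • v := by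
  have hsc := hc.toIsSmoothCoordinate
  have hγ0 : γ 0 = 1 := by simpa using hadd 0 0
  have h1 : HasFDerivAt (fun y => c (δ r (c.symm y))) (dilDiff δ c r) (c (γ 0)) := by
    rw [hγ0, hsc.map_one]
    exact ((hc.contDiffAt_dil r hr).differentiableAt (by simp)).hasFDerivAt
  have h2 := h1.comp_hasDerivAt (0 : ℝ) hv.hasDerivAt
  have h3 : HasDerivAt (fun t => c (γ (r * t))) (r • v) 0 := by
    have h0 : HasDerivAt (fun s => c (γ s)) v (r * 0) := by
      rw [mul_zero]; exact hv.hasDerivAt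
    exact HasDerivAt.scomp (h := fun s : ℝ => r * s) 0 h0
      (((hasDerivAt_id (0 : ℝ)).const_mul r).congr_deriv (mul_one r))
  refine h2.unique (h3.congr_of_eventuallyEq ?_)
  have hmem : ∀ᶠ t in 𝓝 (0 : ℝ), γ t ∈ c.source := by
    have := hγ.tendsto 0
    rw [hγ0] at this
    exact this.eventually hsc.eventually_mem
  filter_upwards [hmem] with t ht
  simp only [Function.comp]
  rw [c.left_inv ht, hdil]

/-- A vector of V 1 outside the span is detected by a functional β that kills the span. Composed
with the projection to the first layer, β becomes homogeneous of weight one; it still kills the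
velocities, which lie in the first layer, so `functional_eq_zero` applies. -/
theorem layer_one_le_span (hδ : IsScalableGroup δ) {γ : ι → ℝ → H}
    (hγ : ∀ i, Continuous (γ i))
    (hadd : ∀ i s t, γ i (s + t) = γ i s * γ i t) (hdil : ∀ i r t, δ r (γ i t) = γ i (r * t))
    {v : ι → E} (hv : ∀ i, HasStrictDerivAt (fun t => c (γ i t)) (v i) 0)
    (hdense : Dense (Subgroup.closure {g | ∃ i t, g = γ i t} : Set H)) :
    V 1 ≤ Submodule.span ℝ (Set.range v) := by
  classical
  intro u hu
  by_contra hnot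
  obtain ⟨β, hβu, hβ⟩ := Submodule.exists_le_ker_of_notMem hnot
  set b := layerBasis hc.isInternal with hb
  -- the projection onto the first layer
  let π : E →ₗ[ℝ] E := b.constr ℝ fun a => if a.1 = 1 then b a else 0
  have hπ : ∀ w, dilDiff δ c 2 w = (2 : ℝ) • w → π w = w := by
    intro w hw
    have h1 : ∀ a, b.repr w a • (if a.1 = 1 then b a else 0) = b.repr w a • b a := fun a => by
      split_ifs with ha
      · rfl
      · have : b.repr w a = 0 := hc.coord_eq_zero hw ha
        rw [this, zero_smul, zero_smul]
    calc π w = (b.repr w).sum fun a x => x • (if a.1 = 1 then b a else 0) :=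
          b.constr_apply ℝ _ _
      _ = (b.repr w).sum fun a x => x • b a := by
        refine Finsupp.sum_congr fun a _ => h1 a
      _ = w := b.linearCombination_repr w
  let α : E →L[ℝ] ℝ := LinearMap.toContinuousLinearMap (β.comp π)
  have hα0 : α = 0 := by
    refine hc.functional_eq_zero hδ hadd hdil hv hdense α (fun r hr w => ?_) fun i => ?_
    · have : (β.comp π).comp (dilDiff δ c r : E →ₗ[ℝ] E) = r • β.comp π := by
        refine b.ext fun a => ?_
        simp only [LinearMap.comp_apply, ContinuousLinearMap.coe_coe, LinearMap.smul_apply]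
        rw [hb, hc.dilDiff_layerBasis hr, ← hb, map_smul]
        simp only [π, Module.Basis.constr_basis]
        split_ifs with ha
        · rw [ha, pow_one, map_smul]
        · simp
      exact DFunLike.congr_fun this w
    · change β (π (v i)) = 0
      rw [hπ _ (hc.dilDiff_deriv (hγ i) (hadd i) (hdil i) (hv i) two_ne_zero)]
      exact hβ (Submodule.subset_span ⟨i, rfl⟩)
  have h2 : π u = u := hπ u ((hc.fderiv_dil 2 two_ne_zero 1 u hu).trans (by rw [pow_one]))
  have h3 : β (π u) = 0 := DFunLike.congr_fun hα0 u
  rw [h2] at h3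
  exact hβu h3

end IsStratifiedChart

end Spanning
end CarnotNull

namespace CarnotNull

/-! ### Submersions and Haar measure: pulling back null sets -/

section Submersion

variable {E F : Type*} [NormedAddCommGroup E] [NormedSpace ℝ E] [FiniteDimensional ℝ E]
  [MeasurableSpace E] [BorelSpace E] [NormedAddCommGroup F] [NormedSpace ℝ F]
  [FiniteDimensional ℝ F] [MeasurableSpace F] [BorelSpace F]

/-- Haar measure and full-dimensional Hausdorff measure have the same null sets, and Lipschitz maps
do not create Hausdorff measure. -/
lemma LipschitzOnWith.addHaar_image_eq_zero (μ : Measure E) [μ.IsAddHaarMeasure] {K : NNReal}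
    {f : E → E} {s : Set E} (hf : LipschitzOnWith K f s) (hs : μ s = 0) : μ (f '' s) = 0 := by
  have h1 : μ ≪ (μH[Module.finrank ℝ E] : Measure E) :=
    Measure.absolutelyContinuous_isAddHaarMeasure μ _
  have h2 : (μH[Module.finrank ℝ E] : Measure E) ≪ μ :=
    Measure.absolutelyContinuous_isAddHaarMeasure _ μ
  have h3 := hf.hausdorffMeasure_image_le (d := Module.finrank ℝ E) (by positivity)
  rw [h2 hs, mul_zero] at h3
  exact h1 (le_antisymm h3 bot_le)

/-- Near a point where it is strictly differentiable with surjective differential, a map pulls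
null sets back to null sets. -/
lemma HasStrictFDerivAt.exists_nhds_measure_eq_zero (μ : Measure E) [μ.IsAddHaarMeasure]
    (ν : Measure F) [ν.IsAddHaarMeasure] {f : F → E} {D : F →L[ℝ] E} {a : F}
    (hf : HasStrictFDerivAt f D a) (hD : D.range = ⊤) :
    ∃ U ∈ 𝓝 a, ∀ S ⊆ U, MeasurableSet S → μ (f '' S) = 0 → ν S = 0 := by
  obtain ⟨L₀, hL₀⟩ := (D : F →ₗ[ℝ] E).exists_rightInverse_of_surjective hD
  let L : E →L[ℝ] F := LinearMap.toContinuousLinearMap L₀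
  have hL : ∀ s, D (L s) = s := fun s => DFunLike.congr_fun hL₀ s
  -- This constant leaves an error at most ‖s - s'‖ / 2 along the range of the right inverse L, so f
  -- is anti-Lipschitz there with constant 2.
  obtain ⟨U, hU, happ⟩ := hf.approximates_deriv_on_nhds (c := (1 / 2 / (‖L‖₊ + 1)))
    (Or.inr (by positivity))
  refine ⟨U, hU, fun S hSU hS hfS => ?_⟩
  have hslice : ∀ τ : F, μ {s : E | τ + L s ∈ S} = 0 := by
    intro τ
    set A : Set E := {s : E | τ + L s ∈ S} with hA
    set φ : E → E := fun s => f (τ + L s) with hφ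
    have hanti : ∀ s ∈ A, ∀ s' ∈ A, dist s s' ≤ 2 * dist (φ s) (φ s') := by
      intro s hs s' hs'
      have h1 := happ (τ + L s) (hSU hs) (τ + L s') (hSU hs')
      have h2 : τ + L s - (τ + L s') = L (s - s') := by rw [map_sub]; abel
      rw [h2, hL] at h1
      have h3 : ((1 / 2 / (‖L‖₊ + 1) : NNReal) : ℝ) * ‖L (s - s')‖ ≤ 1 / 2 * ‖s - s'‖ := by
        have h4 := L.le_opNorm (s - s')
        push_cast
        calc 1 / 2 / (‖L‖ + 1) * ‖L (s - s')‖ ≤ 1 / 2 / (‖L‖ + 1) * ((‖L‖ + 1) * ‖s - s'‖) := by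
              gcongr; nlinarith [norm_nonneg (s - s')]
          _ = _ := by field_simp
      have h5 := norm_sub_norm_le (s - s') (φ s - φ s')
      rw [norm_sub_rev (s - s')] at h5
      rw [dist_eq_norm, dist_eq_norm]
      have h6 : ‖φ s - φ s' - (s - s')‖ ≤ 1 / 2 * ‖s - s'‖ := h1.trans h3
      linarith
    have hinj : Set.InjOn φ A := fun s hs s' hs' h => by
      have := hanti s hs s' hs'
      rw [h, dist_self, mul_zero] at this
      exact dist_le_zero.1 this
    have hnull : μ (φ '' A) = 0 := measure_mono_null (by
      rintro _ ⟨s, hs, rfl⟩; exact ⟨_, hs, rfl⟩) hfS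
    have hlip : LipschitzOnWith 2 (Function.invFunOn φ A) (φ '' A) := by
      refine LipschitzOnWith.of_dist_le_mul ?_
      rintro _ ⟨s, hs, rfl⟩ _ ⟨s', hs', rfl⟩
      rw [hinj.leftInvOn_invFunOn hs, hinj.leftInvOn_invFunOn hs']
      exact hanti s hs s' hs'
    have := LipschitzOnWith.addHaar_image_eq_zero μ hlip hnull
    rwa [hinj.leftInvOn_invFunOn.image_image] at this
  have hmeas : MeasurableSet {p : F × E | p.1 + L p.2 ∈ S} :=
    (by fun_prop : Measurable fun p : F × E => p.1 + L p.2) hS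
  -- Fubini in both orders: the sections for fixed τ are null, while those for fixed s are
  -- translates of S and all have measure ν S.
  have hprod : (ν.prod μ) {p : F × E | p.1 + L p.2 ∈ S} = 0 := by
    rw [Measure.prod_apply hmeas]
    simp only [Set.preimage_ofPred_eq, hslice, lintegral_zero]
  rw [Measure.prod_apply_symm hmeas] at hprod
  simp only [Set.preimage_ofPred_eq] at hprod
  have hconst : ∀ s : E, ν {τ | τ + L s ∈ S} = ν S := fun s =>
    measure_preimage_add_right ν (L s) S
  simp only [hconst, lintegral_const, mul_eq_zero] at hprod
  exact hprod.resolve_right (isOpen_univ.measure_pos μ Set.univ_nonempty).ne'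

end Submersion

/-! ### Haar null sets in coordinates and under word maps -/

section Chart

variable {H E : Type*} [Group H] [TopologicalSpace H] [IsTopologicalGroup H]
  [SecondCountableTopology H] [MeasurableSpace H] [BorelSpace H]
  [NormedAddCommGroup E] [NormedSpace ℝ E] [FiniteDimensional ℝ E]
  [MeasurableSpace E] [BorelSpace E]

/-- Haar null sets are null in smooth coordinates. -/
lemma IsSmoothCoordinate.exists_nhds_measure_symm_preimage_eq_zero
    {c : OpenPartialHomeomorph H E} (hc : IsSmoothCoordinate c)
    (vol : Measure H) [vol.IsMulLeftInvariant] [vol.IsOpenPosMeasure] [SigmaFinite vol]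
    (μ : Measure E) [μ.IsAddHaarMeasure] :
    ∃ U ∈ 𝓝 (0 : E), ∀ N, MeasurableSet N → vol N = 0 → μ (U ∩ c.symm ⁻¹' N) = 0 := by
  have hdiff : ∀ᶠ p in 𝓝 ((0 : E), (0 : E)), DifferentiableAt ℝ (localMul c) p := by
    filter_upwards [hc.eventually_contDiffAt_localMul] with p hp
    exact hp.differentiableAt (by simp)
  have hsrc : ∀ᶠ p in 𝓝 ((0 : E), (0 : E)), p.1 ∈ c.target ∧ p.2 ∈ c.target := by
    have h := c.open_target.mem_nhds hc.zero_mem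
    exact (continuous_fst.tendsto ((0 : E), (0 : E))).eventually h |>.and
      ((continuous_snd.tendsto ((0 : E), (0 : E))).eventually h)
  obtain ⟨ρ, hρ, hball⟩ := Metric.eventually_nhds_iff.1 (hdiff.and hsrc)
  have hball' : ∀ x y : E, ‖x‖ < ρ → ‖y‖ < ρ → DifferentiableAt ℝ (localMul c) (x, y) ∧
      x ∈ c.target ∧ y ∈ c.target := fun x y hx hy => by
    refine hball ?_
    rw [Prod.dist_eq]; simpa using ⟨hx, hy⟩
  -- a neighbourhood of the identity moving a small ball inside the ball of radius `ρ`
  have hmove : ∀ᶠ p : H × E in 𝓝 ((1 : H), (0 : E)), p.1⁻¹ * c.symm p.2 ∈ c.source ∧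
      ‖c (p.1⁻¹ * c.symm p.2)‖ < ρ := by
    have h1 : Tendsto (fun p : H × E => p.1⁻¹ * c.symm p.2) (𝓝 ((1 : H), (0 : E))) (𝓝 1) := by
      have ha : ContinuousAt (fun p : H × E => p.1⁻¹ * c.symm p.2) ((1 : H), (0 : E)) :=
        continuousAt_fst.inv.mul (ContinuousAt.comp (f := fun p : H × E => p.2) (g := c.symm)
          hc.continuousAt_symm continuousAt_snd)
      have := ha.tendsto
      simpa [hc.symm_zero] using this
    have h2 : Tendsto (fun g => ‖c g‖) (𝓝 1) (𝓝 0) := by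
      have := (c.continuousAt hc.one_mem).norm.tendsto
      simpa [hc.map_one] using this
    exact (h1.eventually hc.eventually_mem).and ((h2.comp h1).eventually_lt_const hρ)
  rw [nhds_prod_eq] at hmove
  obtain ⟨W, hW, U, hU, hWU⟩ := eventually_prod_iff.1 hmove
  have hW2 : ∀ᶠ g in 𝓝 (1 : H), W g ∧ g ∈ c.source ∧ ‖c g‖ < ρ := by
    have h2 : Tendsto (fun g => ‖c g‖) (𝓝 1) (𝓝 0) := by
      have := (c.continuousAt hc.one_mem).norm.tendsto
      simpa [hc.map_one] using this
    exact hW.and (hc.eventually_mem.and (h2.eventually_lt_const hρ))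
  refine ⟨{y | U y} ∩ c.target, inter_mem hU (c.open_target.mem_nhds hc.zero_mem),
    fun N hN hN0 => ?_⟩
  set Bρ := Metric.ball (0 : E) ρ with hBρ
  have hBt : Bρ ⊆ c.target := fun y hy => (hball' y y (mem_ball_zero_iff.1 hy) (mem_ball_zero_iff.1 hy)).2.1
  classical
  -- A globally measurable extension of the inverse chart, as needed for Fubini.
  let σ : E → H := Bρ.piecewise c.symm (fun _ => 1)
  have hσ : Measurable σ := by
    refine ContinuousOn.measurable_piecewise (c.symm.continuousOn.mono hBt)
      continuousOn_const measurableSet_ball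
  have hmeas : MeasurableSet {p : H × E | p.1 * σ p.2 ∈ N} :=
    (measurable_fst.mul (hσ.comp measurable_snd)) hN
  -- Right translates of Haar null sets are null, so Fubini yields some g near 1 for which the part
  -- of the ball that g c⁻¹ sends into N is null. The left translation by g, differentiable in the
  -- chart, then carries null sets to null sets; no density of Haar measure in the chart is
  -- computed.
  have hprod : (vol.prod μ) {p : H × E | p.1 * σ p.2 ∈ N} = 0 := by
    rw [Measure.prod_apply_symm hmeas]
    have : ∀ y, vol ((fun x => (x, y)) ⁻¹' {p : H × E | p.1 * σ p.2 ∈ N}) = 0 := fun y =>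
      (measure_mul_right_null vol (σ y)).2 hN0
    simp only [this, lintegral_zero]
  have hae := Measure.measure_ae_null_of_prod_null hprod
  have hpos : ∃ g, (W g ∧ g ∈ c.source ∧ ‖c g‖ < ρ) ∧
      μ (Prod.mk g ⁻¹' {p : H × E | p.1 * σ p.2 ∈ N}) = 0 := by
    by_contra! hcon
    have h1 : vol {g | W g ∧ g ∈ c.source ∧ ‖c g‖ < ρ} = 0 :=
      measure_mono_null (fun g hg => hcon g hg) (ae_iff.1 hae)
    exact (vol.measure_pos_of_mem_nhds hW2).ne' h1
  obtain ⟨g, ⟨hgW, hgs, hgρ⟩, hgN⟩ := hpos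
  set Z : Set E := {z | z ∈ Bρ ∧ g * c.symm z ∈ N} with hZ
  have hZ0 : μ Z = 0 := by
    refine measure_mono_null (fun z hz => ?_) hgN
    change g * σ z ∈ N
    rw [show σ z = c.symm z from Set.piecewise_eq_of_mem _ _ _ hz.1]
    exact hz.2
  have hd : DifferentiableOn ℝ (fun z => localMul c (c g, z)) Z := fun z hz =>
    (DifferentiableAt.comp (f := fun z : E => (c g, z)) z
      (hball' (c g) z hgρ (mem_ball_zero_iff.1 hz.1)).1 (by fun_prop)).differentiableWithinAt
  have himg := addHaar_image_eq_zero_of_differentiableOn_of_addHaar_eq_zero μ hd hZ0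
  refine measure_mono_null ?_ himg
  rintro y ⟨⟨hyU, hyt⟩, hyN⟩
  obtain ⟨hz1, hz2⟩ := hWU hgW hyU
  refine ⟨c (g⁻¹ * c.symm y), ⟨mem_ball_zero_iff.2 hz2, ?_⟩, ?_⟩
  · rw [c.left_inv hz1, mul_inv_cancel_left]; exact hyN
  · change c (c.symm (c g) * c.symm (c (g⁻¹ * c.symm y))) = y
    rw [c.left_inv hgs, c.left_inv hz1, mul_inv_cancel_left, c.right_inv hyt]

/-- If the differential of a word map is surjective at a point, the word map pulls Haar null sets
back to Lebesgue null sets near that point. -/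
lemma IsSmoothCoordinate.exists_open_volume_inter_wordMap_preimage_eq_zero
    {c : OpenPartialHomeomorph H E} (hc : IsSmoothCoordinate c)
    (vol : Measure H) [vol.IsMulLeftInvariant] [vol.IsOpenPosMeasure] [SigmaFinite vol]
    {ι : Type*} {γ : ι → ℝ → H} (hγ : ∀ i, Continuous (γ i))
    (hadd : ∀ i s t, γ i (s + t) = γ i s * γ i t) {v : ι → E}
    (hv : ∀ i, HasStrictDerivAt (fun t => c (γ i t)) (v i) 0)
    {n : ℕ} {i : Fin n → ι} {t₀ : Fin n → ℝ} (ht₀ : (wordDiff c γ v n i t₀).range = ⊤) :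
    ∃ B : Set (Fin n → ℝ), IsOpen B ∧ B.Nonempty ∧
      ∀ N, MeasurableSet N → vol N = 0 → volume (B ∩ wordMap γ n i ⁻¹' N) = 0 := by
  obtain ⟨U, hU, hnull⟩ := hc.exists_nhds_measure_symm_preimage_eq_zero vol
    (Measure.addHaar : Measure E)
  have hF := hc.hasStrictFDerivAt_wordMap hγ hadd hv n i t₀
  obtain ⟨S₀, hS₀, hsub⟩ := HasStrictFDerivAt.exists_nhds_measure_eq_zero (Measure.addHaar : Measure E)
    (volume : Measure (Fin n → ℝ)) hF ht₀
  have hcont := continuous_wordMap hγ n i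
  have h1 : Tendsto (fun t => (wordMap γ n i t₀)⁻¹ * wordMap γ n i t) (𝓝 t₀) (𝓝 1) := by
    have : Continuous fun t => (wordMap γ n i t₀)⁻¹ * wordMap γ n i t := by fun_prop
    simpa using this.tendsto t₀
  have h2 : Tendsto (fun t => c ((wordMap γ n i t₀)⁻¹ * wordMap γ n i t)) (𝓝 t₀) (𝓝 0) := by
    have := (c.continuousAt hc.one_mem).tendsto.comp h1
    rwa [hc.map_one] at this
  have hB : {t | t ∈ S₀ ∧ (wordMap γ n i t₀)⁻¹ * wordMap γ n i t ∈ c.source ∧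
      c ((wordMap γ n i t₀)⁻¹ * wordMap γ n i t) ∈ U} ∈ 𝓝 t₀ :=
    Filter.inter_mem hS₀ (Filter.inter_mem (h1.eventually hc.eventually_mem) (h2 hU))
  refine ⟨interior _, isOpen_interior, ⟨t₀, mem_interior_iff_mem_nhds.2 hB⟩, fun N hN hN0 => ?_⟩
  refine hsub _ (fun t ht => (interior_subset ht.1).1)
    (isOpen_interior.measurableSet.inter (hcont.measurable hN)) ?_
  refine measure_mono_null ?_ (hnull ((fun h => wordMap γ n i t₀ * h) ⁻¹' N)
    (measurable_const_mul _ hN) ((measure_preimage_mul vol _ N).trans hN0))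
  rintro _ ⟨t, ⟨htB, htN⟩, rfl⟩
  obtain ⟨-, hs, hu⟩ := interior_subset htB
  refine ⟨hu, ?_⟩
  change wordMap γ n i t₀ * c.symm (c _) ∈ N
  rw [c.left_inv hs, mul_inv_cancel_left]
  exact htN

end Chart
end CarnotNull

namespace CarnotNull

lemma IsCarnotGroup.locallyCompactSpace {H : Type*} [Group H] [TopologicalSpace H]
    {δ : ℝ → H → H} (h : IsCarnotGroup H δ) : LocallyCompactSpace H := by
  obtain ⟨n, _, -⟩ := h
  exact ChartedSpace.locallyCompactSpace (EuclideanSpace ℝ (Fin n)) H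

/-! ### Haar measure and density points on a locally compact metric scalable group -/

section Metric

variable {H : Type*} [Group H] [MetricSpace H] {δ : ℝ → H → H}

namespace IsMetricScalableGroup

variable (hδ : IsMetricScalableGroup δ)

include hδ

lemma dist_dil_one (t : ℝ) (g : H) : dist (δ t g) 1 = |t| * dist g 1 := by
  conv_lhs => rw [← hδ.toIsScalableGroup.dil_one t]
  exact hδ.dist_dil t g 1

lemma dist_mul_right_self (a g : H) : dist (a * g) a = dist g 1 := by
  conv_lhs => rw [← mul_one a, mul_assoc, one_mul]
  exact hδ.dist_mul_left a g 1

lemma preimage_mul_left_closedBall (a : H) (r : ℝ) :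
    (fun g => a * g) ⁻¹' Metric.closedBall a r = Metric.closedBall 1 r := by
  ext g
  simp [hδ.dist_mul_right_self]

lemma image_dil_closedBall {t : ℝ} (ht : t ≠ 0) (r : ℝ) :
    δ t '' Metric.closedBall 1 r = Metric.closedBall 1 (|t| * r) := by
  ext g
  constructor
  · rintro ⟨g, hg, rfl⟩
    rw [Metric.mem_closedBall] at hg ⊢
    rw [hδ.dist_dil_one]
    gcongr
  · intro hg
    refine ⟨δ t⁻¹ g, ?_, ?_⟩
    · rw [Metric.mem_closedBall] at hg ⊢
      rw [hδ.dist_dil_one, abs_inv, inv_mul_le_iff₀ (abs_pos.2 ht)]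
      exact hg
    · rw [hδ.comp, mul_inv_cancel₀ ht, hδ.toIsScalableGroup.one_dil]

/-- One compact ball exists by local compactness; dilations carry it to every radius and
translations to every centre. -/
lemma properSpace [IsTopologicalGroup H] [LocallyCompactSpace H] : ProperSpace H := by
  obtain ⟨r, hr, hcomp⟩ := Metric.exists_isCompact_closedBall (1 : H)
  refine ProperSpace.of_isCompact_closedBall_of_le 1 fun x R hR => ?_
  have h1 : IsCompact (Metric.closedBall (1 : H) R) := by
    have := hcomp.image (hδ.toIsScalableGroup.continuous_dil (R / r))
    rwa [hδ.image_dil_closedBall (by positivity), abs_of_pos (by positivity),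
      div_mul_cancel₀ _ hr.ne'] at this
  have h2 := h1.image (continuous_const_mul x)
  rwa [← hδ.preimage_mul_left_closedBall x,
    Set.image_preimage_eq _ (mul_left_surjective x)] at h2

/-- The dilation is a bijective homomorphism that multiplies distances to `1` by |t|, hence is
proper, so the image measure stays finite on compact sets. -/
lemma isHaarMeasure_map_dil [IsTopologicalGroup H] [ProperSpace H] [MeasurableSpace H]
    [BorelSpace H] (vol : Measure H) [vol.IsHaarMeasure] {t : ℝ} (ht : t ≠ 0) :
    (vol.map (δ t)).IsHaarMeasure := by
  let f : H →* H := ⟨⟨δ t, hδ.toIsScalableGroup.dil_one _⟩, hδ.map_mul _ ht⟩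
  have hf : Continuous f := hδ.toIsScalableGroup.continuous_dil t
  have hprop : Tendsto f (cocompact H) (cocompact H) := by
    rw [Metric.cobounded_eq_cocompact.symm, ← Metric.comap_dist_right_atTop (1 : H),
      tendsto_comap_iff]
    have : ((fun y => dist y 1) ∘ f) = fun g => |t| * dist g 1 := by
      ext g
      exact hδ.dist_dil_one t g
    rw [this]
    exact tendsto_comap.const_mul_atTop (abs_pos.2 ht)
  exact Measure.isHaarMeasure_map vol f hf (hδ.bijective _ ht).2 hprop

lemma haar_preimage_dil_eq_zero [IsTopologicalGroup H] [ProperSpace H] [MeasurableSpace H]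
    [BorelSpace H] (vol : Measure H) [vol.IsHaarMeasure] {t : ℝ} (ht : t ≠ 0) {Z : Set H}
    (hZ : MeasurableSet Z) (h0 : vol Z = 0) : vol (δ t ⁻¹' Z) = 0 := by
  have := hδ.isHaarMeasure_map_dil vol ht
  rw [← Measure.map_apply (hδ.toIsScalableGroup.continuous_dil t).measurable hZ]
  exact Measure.absolutelyContinuous_isHaarMeasure (vol.map (δ t)) vol h0

/-- The image of Haar measure under δ_{1/2} is again Haar, so a constant multiple of it. This gives
doubling without the homogeneous dimension. -/
lemma exists_haar_closedBall_two_mul [IsTopologicalGroup H] [ProperSpace H] [MeasurableSpace H]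
    [BorelSpace H] (vol : Measure H) [vol.IsHaarMeasure] :
    ∃ C : NNReal, ∀ r, vol (Metric.closedBall 1 (2 * r)) = C * vol (Metric.closedBall 1 r) := by
  have h0 : (1 / 2 : ℝ) ≠ 0 := by norm_num
  have hpre : ∀ r, δ (1 / 2) ⁻¹' Metric.closedBall 1 r = Metric.closedBall 1 (2 * r) := fun r => by
    ext g
    change dist (δ (1 / 2) g) 1 ≤ r ↔ dist g 1 ≤ 2 * r
    rw [hδ.dist_dil_one, abs_of_pos (by norm_num)]
    constructor <;> intro h <;> linarith
  have := hδ.isHaarMeasure_map_dil vol h0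
  refine ⟨Measure.haarScalarFactor (vol.map (δ (1 / 2))) vol, fun r => ?_⟩
  have h2 := Measure.isMulLeftInvariant_eq_smul (vol.map (δ (1 / 2))) vol
  rw [← hpre, ← Measure.map_apply (hδ.toIsScalableGroup.continuous_dil _).measurable
    Metric.isClosed_closedBall.measurableSet]
  exact congrArg (fun m : Measure H => m (Metric.closedBall 1 r)) h2

lemma haar_closedBall [IsTopologicalGroup H] [MeasurableSpace H]
    [BorelSpace H] (vol : Measure H) [vol.IsHaarMeasure] (a : H) (r : ℝ) :
    vol (Metric.closedBall a r) = vol (Metric.closedBall 1 r) := by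
  rw [← hδ.preimage_mul_left_closedBall a, measure_preimage_mul]

lemma isUnifLocDoublingMeasure [IsTopologicalGroup H] [ProperSpace H] [MeasurableSpace H]
    [BorelSpace H] (vol : Measure H) [vol.IsHaarMeasure] : IsUnifLocDoublingMeasure vol := by
  obtain ⟨C, hC⟩ := hδ.exists_haar_closedBall_two_mul vol
  refine ⟨C, Eventually.of_forall fun r x => ?_⟩
  rw [hδ.haar_closedBall vol x, hδ.haar_closedBall vol x, hC]

/-- The identity is a density point of a Borel set as soon as the complement has density zero along
closed balls with radii `2 ^ (-n)`. -/
lemma isDensityPointOne_of_tendsto [IsTopologicalGroup H] [ProperSpace H] [MeasurableSpace H]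
    [BorelSpace H] (vol : Measure H) [vol.IsHaarMeasure] {U : Set H} (hU : MeasurableSet U)
    (h : Tendsto (fun n : ℕ => vol (Uᶜ ∩ Metric.closedBall 1 ((1 / 2) ^ n)) /
      vol (Metric.closedBall 1 ((1 / 2) ^ n))) atTop (𝓝 0)) : IsDensityPointOne U := by
  obtain ⟨C, hC⟩ := hδ.exists_haar_closedBall_two_mul vol
  refine ⟨vol, inferInstance, ?_⟩
  have hpos : ∀ r > 0, vol (Metric.ball (1 : H) r) ≠ 0 := fun r hr =>
    (Metric.measure_ball_pos vol 1 hr).ne'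
  have hfin : ∀ r, vol (Metric.ball (1 : H) r) ≠ ⊤ := fun r => measure_ball_lt_top.ne
  have hcompl : Tendsto (fun r : ℝ => vol (Uᶜ ∩ Metric.ball 1 r) / vol (Metric.ball 1 r))
      (𝓝[>] 0) (𝓝 0) := by
    rw [ENNReal.tendsto_nhds_zero] at h ⊢
    intro ε hε
    obtain ⟨ε', hε', hεC⟩ : ∃ ε' > 0, C * ε' ≤ ε := by
      rcases eq_or_ne C 0 with rfl | hC0
      · exact ⟨1, one_pos, by simp⟩
      · exact ⟨ε / C, ENNReal.div_pos hε.ne' ENNReal.coe_ne_top, ENNReal.mul_div_le⟩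
    obtain ⟨n₀, hn₀⟩ := eventually_atTop.1 (h ε' hε')
    filter_upwards [Ioo_mem_nhdsGT (show (0 : ℝ) < (1 / 2) ^ n₀ by positivity)] with r hr
    -- Sandwich r between consecutive powers of 1/2; doubling compares the balls. Only countably
    -- many radii enter the hypothesis, which keeps the set of density points measurable later on.
    obtain ⟨n, hn1, hn2⟩ := exists_nat_pow_near_of_lt_one hr.1
      (hr.2.le.trans (pow_le_one₀ (by norm_num) (by norm_num))) (y := (1 / 2 : ℝ))
      (by norm_num) (by norm_num)
    have hn : n₀ ≤ n := by
      by_contra! hlt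
      have : (1 / 2 : ℝ) ^ n₀ ≤ (1 / 2) ^ (n + 1) :=
        pow_le_pow_of_le_one (by norm_num) (by norm_num) hlt
      linarith [hr.2]
    have h1 : vol (Metric.closedBall (1 : H) ((1 / 2) ^ n)) ≤ C * vol (Metric.ball (1 : H) r) := by
      rw [show ((1 / 2 : ℝ)) ^ n = 2 * (1 / 2) ^ (n + 1) by rw [pow_succ]; ring, hC]
      gcongr
      exact Metric.closedBall_subset_ball hn1
    have h2 : vol (Uᶜ ∩ Metric.ball 1 r) ≤ ε' * (C * vol (Metric.ball (1 : H) r)) := by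
      refine (measure_mono (Set.inter_subset_inter_right _
        ((Metric.ball_subset_ball hn2).trans Metric.ball_subset_closedBall))).trans
        (le_trans ?_ (mul_le_mul_right h1 ε'))
      refine (ENNReal.div_le_iff ?_ ?_).1 (hn₀ n hn)
      · exact (Metric.measure_closedBall_pos vol 1 (by positivity)).ne'
      · exact measure_closedBall_lt_top.ne
    rw [ENNReal.div_le_iff (hpos r hr.1) (hfin r)]
    refine h2.trans ?_
    rw [← mul_assoc, mul_comm ε']
    gcongr
  have hsub := ENNReal.Tendsto.sub (tendsto_const_nhds (x := (1 : ENNReal)) (f := 𝓝[>] (0 : ℝ)))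
    hcompl (Or.inl ENNReal.one_ne_top)
  rw [tsub_zero] at hsub
  refine hsub.congr' ?_
  filter_upwards [self_mem_nhdsWithin] with r hr
  have h3 : vol (U ∩ Metric.ball 1 r) / vol (Metric.ball 1 r)
      + vol (Uᶜ ∩ Metric.ball 1 r) / vol (Metric.ball 1 r) = 1 := by
    rw [← ENNReal.add_div, Set.inter_comm U, Set.inter_comm Uᶜ, ← Set.sdiff_eq,
      measure_inter_add_sdiff _ hU, ENNReal.div_self (hpos r hr) (hfin r)]
  rw [← h3]
  refine ENNReal.add_sub_cancel_right ?_
  refine (ENNReal.div_lt_top ((measure_mono Set.inter_subset_right).trans_lt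
    measure_ball_lt_top).ne (hpos r hr)).ne

/-- Almost every point of a Borel set is a density point, along closed balls with radii
`2 ^ (-n)`. -/
lemma ae_tendsto_compl_closedBall [IsTopologicalGroup H] [ProperSpace H] [MeasurableSpace H]
    [BorelSpace H] (vol : Measure H) [vol.IsHaarMeasure] {S : Set H} (hS : MeasurableSet S) :
    ∀ᵐ h ∂vol, h ∈ S → Tendsto (fun n : ℕ =>
      vol (((fun g => h * g) ⁻¹' S)ᶜ ∩ Metric.closedBall 1 ((1 / 2) ^ n)) /
        vol (Metric.closedBall 1 ((1 / 2) ^ n))) atTop (𝓝 0) := by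
  have := hδ.isUnifLocDoublingMeasure vol
  have hae := IsUnifLocDoublingMeasure.ae_tendsto_measure_inter_div vol S 1
  rw [ae_restrict_iff' hS] at hae
  filter_upwards [hae] with h hh hS'
  have hlim : Tendsto (fun n : ℕ => (1 / 2 : ℝ) ^ n) atTop (𝓝[>] 0) :=
    tendsto_nhdsWithin_iff.2 ⟨tendsto_pow_atTop_nhds_zero_of_lt_one (by norm_num) (by norm_num),
      Eventually.of_forall fun n => by simp⟩
  have h1 := hh hS' (fun _ : ℕ => h) (fun n => (1 / 2 : ℝ) ^ n) hlim
    (Eventually.of_forall fun n => Metric.mem_closedBall_self (by positivity))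
  have hsub := ENNReal.Tendsto.sub (tendsto_const_nhds (x := (1 : ENNReal)) (f := atTop))
    h1 (Or.inl ENNReal.one_ne_top)
  rw [tsub_self] at hsub
  refine hsub.congr fun n => ?_
  have hpos : vol (Metric.closedBall (1 : H) ((1 / 2) ^ n)) ≠ 0 :=
    (Metric.measure_closedBall_pos vol 1 (by positivity)).ne'
  have hfin : vol (Metric.closedBall (1 : H) ((1 / 2) ^ n)) ≠ ⊤ := measure_closedBall_lt_top.ne
  have h2 : vol (S ∩ Metric.closedBall h ((1 / 2) ^ n)) =
      vol ((fun g => h * g) ⁻¹' S ∩ Metric.closedBall 1 ((1 / 2) ^ n)) := by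
    rw [← hδ.preimage_mul_left_closedBall h, ← Set.preimage_inter, measure_preimage_mul]
  have hm : MeasurableSet ((fun g => h * g) ⁻¹' S) := measurable_const_mul h hS
  have h3 : vol ((fun g => h * g) ⁻¹' S ∩ Metric.closedBall 1 ((1 / 2) ^ n)) /
      vol (Metric.closedBall 1 ((1 / 2) ^ n))
      + vol (((fun g => h * g) ⁻¹' S)ᶜ ∩ Metric.closedBall 1 ((1 / 2) ^ n)) /
      vol (Metric.closedBall 1 ((1 / 2) ^ n)) = 1 := by
    rw [← ENNReal.add_div, Set.inter_comm _ (Metric.closedBall _ _),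
      Set.inter_comm _ (Metric.closedBall _ _), ← Set.sdiff_eq,
      measure_inter_add_sdiff _ hm, ENNReal.div_self hpos hfin]
  rw [h2, hδ.haar_closedBall vol h, ← h3]
  refine ENNReal.add_sub_cancel_left ?_
  refine (ENNReal.div_lt_top ((measure_mono Set.inter_subset_right).trans_lt
    measure_closedBall_lt_top).ne hpos).ne

end IsMetricScalableGroup

end Metric

/-! ### Carnot subgroups of the ambient group and density along their cosets -/

section Subgroup

variable {G : Type*} [Group G] [MetricSpace G] {δ : ℝ → G → G}

lemma IsMetricScalableGroup.subgroup (hδ : IsMetricScalableGroup δ) {N : Subgroup G}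
    {δN : ℝ → N → N} (hN : ∀ (t : ℝ) (g : N), (δN t g : G) = δ t g)
    (hsurj : ∀ t : ℝ, t ≠ 0 → δ t '' (N : Set G) = N) : IsMetricScalableGroup δN where
  continuous_uncurry := by
    refine Continuous.subtype_mk (?_ : Continuous fun p : ℝ × N => (δN p.1 p.2 : G)) _ |>.congr
      fun _ => rfl
    simp only [hN]
    exact hδ.continuous_uncurry.comp
      (continuous_fst.prodMk (continuous_subtype_val.comp continuous_snd))
  map_mul t ht g h := Subtype.ext (by simp [hN, hδ.map_mul t ht])
  bijective t ht := by
    refine ⟨fun g h hgh => Subtype.ext ((hδ.bijective t ht).1 ?_), fun g => ?_⟩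
    · rw [← hN, ← hN, hgh]
    · obtain ⟨h, hh, hg⟩ := (hsurj t ht).symm.subset g.2
      exact ⟨⟨h, hh⟩, Subtype.ext (by rw [hN]; exact hg)⟩
  comp s t g := Subtype.ext (by simp [hN, hδ.comp])
  zero g := Subtype.ext (by simp [hN, hδ.zero])
  dist_mul_left a g h := hδ.dist_mul_left a g h
  dist_dil t g h := by
    rw [Subtype.dist_eq, hN, hN, hδ.dist_dil, Subtype.dist_eq]

lemma IsMetricScalableGroup.properSpace_of_isCarnotSubgroup [IsTopologicalGroup G]
    (hδ : IsMetricScalableGroup δ) {N : Subgroup G} (hN : IsCarnotSubgroup δ N) :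
    ProperSpace N := by
  obtain ⟨⟨-, hsurj⟩, δN, hcoe, hcar⟩ := hN
  have := hcar.locallyCompactSpace
  exact (hδ.subgroup hcoe hsurj).properSpace

/-- Each Carnot subgroup in a filtration is proper, hence separable, and their countable union is
dense. -/
lemma IsInfDimCarnotGroup.secondCountableTopology [IsTopologicalGroup G]
    (hG : IsInfDimCarnotGroup δ) : SecondCountableTopology G := by
  obtain ⟨N, hN⟩ := hG.exists_filtration
  have hsep : ∀ m, TopologicalSpace.IsSeparable (N m : Set G) := fun m => by
    have := hG.toIsMetricScalableGroup.properSpace_of_isCarnotSubgroup (hN.isCarnotSubgroup m)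
    have h := TopologicalSpace.isSeparable_range (continuous_subtype_val (p := (· ∈ N m)))
    rwa [Subtype.range_coe_subtype] at h
  have h := (TopologicalSpace.IsSeparable.iUnion hsep).closure
  rw [hN.dense] at h
  have := TopologicalSpace.isSeparable_univ_iff.1 h
  exact UniformSpace.secondCountable_of_separable G

/-- The points of a Borel set which are not density points of it, along the cosets of a Carnot
subgroup, form a set which is Haar null on each coset. -/
lemma IsMetricScalableGroup.exists_measurableSet_not_isDensityPointOne [IsTopologicalGroup G]
    [SecondCountableTopology G] [MeasurableSpace G] [BorelSpace G]
    (hδ : IsMetricScalableGroup δ) {N : Subgroup G} (hN : IsCarnotSubgroup δ N)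
    (vol : Measure N) [vol.IsHaarMeasure] {A : Set G} (hA : MeasurableSet A) :
    ∃ Z : Set G, MeasurableSet Z ∧ (∀ g : G, vol {h : N | g * h ∈ Z} = 0) ∧
      ∀ x ∈ A, x ∉ Z → IsDensityPointOne {h : N | x * h ∈ A} := by
  have := hδ.properSpace_of_isCarnotSubgroup hN
  obtain ⟨⟨-, hsurj⟩, δN, hcoe, hcar⟩ := hN
  have hδN := hδ.subgroup hcoe hsurj
  let f : ℕ → G → ENNReal := fun n x =>
    vol ({h : N | x * h ∈ A}ᶜ ∩ Metric.closedBall 1 ((1 / 2) ^ n)) /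
      vol (Metric.closedBall 1 ((1 / 2) ^ n))
  have hf : ∀ n, Measurable (f n) := fun n => by
    refine Measurable.div_const ?_ _
    have hm : MeasurableSet {p : G × N | p.1 * p.2 ∉ A ∧ p.2 ∈ Metric.closedBall (1 : N)
        ((1 / 2) ^ n)} := by
      refine MeasurableSet.inter ?_ (measurable_snd Metric.isClosed_closedBall.measurableSet)
      exact (measurable_fst.mul (measurable_subtype_coe.comp measurable_snd)) hA.compl
    exact measurable_measure_prodMk_left hm
  -- On the coset of g, f n (g * h) is the density ratio at h of the set {h | g * h ∈ A}, so the
  -- density theorem on N applies to every coset.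
  refine ⟨A ∩ {x | Tendsto (fun n => f n x) atTop (𝓝 0)}ᶜ,
    hA.inter (measurableSet_tendsto _ hf).compl, fun g => ?_, fun x hx hxZ => ?_⟩
  · have hm : MeasurableSet {h : N | g * h ∈ A} :=
      ((measurable_const_mul g).comp measurable_subtype_coe) hA
    refine measure_mono_null (fun h hh => ?_) (ae_iff.1 (hδN.ae_tendsto_compl_closedBall vol hm))
    intro hcon
    refine hh.2 ?_
    have := hcon hh.1
    change Tendsto (fun n => f n (g * h)) atTop (𝓝 0)
    convert this using 6
    ext k
    simp [mul_assoc]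
  · have hx' : Tendsto (fun n => f n x) atTop (𝓝 0) := by
      by_contra h
      exact hxZ ⟨hx, h⟩
    exact hδN.isDensityPointOne_of_tendsto vol
      (((measurable_const_mul x).comp measurable_subtype_coe) hA) hx'

end Subgroup

end CarnotNull

namespace CarnotNull

/-! ### Word maps under dilations and homomorphisms -/

section WordMap

variable {H ι : Type*} [Group H] {γ : ι → ℝ → H}

lemma IsScalableGroup.dil_wordMap [TopologicalSpace H] {δ : ℝ → H → H} (hδ : IsScalableGroup δ)
    (hdil : ∀ i r t, δ r (γ i t) = γ i (r * t)) {r : ℝ} (hr : r ≠ 0) :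
    ∀ (n : ℕ) (i : Fin n → ι) (t : Fin n → ℝ),
      δ r (wordMap γ n i t) = wordMap γ n i (r • t)
  | 0, i, t => hδ.dil_one r
  | n + 1, i, t => by
    change δ r (wordMap γ n (Fin.tail i) (Fin.tail t) * γ (i 0) (t 0)) = _
    rw [hδ.map_mul r hr, hdil, dil_wordMap hδ hdil hr n]
    rfl

lemma map_wordMap {G κ : Type*} [Group G] {γ' : κ → ℝ → G} (f : H →* G) (e : ι → κ)
    (hf : ∀ i t, f (γ i t) = γ' (e i) t) : ∀ (n : ℕ) (i : Fin n → ι) (t : Fin n → ℝ),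
      f (wordMap γ n i t) = wordMap γ' n (fun l => e (i l)) t
  | 0, i, t => map_one f
  | n + 1, i, t => by
    change f (wordMap γ n (Fin.tail i) (Fin.tail t) * γ (i 0) (t 0)) = _
    rw [map_mul, map_wordMap f e hf n, hf]
    rfl

end WordMap

/-! ### The Aronszajn class is a σ-ideal -/

section SigmaIdeal

variable {G : Type*} [Group G] [MeasurableSpace G] {δ : ℝ → G → G} {X : ℕ → G}

lemma nullAlong_mono {Y : G} {E F : Set G} (hE : E ∈ nullAlong δ Y) (hFE : F ⊆ E)
    (hF : MeasurableSet F) : F ∈ nullAlong δ Y :=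
  ⟨hF, fun g => measure_mono_null (fun _ ht => hFE ht) (hE.2 g)⟩

lemma nullAlong_iUnion {Y : G} {E : ℕ → Set G} (hE : ∀ n, E n ∈ nullAlong δ Y) :
    ⋃ n, E n ∈ nullAlong δ Y := by
  refine ⟨MeasurableSet.iUnion fun n => (hE n).1, fun g => ?_⟩
  have : {t : ℝ | g * δ t Y ∈ ⋃ n, E n} = ⋃ n, {t | g * δ t Y ∈ E n} := by ext; simp
  rw [this]
  exact measure_iUnion_null fun n => (hE n).2 g

lemma empty_mem_nullAlong (Y : G) : ∅ ∈ nullAlong δ Y := ⟨MeasurableSet.empty, by simp⟩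

lemma aronszajnClass_mono {E F : Set G} (hE : E ∈ aronszajnClass δ X) (hFE : F ⊆ E)
    (hF : MeasurableSet F) : F ∈ aronszajnClass δ X := by
  obtain ⟨-, S, rfl, hS⟩ := hE
  refine ⟨hF, fun i => F ∩ S i, ?_, fun i =>
    nullAlong_mono (hS i) Set.inter_subset_right (hF.inter (hS i).1)⟩
  rw [← Set.inter_iUnion, Set.inter_eq_left.2 hFE]

lemma aronszajnClass_iUnion {E : ℕ → Set G} (hE : ∀ n, E n ∈ aronszajnClass δ X) :
    ⋃ n, E n ∈ aronszajnClass δ X := by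
  choose S hS using fun n => (hE n).2
  refine ⟨MeasurableSet.iUnion fun n => (hE n).1, fun i => ⋃ n, S n i, ?_, fun i =>
    nullAlong_iUnion fun n => (hS n).2 i⟩
  rw [Set.iUnion_comm]
  exact Set.iUnion_congr fun n => (hS n).1

lemma nullAlong_subset_aronszajnClass (i : ℕ) : nullAlong δ (X i) ⊆ aronszajnClass δ X := by
  classical
  intro E hE
  refine ⟨hE.1, fun j => if j = i then E else ∅, ?_, fun j => ?_⟩
  · ext x; simp
  · dsimp only
    split_ifs with h
    · exact h ▸ hE
    · exact empty_mem_nullAlong _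

lemma empty_mem_aronszajnClass : ∅ ∈ aronszajnClass δ X :=
  nullAlong_subset_aronszajnClass 0 (empty_mem_nullAlong _)

lemma aronszajnClass_union {E F : Set G} (hE : E ∈ aronszajnClass δ X)
    (hF : F ∈ aronszajnClass δ X) : E ∪ F ∈ aronszajnClass δ X := by
  have : E ∪ F = ⋃ n : ℕ, if n = 0 then E else F := by
    ext x
    simp only [Set.mem_union, Set.mem_iUnion]
    constructor
    · rintro (h | h)
      · exact ⟨0, by simpa using h⟩
      · exact ⟨1, by simpa using h⟩
    · rintro ⟨n, hn⟩
      split_ifs at hn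
      exacts [Or.inl hn, Or.inr hn]
  rw [this]
  refine aronszajnClass_iUnion fun n => ?_
  split_ifs
  exacts [hE, hF]

end SigmaIdeal

/-! ### Non-null sets almost fill word maps at small scales -/

section Density

variable {G : Type*} [Group G] [TopologicalSpace G] [IsTopologicalGroup G]
  [MeasurableSpace G] [BorelSpace G] {δ : ℝ → G → G} {X : ℕ → G}

/-- Up to a set that is null along a one-parameter subgroup, the points of a Borel set are density
points of it along that subgroup. -/
lemma exists_density_subset {Y : G} (hY : Y ∈ firstLayer δ) {Z : Set G} (hZ : MeasurableSet Z)
    {R κ : ℝ} (hR : 0 < R) (hκ : κ < 2 * R) :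
    ∃ D : ℕ → Set G, (∀ j, MeasurableSet (D j)) ∧ (∀ j, D j ⊆ Z) ∧
      (Z \ ⋃ j, D j) ∈ nullAlong δ Y ∧ ∀ j, ∀ x ∈ D j, ∀ m, j ≤ m →
        ENNReal.ofReal κ ≤ volume {s : ℝ | |s| ≤ R ∧ x * δ ((1 / 2) ^ m * s) Y ∈ Z} := by
  let f : ℕ → G → ENNReal := fun m x => volume {s : ℝ | |s| ≤ R ∧ x * δ ((1 / 2) ^ m * s) Y ∈ Z}
  have hf : ∀ m, Measurable (f m) := fun m => by
    have hc : Continuous fun p : G × ℝ => p.1 * δ ((1 / 2) ^ m * p.2) Y :=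
      continuous_fst.mul (hY.1.comp (by fun_prop : Continuous fun p : G × ℝ => (1 / 2) ^ m * p.2))
    have hm : MeasurableSet {p : G × ℝ | |p.2| ≤ R ∧ p.1 * δ ((1 / 2) ^ m * p.2) Y ∈ Z} :=
      (measurableSet_le (measurable_snd.abs) measurable_const).inter (hc.measurable hZ)
    exact measurable_measure_prodMk_left hm
  have hD : ∀ j, MeasurableSet {x | x ∈ Z ∧ ∀ m, j ≤ m → ENNReal.ofReal κ ≤ f m x} := fun j => by
    have : {x | x ∈ Z ∧ ∀ m, j ≤ m → ENNReal.ofReal κ ≤ f m x} =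
        Z ∩ ⋂ m, ⋂ (_ : j ≤ m), {x | ENNReal.ofReal κ ≤ f m x} := by
      ext x; simp
    rw [this]
    exact hZ.inter (MeasurableSet.iInter fun m => MeasurableSet.iInter fun _ =>
      measurableSet_le measurable_const (hf m))
  -- `D j` collects the points whose density bound holds from scale 2 ^ (-j) on; this uniformity
  -- lets all letters of a word share one scale.
  refine ⟨fun j => {x | x ∈ Z ∧ ∀ m, j ≤ m → ENNReal.ofReal κ ≤ f m x}, hD, fun j x hx => hx.1,
    ⟨hZ.diff (MeasurableSet.iUnion hD), fun g => ?_⟩, fun j x hx => hx.2⟩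
  set S : Set ℝ := {t | g * δ t Y ∈ Z} with hSdef
  have hS : MeasurableSet S := (continuous_const.mul hY.1).measurable hZ
  have hae := IsUnifLocDoublingMeasure.ae_tendsto_measure_inter_div (volume : Measure ℝ) S 1
  rw [ae_restrict_iff' hS] at hae
  refine measure_mono_null (fun t ht => ?_) (ae_iff.1 hae)
  intro hcon
  refine ht.2 ?_
  have hlim : Tendsto (fun m : ℕ => (1 / 2 : ℝ) ^ m * R) atTop (𝓝[>] 0) := by
    refine tendsto_nhdsWithin_iff.2 ⟨?_, Eventually.of_forall fun n => ?_⟩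
    · simpa using (tendsto_pow_atTop_nhds_zero_of_lt_one (r := (1 / 2 : ℝ))
        (by norm_num) (by norm_num)).mul_const R
    · exact Set.mem_Ioi.2 (by positivity)
  have h1 := hcon ht.1 (fun _ : ℕ => t) _ hlim
    (Eventually.of_forall fun n => Metric.mem_closedBall_self (by positivity))
  have h2 : ∀ m, f m (g * δ t Y) = volume (S ∩ Metric.closedBall t ((1 / 2) ^ m * R)) /
      volume (Metric.closedBall t ((1 / 2) ^ m * R)) * ENNReal.ofReal (2 * R) := fun m => by
    have hp : (0 : ℝ) < (1 / 2) ^ m := by positivity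
    have h3 : {s : ℝ | |s| ≤ R ∧ g * δ t Y * δ ((1 / 2) ^ m * s) Y ∈ Z} =
        (fun s => (1 / 2) ^ m * s) ⁻¹' ((fun s => t + s) ⁻¹'
          (S ∩ Metric.closedBall t ((1 / 2) ^ m * R))) := by
      ext s
      simp only [Set.mem_preimage, Set.mem_inter_iff, hSdef, Metric.mem_closedBall,
        Real.dist_eq, add_sub_cancel_left, abs_mul, abs_of_pos hp, mul_le_mul_iff_right₀ hp]
      change _ ∧ _ ↔ g * δ (t + _) Y ∈ Z ∧ _
      rw [hY.2, mul_assoc, and_comm]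
    change volume _ = _
    rw [h3, Real.volume_preimage_mul_left hp.ne', measure_preimage_add, Real.volume_closedBall,
      abs_of_pos (inv_pos.2 hp), show 2 * ((1 / 2) ^ m * R) = (1 / 2) ^ m * (2 * R) by ring,
      ENNReal.ofReal_mul hp.le, ENNReal.ofReal_inv_of_pos hp, ENNReal.div_eq_inv_mul,
      ENNReal.mul_inv (Or.inr ENNReal.ofReal_ne_top)
        (Or.inl ENNReal.ofReal_ne_top), mul_assoc, mul_assoc]
    congr 1
    rw [mul_comm (volume _), ← mul_assoc, ENNReal.inv_mul_cancel _ ENNReal.ofReal_ne_top, one_mul]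
    simpa using hR
  have h4 : Tendsto (fun m => f m (g * δ t Y)) atTop (𝓝 (ENNReal.ofReal (2 * R))) := by
    simp only [h2]
    have h := ENNReal.Tendsto.mul_const h1 (Or.inr (ENNReal.ofReal_ne_top (r := 2 * R)))
    rwa [one_mul] at h
  have h5 : ENNReal.ofReal κ < ENNReal.ofReal (2 * R) :=
    (ENNReal.ofReal_lt_ofReal_iff (by positivity)).2 hκ
  obtain ⟨j, hj⟩ := eventually_atTop.1 (h4.eventually (lt_mem_nhds h5))
  exact Set.mem_iUnion.2 ⟨j, ht.1, fun m hm => (hj m hm).le⟩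

/-- A Borel set outside the Aronszajn class is, at small scales around some point, almost full
along any given word map. -/
lemma exists_le_volume_wordMap (hX : ∀ i, X i ∈ firstLayer δ) {R κ : ℝ} (hR : 0 < R)
    (hκ : κ < 2 * R) : ∀ (n : ℕ) (i : Fin n → ℕ) (Z : Set G), MeasurableSet Z →
      Z ∉ aronszajnClass δ X → ∃ x : G, ∃ j : ℕ, ∀ m, j ≤ m → ENNReal.ofReal κ ^ n ≤
        volume {t : Fin n → ℝ | (∀ l, |t l| ≤ R) ∧
          x * wordMap (fun i t => δ t (X i)) n i ((1 / 2 : ℝ) ^ m • t) ∈ Z}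
  | 0, i, Z, hZ, hZA => by
    obtain ⟨x, hx⟩ : Z.Nonempty := by
      by_contra h
      exact hZA (Set.not_nonempty_iff_eq_empty.1 h ▸ empty_mem_aronszajnClass)
    refine ⟨x, 0, fun m _ => ?_⟩
    simp [wordMap, hx, volume_pi]
  | n + 1, i, Z, hZ, hZA => by
    -- The induction peels off the rightmost letter: some `D j` is outside the class, and the
    -- shorter word is made to land in it; from a point of `D j` the last letter lands in `Z` for
    -- most parameters.
    obtain ⟨D, hDm, hDZ, hnull, hD⟩ := exists_density_subset (hX (i 0)) hZ hR hκ
    obtain ⟨j, hj⟩ : ∃ j, D j ∉ aronszajnClass δ X := by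
      by_contra! hcon
      refine hZA (aronszajnClass_mono (aronszajnClass_union (aronszajnClass_iUnion hcon)
        (nullAlong_subset_aronszajnClass (i 0) hnull)) ?_ hZ)
      rw [Set.union_sdiff_self]
      exact Set.subset_union_right
    obtain ⟨x, j', hx⟩ := exists_le_volume_wordMap hX hR hκ n (Fin.tail i) (D j) (hDm j) hj
    refine ⟨x, max j j', fun m hm => ?_⟩
    set ρ : ℝ := (1 / 2) ^ m with hρ
    set γ : ℕ → ℝ → G := fun i t => δ t (X i) with hγ
    have hγc : ∀ i, Continuous (γ i) := fun i => (hX i).1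
    let T : Set (ℝ × (Fin n → ℝ)) := {p | |p.1| ≤ R ∧ (∀ l, |p.2 l| ≤ R) ∧
      x * (wordMap γ n (Fin.tail i) (ρ • p.2) * γ (i 0) (ρ * p.1)) ∈ Z}
    have hbox : ∀ k, MeasurableSet {t : Fin k → ℝ | ∀ l, |t l| ≤ R} := fun k => by
      rw [Set.ofPred_forall]
      exact MeasurableSet.iInter fun l => measurableSet_le (measurable_pi_apply l).abs
        measurable_const
    have hT : MeasurableSet T := by
      refine (measurableSet_le measurable_fst.abs measurable_const).inter
        ((measurable_snd (hbox n)).inter ?_)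
      have h1 : Continuous fun p : ℝ × (Fin n → ℝ) => wordMap γ n (Fin.tail i) (ρ • p.2) :=
        (continuous_wordMap hγc n (Fin.tail i)).comp (by fun_prop)
      have h2 : Continuous fun p : ℝ × (Fin n → ℝ) => γ (i 0) (ρ * p.1) :=
        (hγc (i 0)).comp (by fun_prop)
      exact (continuous_const.mul (h1.mul h2)).measurable hZ
    have he := volume_preserving_piFinSuccAbove (fun _ : Fin (n + 1) => ℝ) 0
    have hset : {t : Fin (n + 1) → ℝ | (∀ l, |t l| ≤ R) ∧ x * wordMap γ (n + 1) i (ρ • t) ∈ Z} =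
        MeasurableEquiv.piFinSuccAbove (fun _ : Fin (n + 1) => ℝ) 0 ⁻¹' T := by
      ext t
      change ((∀ l, |t l| ≤ R) ∧ _) ↔ |t 0| ≤ R ∧ (∀ l : Fin n, |t l.succ| ≤ R) ∧ _
      rw [Fin.forall_fin_succ, and_assoc]
      rfl
    rw [hset, he.measure_preimage hT.nullMeasurableSet, Measure.volume_eq_prod,
      Measure.prod_apply_symm hT, pow_succ]
    set T' : Set (Fin n → ℝ) := {t | (∀ l, |t l| ≤ R) ∧
      x * wordMap γ n (Fin.tail i) (ρ • t) ∈ D j} with hT'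
    have hT'm : MeasurableSet T' := by
      refine (hbox n).inter ?_
      have h1 : Continuous fun t : Fin n → ℝ => x * wordMap γ n (Fin.tail i) (ρ • t) :=
        continuous_const.mul ((continuous_wordMap hγc n (Fin.tail i)).comp (by fun_prop))
      exact h1.measurable (hDm j)
    calc ENNReal.ofReal κ ^ n * ENNReal.ofReal κ ≤ volume T' * ENNReal.ofReal κ := by
          gcongr; exact hx m ((le_max_right _ _).trans hm)
      _ = ∫⁻ _ in T', ENNReal.ofReal κ := by rw [setLIntegral_const, mul_comm]
      _ ≤ ∫⁻ t in T', volume ((fun s => (s, t)) ⁻¹' T) := by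
          refine setLIntegral_mono' hT'm fun t ht => ?_
          refine (hD j _ ht.2 m ((le_max_left _ _).trans hm)).trans (measure_mono fun s hs => ?_)
          exact ⟨hs.1, ht.1, by rw [← mul_assoc]; exact hs.2⟩
      _ ≤ ∫⁻ t, volume ((fun s => (s, t)) ⁻¹' T) := setLIntegral_le_lintegral _ _

end Density

end CarnotNull

namespace CarnotNull

/-! ### Haar null on cosets implies membership in the Aronszajn class -/

section Cosets

variable {G : Type*} [Group G] [MetricSpace G] [IsTopologicalGroup G]
  [MeasurableSpace G] [BorelSpace G] {δ : ℝ → G → G} {X : ℕ → G}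

/-- In a Carnot group spanned by finitely many one-parameter subgroups, some word map pulls Haar
null sets back to Lebesgue null sets, locally around some point. -/
lemma IsCarnotGroup.exists_open_volume_inter_wordMap_preimage_eq_zero {H ι : Type*} [Group H]
    [MetricSpace H] [IsTopologicalGroup H] [SecondCountableTopology H] [MeasurableSpace H]
    [BorelSpace H] {δ : ℝ → H → H} (hH : IsCarnotGroup H δ) (hδ : IsScalableGroup δ)
    (vol : Measure H) [vol.IsMulLeftInvariant] [vol.IsOpenPosMeasure] [SigmaFinite vol]
    {γ : ι → ℝ → H} (hγ : ∀ i, Continuous (γ i))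
    (hadd : ∀ i s t, γ i (s + t) = γ i s * γ i t) (hdil : ∀ i r t, δ r (γ i t) = γ i (r * t))
    (hdense : Dense (Subgroup.closure {g | ∃ i t, g = γ i t} : Set H)) :
    ∃ (n : ℕ) (i : Fin n → ι) (B : Set (Fin n → ℝ)), IsOpen B ∧ B.Nonempty ∧
      ∀ N, MeasurableSet N → vol N = 0 → volume (B ∩ wordMap γ n i ⁻¹' N) = 0 := by
  obtain ⟨d, c, V, hc⟩ := hH.exists_isStratifiedChart
  choose v hv using fun i => hc.toIsSmoothCoordinate.exists_hasStrictDerivAt (hγ i) (hadd i)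
  obtain ⟨n, i, t, ht⟩ := hc.exists_range_wordDiff_eq_top hadd hv hγ
    (hc.layer_one_le_span hδ hγ hadd hdil hv hdense)
  exact ⟨n, i, hc.toIsSmoothCoordinate.exists_open_volume_inter_wordMap_preimage_eq_zero vol hγ
    hadd hv ht⟩

-- The subgroup is by definition the closure of the generated group; this moves density from the
-- ambient group to the subspace topology.
omit [MeasurableSpace G] [BorelSpace G] in
lemma dense_closure_assocFiltration (k : ℕ) {γ : {i // i ≤ k} → ℝ → assocFiltration δ X k}
    (hγ : ∀ i t, (γ i t : G) = δ t (X i)) :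
    Dense (Subgroup.closure {g | ∃ i t, g = γ i t} : Set (assocFiltration δ X k)) := by
  rw [Subtype.dense_iff]
  intro x hx
  have h1 : ((↑) '' (Subgroup.closure {g | ∃ i t, g = γ i t} : Set (assocFiltration δ X k)) : Set G)
      = Subgroup.closure {g : G | ∃ a ∈ {g : G | ∃ i ≤ k, g = X i}, ∃ t : ℝ, g = δ t a} := by
    have h2 := (assocFiltration δ X k).subtype.map_closure {g | ∃ i t, g = γ i t}
    have h3 := congrArg (fun S : Subgroup G => (S : Set G)) h2
    simp only [Subgroup.coe_map, Subgroup.coe_subtype] at h3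
    rw [h3]
    congr 2
    ext g
    constructor
    · rintro ⟨_, ⟨i, t, rfl⟩, rfl⟩
      exact ⟨X i, ⟨i, i.2, rfl⟩, t, hγ i t⟩
    · rintro ⟨_, ⟨i, hi, rfl⟩, t, rfl⟩
      exact ⟨γ ⟨i, hi⟩ t, ⟨_, t, rfl⟩, hγ ⟨i, hi⟩ t⟩
  refine (congrArg (x ∈ closure ·) h1).mpr ?_
  exact hx

/-- A Borel set which is Haar null on every coset of one of the subgroups of the filtration is in
the Aronszajn class. -/
theorem mem_aronszajnClass_of_haar_null [SecondCountableTopology G]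
    (hδ : IsMetricScalableGroup δ) (hX : ∀ i, X i ∈ firstLayer δ) (k : ℕ)
    (hN : IsCarnotSubgroup δ (assocFiltration δ X k)) (vol : Measure (assocFiltration δ X k))
    [vol.IsHaarMeasure] {Z : Set G} (hZ : MeasurableSet Z)
    (hnull : ∀ g : G, vol {h : assocFiltration δ X k | g * h ∈ Z} = 0) :
    Z ∈ aronszajnClass δ X := by
  have := hδ.properSpace_of_isCarnotSubgroup hN
  obtain ⟨⟨-, hsurj⟩, δN, hcoe, hcar⟩ := hN
  have hδN := hδ.subgroup hcoe hsurj
  have hmem : ∀ (i : {i // i ≤ k}) (t : ℝ), δ t (X i) ∈ assocFiltration δ X k := fun i t =>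
    subset_closure (Subgroup.subset_closure ⟨X i, ⟨i, i.2, rfl⟩, t, rfl⟩)
  let γ : {i // i ≤ k} → ℝ → assocFiltration δ X k := fun i t => ⟨δ t (X i), hmem i t⟩
  have hdil : ∀ i r t, δN r (γ i t) = γ i (r * t) := fun i r t =>
    Subtype.ext (by rw [hcoe]; exact hδ.comp r t (X i))
  obtain ⟨n, i, B, hBo, ⟨b, hb⟩, hB⟩ :=
    hcar.exists_open_volume_inter_wordMap_preimage_eq_zero hδN.toIsScalableGroup vol (γ := γ)
      (fun i => (hX i).1.subtype_mk _) (fun i s t => Subtype.ext ((hX i).2 s t)) hdil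
      (dense_closure_assocFiltration k fun i t => rfl)
  by_contra hZA
  -- a cube meeting `B`
  set R : ℝ := ‖b‖ + 1 with hR
  have hRpos : 0 < R := by positivity
  set Q : Set (Fin n → ℝ) := {t | ∀ l, |t l| ≤ R} with hQ
  have hQ' : Q = Metric.closedBall 0 R := by
    ext t
    rw [mem_closedBall_zero_iff, pi_norm_le_iff_of_nonneg hRpos.le]
    rfl
  have hQvol : volume Q = ENNReal.ofReal (2 * R) ^ n := by
    rw [hQ', Real.volume_pi_closedBall _ hRpos.le, Fintype.card_fin,
      ENNReal.ofReal_pow (by positivity)]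
  have hpos : 0 < volume (Q ∩ B) := by
    have h1 : (Metric.ball 0 R ∩ B) ∈ 𝓝 b := by
      refine (Metric.isOpen_ball.inter hBo).mem_nhds ⟨?_, hb⟩
      rw [mem_ball_zero_iff]; linarith
    refine (volume.measure_pos_of_mem_nhds h1).trans_le (measure_mono ?_)
    rw [hQ']
    exact Set.inter_subset_inter_left _ Metric.ball_subset_closedBall
  have hlt : volume (Q \ B) < ENNReal.ofReal (2 * R) ^ n := by
    rw [← hQvol, ← measure_inter_add_sdiff Q hBo.measurableSet, add_comm]
    refine ENNReal.lt_add_right (ne_top_of_le_ne_top ?_ (measure_mono Set.sdiff_subset)) hpos.ne'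
    rw [hQvol]
    exact ENNReal.pow_ne_top ENNReal.ofReal_ne_top
  -- B occupies a positive part of the cube, so a proportion close enough to 1 no longer fits in the
  -- cube minus B.
  obtain ⟨κ, hκ, hlt'⟩ : ∃ κ < 2 * R, volume (Q \ B) < ENNReal.ofReal κ ^ n := by
    have hcont : Tendsto (fun κ : ℝ => ENNReal.ofReal κ ^ n) (𝓝[<] (2 * R))
        (𝓝 (ENNReal.ofReal (2 * R) ^ n)) :=
      (((ENNReal.continuous_pow n).comp ENNReal.continuous_ofReal).tendsto (2 * R)).mono_left
        nhdsWithin_le_nhds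
    obtain ⟨κ, h1, h2⟩ := ((hcont.eventually (lt_mem_nhds hlt)).and self_mem_nhdsWithin).exists
    exact ⟨κ, h2, h1⟩
  obtain ⟨x, m, hm⟩ := exists_le_volume_wordMap hX hRpos hκ n (fun l => (i l : ℕ)) Z hZ hZA
  refine (hlt'.trans_le (hm m le_rfl)).not_ge ?_
  set ρ : ℝ := (1 / 2) ^ m with hρ
  have hρ0 : ρ ≠ 0 := by positivity
  -- Rescaling moves the small-scale picture at x to scale 1, where B is fixed; M is still Haar
  -- null.
  set M : Set (assocFiltration δ X k) := δN ρ ⁻¹' {h | x * h ∈ Z} with hM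
  have hxZ : MeasurableSet {h : assocFiltration δ X k | x * h ∈ Z} :=
    ((measurable_const_mul x).comp measurable_subtype_coe) hZ
  have hM0 : volume (B ∩ wordMap γ n i ⁻¹' M) = 0 :=
    hB M ((hδN.toIsScalableGroup.continuous_dil ρ).measurable hxZ)
      (hδN.haar_preimage_dil_eq_zero vol hρ0 hxZ (hnull x))
  have hsub : {t : Fin n → ℝ | (∀ l, |t l| ≤ R) ∧
      x * wordMap (fun i t => δ t (X i)) n (fun l => (i l : ℕ)) (ρ • t) ∈ Z} ⊆
      (Q \ B) ∪ (B ∩ wordMap γ n i ⁻¹' M) := by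
    rintro t ⟨htQ, htZ⟩
    by_cases htB : t ∈ B
    · refine Or.inr ⟨htB, ?_⟩
      change x * (δN ρ (wordMap γ n i t) : G) ∈ Z
      rw [hδN.toIsScalableGroup.dil_wordMap hdil hρ0]
      have h1 := map_wordMap (γ' := fun i t => δ t (X i)) (assocFiltration δ X k).subtype
        (fun i : {i // i ≤ k} => (i : ℕ)) (γ := γ) (fun _ _ => rfl) n i (ρ • t)
      rw [Subgroup.coe_subtype] at h1
      rw [h1]
      exact htZ
    · exact Or.inl ⟨htQ, htB⟩
  refine (measure_mono hsub).trans ((measure_union_le _ _).trans ?_)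
  rw [hM0, add_zero]

end Cosets

end CarnotNull

namespace CarnotNull

/-! ### Iterated convolutions as laws of random products -/

section Convolution

variable {G : Type*} [Group G] [MeasurableSpace G]

/-- The iterated convolution `η (n - 1) ∗ ⋯ ∗ η 0`, starting with the Dirac mass at `1`. -/
noncomputable def leftConv (η : ℕ → Measure G) : ℕ → Measure G
  | 0 => Measure.dirac 1
  | n + 1 => (η n).mconv (leftConv η n)

/-- The product `w (n - 1) * ⋯ * w 0`. -/
def leftProd (w : ℕ → G) : ℕ → G
  | 0 => 1
  | n + 1 => w n * leftProd w n

variable [MeasurableMul₂ G] {η : ℕ → Measure G} [∀ n, IsProbabilityMeasure (η n)]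

instance isProbabilityMeasure_leftConv (n : ℕ) : IsProbabilityMeasure (leftConv η n) := by
  induction n with
  | zero => exact Measure.dirac.isProbabilityMeasure
  | succ n ih => exact Measure.isProbabilityMeasure_map measurable_mul.aemeasurable

lemma iterConv_eq_leftConv (n : ℕ) : iterConv η n = leftConv η (n + 1) := by
  induction n with
  | zero => exact (Measure.mconv_dirac_one (η 0)).symm
  | succ n ih => rw [iterConv, ih]; rfl

omit [∀ n, IsProbabilityMeasure (η n)] in
lemma measurable_leftProd (n : ℕ) : Measurable fun w : ℕ → G => leftProd w n := by
  induction n with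
  | zero => exact measurable_const
  | succ n ih => exact (measurable_pi_apply n).mul ih

omit [MeasurableSpace G] [MeasurableMul₂ G] in
lemma leftProd_congr {w w' : ℕ → G} {n : ℕ} (h : ∀ i < n, w i = w' i) :
    leftProd w n = leftProd w' n := by
  induction n with
  | zero => rfl
  | succ n ih =>
    rw [leftProd, leftProd, h n n.lt_succ_self, ih fun i hi => h i (hi.trans n.lt_succ_self)]

/-- The product of the first n factors depends only on coordinates below n, so it is independent of
coordinate n. -/
lemma indepFun_leftProd (n : ℕ) :
    ProbabilityTheory.IndepFun (fun w : ℕ → G => w n) (fun w => leftProd w n)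
      (Measure.infinitePi η) := by
  have h1 : ProbabilityTheory.iIndepFun (fun (i : ℕ) (w : ℕ → G) => w i) (Measure.infinitePi η) :=
    ProbabilityTheory.iIndepFun_infinitePi (X := fun _ => id) fun _ => measurable_id
  have h2 := h1.indepFun_finset {n} (Finset.range n) (by simp) fun i => measurable_pi_apply i
  let g : ((i : Finset.range n) → G) → G := fun u =>
    leftProd (fun i => if h : i ∈ Finset.range n then u ⟨i, h⟩ else 1) n
  have hg : Measurable g := by
    refine (measurable_leftProd n).comp (measurable_pi_iff.2 fun i => ?_)
    by_cases h : i ∈ Finset.range n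
    · simp only [h, dif_pos]; exact measurable_pi_apply _
    · simp only [h, dif_neg, not_false_eq_true]; exact measurable_const
  have hφ : Measurable fun u : ({n} : Finset ℕ) → G => u ⟨n, Finset.mem_singleton_self n⟩ :=
    measurable_pi_apply _
  have h3 := h2.comp hφ hg
  have h4 : (fun w : ℕ → G => leftProd w n) = g ∘ fun w (i : Finset.range n) => w i := by
    ext w
    refine leftProd_congr (G := G) fun i hi => ?_
    simp [hi]
  rw [h4]
  exact h3

lemma map_leftProd (n : ℕ) : (Measure.infinitePi η).map (fun w => leftProd w n) = leftConv η n ∧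
    (Measure.infinitePi η).map (fun w => (w n, leftProd w n)) = (η n).prod (leftConv η n) := by
  have key : ∀ n, (Measure.infinitePi η).map (fun w => leftProd w n) = leftConv η n →
      (Measure.infinitePi η).map (fun w => (w n, leftProd w n)) = (η n).prod (leftConv η n) := by
    intro n h
    rw [(ProbabilityTheory.indepFun_iff_map_prod_eq_prod_map_map
      (measurable_pi_apply n).aemeasurable (measurable_leftProd n).aemeasurable).1
      (indepFun_leftProd n), h]
    congr 1
    exact (measurePreserving_eval_infinitePi η n).map_eq
  suffices h : (Measure.infinitePi η).map (fun w => leftProd w n) = leftConv η n from ⟨h, key n h⟩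
  induction n with
  | zero =>
    change (Measure.infinitePi η).map (fun _ => (1 : G)) = Measure.dirac 1
    rw [Measure.map_const, measure_univ, one_smul]
  | succ n ih =>
    have hm : Measurable fun w : ℕ → G => (w n, leftProd w n) :=
      (measurable_pi_apply n).prodMk (measurable_leftProd n)
    rw [leftConv, Measure.mconv, ← key n ih, Measure.map_map measurable_mul hm]
    rfl

end Convolution

/-! ### Weak convergence of iterated convolutions -/

section Limit

variable {G : Type*} [Group G] [MetricSpace G] [IsTopologicalGroup G]
  [SecondCountableTopology G] [CompleteSpace G] [MeasurableSpace G] [BorelSpace G]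

/-- Iterated convolutions whose factors move points very little with high probability converge
weakly. -/
theorem exists_weaklyConverges_iterConv {η : ℕ → Measure G} [∀ n, IsProbabilityMeasure (η n)]
    (h : ∀ n, ((η n).prod (leftConv η n)) {p | (1 / 2 : ℝ) ^ n ≤ dist (p.1 * p.2) p.2} ≤
      ENNReal.ofReal ((1 / 2) ^ n)) :
    ∃ ν : Measure G, WeaklyConverges (iterConv η) ν := by
  set P := Measure.infinitePi η with hP
  -- By Borel–Cantelli the partial products almost surely move by less than 2 ^ (-n) from some step
  -- on, hence are Cauchy; the limit law is that of their limit.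
  have hsum : ∑' n, P {w | (1 / 2 : ℝ) ^ n ≤ dist (leftProd w (n + 1)) (leftProd w n)} ≠ ⊤ := by
    refine ne_top_of_le_ne_top ?_ (ENNReal.tsum_le_tsum
      (g := fun n => ENNReal.ofReal ((1 / 2) ^ n)) fun n => ?_)
    · rw [← ENNReal.ofReal_tsum_of_nonneg (fun n => by positivity) summable_geometric_two]
      exact ENNReal.ofReal_ne_top
    · refine le_trans (le_of_eq ?_) (h n)
      rw [← (map_leftProd n).2, Measure.map_apply]
      · rfl
      · exact (measurable_pi_apply n).prodMk (measurable_leftProd n)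
      · exact measurableSet_le measurable_const
          ((measurable_fst.mul measurable_snd).dist measurable_snd)
  have hlim : ∀ᵐ w ∂P, ∃ z, Tendsto (fun n => leftProd w n) atTop (𝓝 z) := by
    filter_upwards [ae_eventually_notMem hsum] with w hw
    refine cauchySeq_tendsto_of_complete (cauchySeq_of_summable_dist ?_)
    refine Summable.of_norm_bounded_eventually_nat summable_geometric_two ?_
    filter_upwards [hw] with n hn
    rw [Real.norm_of_nonneg dist_nonneg, dist_comm]
    exact (not_le.1 hn).le
  obtain ⟨Z, hZm, hZ⟩ := measurable_limit_of_tendsto_metrizable_ae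
    (fun n => (measurable_leftProd n).aemeasurable) hlim
  refine ⟨P.map Z, fun n => ?_, Measure.isProbabilityMeasure_map hZm.aemeasurable, fun φ => ?_⟩
  · rw [iterConv_eq_leftConv]; infer_instance
  · have h1 : ∀ n, ∫ g, φ g ∂(iterConv η n) = ∫ w, φ (leftProd w (n + 1)) ∂P := fun n => by
      rw [iterConv_eq_leftConv, ← (map_leftProd (n + 1)).1, integral_map
        (measurable_leftProd _).aemeasurable φ.continuous.aestronglyMeasurable]
    simp only [h1]
    rw [integral_map hZm.aemeasurable φ.continuous.aestronglyMeasurable]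
    refine tendsto_integral_of_dominated_convergence (fun _ => ‖φ‖) (fun n => ?_)
      (integrable_const _) (fun n => Eventually.of_forall fun w => φ.norm_coe_le_norm _) ?_
    · exact (φ.continuous.measurable.comp (measurable_leftProd _)).aestronglyMeasurable
    · filter_upwards [hZ] with w hw
      exact (φ.continuous.tendsto _).comp (hw.comp (tendsto_add_atTop_nat 1))

-- The closed-set half of the portmanteau theorem. It passes lower bounds to the limit only for
-- closed sets, which is why closures appear in the scheme.
omit [Group G] [IsTopologicalGroup G] [SecondCountableTopology G] [CompleteSpace G] in
lemma WeaklyConverges.le_measure_of_isClosed {μ : ℕ → Measure G} {ν : Measure G}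
    (h : WeaklyConverges μ ν) {F : Set G} (hF : IsClosed F) {c : ENNReal}
    (hc : ∀ᶠ n in atTop, c ≤ μ n F) : c ≤ ν F := by
  obtain ⟨hμ, hν, hint⟩ := h
  let μ' : ℕ → ProbabilityMeasure G := fun n => ⟨μ n, hμ n⟩
  let ν' : ProbabilityMeasure G := ⟨ν, hν⟩
  have hlim : Tendsto μ' atTop (𝓝 ν') :=
    ProbabilityMeasure.tendsto_iff_forall_integral_tendsto.2 hint
  refine le_trans ?_ (ProbabilityMeasure.limsup_measure_closed_le_of_tendsto hlim hF)
  exact le_limsup_of_frequently_le hc.frequently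

end Limit

/-! ### Exhausting a Borel set by a scheme of totally bounded pieces -/

section Scheme

/-- A Borel subset `E` of a Polish space is exhausted by a countably branching scheme of Borel sets
such that the closures along each branch shrink to a subset of `E`. -/
theorem exists_compact_scheme_of_continuous {T G : Type*} [TopologicalSpace T]
    [PolishSpace T] [MeasurableSpace T] [BorelSpace T]
    [MetricSpace G] [SecondCountableTopology G] [MeasurableSpace G] [BorelSpace G] {f : T → G}
    (hf : Continuous f) (hbij : Function.Bijective f) {E : Set G} (hE : IsClosed (f ⁻¹' E)) :
    ∃ Q : ℕ → ℕ → Set G, (∀ n m, MeasurableSet (Q n m)) ∧ (∀ n, Monotone (Q n)) ∧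
      (∀ n, ⋃ m, Q n m = Set.univ) ∧
      ∀ m : ℕ → ℕ, ⋂ N, closure (E ∩ ⋂ l, ⋂ (_ : l < N), Q l (m l)) ⊆ E := by
  let _ := TopologicalSpace.upgradeIsCompletelyMetrizable T
  rcases isEmpty_or_nonempty T with hT | hT
  · have : IsEmpty G := ⟨fun g => (hbij.2 g).elim fun t _ => isEmptyElim t⟩
    exact ⟨fun _ _ => Set.univ, fun _ _ => MeasurableSet.univ, fun _ _ _ _ => le_rfl,
      fun _ => by ext g; exact isEmptyElim g, fun _ g _ => isEmptyElim g⟩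
  let d : ℕ → T := TopologicalSpace.denseSeq T
  -- Finite unions of small balls for the finer metric: points satisfying all the constraints of a
  -- branch form a totally bounded set.
  let C : ℕ → ℕ → Set T := fun n m => ⋃ i, ⋃ (_ : i < m), Metric.closedBall (d i) ((1 / 2) ^ n)
  have hemb : MeasurableEmbedding f := hf.measurableEmbedding hbij.1
  refine ⟨fun n m => f '' C n m, fun n m => hemb.measurableSet_image.2 ?_, fun n a b hab => ?_,
    fun n => ?_, fun m y hy => ?_⟩
  · exact MeasurableSet.iUnion fun i => MeasurableSet.iUnion fun _ =>
      Metric.isClosed_closedBall.measurableSet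
  · refine Set.image_mono (Set.iUnion_mono fun i => ?_)
    exact Set.iUnion_mono' fun hi => ⟨hi.trans_le hab, le_rfl⟩
  · rw [← Set.image_iUnion, Set.eq_univ_iff_forall]
    intro g
    obtain ⟨t, rfl⟩ := hbij.2 g
    refine ⟨t, ?_, rfl⟩
    obtain ⟨i, hi⟩ := (TopologicalSpace.denseRange_denseSeq T).exists_dist_lt t
      (show (0 : ℝ) < (1 / 2) ^ n by positivity)
    exact Set.mem_iUnion.2 ⟨i + 1, Set.mem_iUnion.2 ⟨i, Set.mem_iUnion.2 ⟨i.lt_succ_self, hi.le⟩⟩⟩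
  · have hex : ∀ N : ℕ, ∃ t : T, f t ∈ E ∧ (∀ l < N, t ∈ C l (m l)) ∧
        dist (f t) y < (1 / 2) ^ N := fun N => by
      obtain ⟨z, ⟨hzE, hz⟩, hd⟩ := Metric.mem_closure_iff.1 (Set.mem_iInter.1 hy N) ((1 / 2) ^ N)
        (by positivity)
      obtain ⟨t, rfl⟩ := hbij.2 z
      refine ⟨t, hzE, fun l hl => ?_, by rwa [dist_comm]⟩
      exact (hbij.1.mem_set_image).1 (Set.mem_iInter₂.1 hz l hl)
    choose t htE htC htd using hex
    -- For a given ε all but finitely many terms satisfy the level-l constraint. A subsequence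
    -- therefore converges in the finer topology, where the preimage of E is closed; its image must
    -- converge to y.
    have htb : TotallyBounded (Set.range t) := by
      refine Metric.totallyBounded_iff.2 fun ε hε => ?_
      obtain ⟨l, hl⟩ := exists_pow_lt_of_lt_one hε (show (1 / 2 : ℝ) < 1 by norm_num)
      refine ⟨t '' Set.Iic l ∪ d '' Set.Iio (m l), ((Set.finite_Iic l).image t).union
        ((Set.finite_Iio (m l)).image d), ?_⟩
      rintro _ ⟨N, rfl⟩
      rcases le_or_gt N l with hN | hN
      · exact Set.mem_iUnion₂.2 ⟨t N, Or.inl ⟨N, hN, rfl⟩, Metric.mem_ball_self hε⟩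
      · obtain ⟨i, hi⟩ := Set.mem_iUnion.1 (htC N l hN)
        obtain ⟨him, hd⟩ := Set.mem_iUnion.1 hi
        exact Set.mem_iUnion₂.2 ⟨d i, Or.inr ⟨i, him, rfl⟩, lt_of_le_of_lt hd hl⟩
    obtain ⟨s, -, φ, hφ, hlim⟩ := (htb.closure.isCompact_of_isClosed isClosed_closure).tendsto_subseq
      fun n => subset_closure (Set.mem_range_self n)
    have h1 : Tendsto (fun n => f (t (φ n))) atTop (𝓝 (f s)) := (hf.tendsto s).comp hlim
    have h2 : Tendsto (fun n => f (t n)) atTop (𝓝 y) := tendsto_iff_dist_tendsto_zero.2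
      (squeeze_zero (fun _ => dist_nonneg) (fun n => (htd n).le)
        (tendsto_pow_atTop_nhds_zero_of_lt_one (by norm_num) (by norm_num)))
    rw [tendsto_nhds_unique (h2.comp hφ.tendsto_atTop) h1]
    exact hE.mem_of_tendsto hlim (Eventually.of_forall fun n => htE (φ n))

/-- A Borel set is clopen in some finer Polish topology. The preceding theorem is applied to the
identity map from that topology, so that two topologies on `G` need not coexist in its proof. -/
theorem exists_compact_scheme {G : Type*} [MetricSpace G] [SecondCountableTopology G]
    [CompleteSpace G] [MeasurableSpace G] [BorelSpace G] {E : Set G} (hE : MeasurableSet E) :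
    ∃ Q : ℕ → ℕ → Set G, (∀ n m, MeasurableSet (Q n m)) ∧ (∀ n, Monotone (Q n)) ∧
      (∀ n, ⋃ m, Q n m = Set.univ) ∧
      ∀ m : ℕ → ℕ, ⋂ N, closure (E ∩ ⋂ l, ⋂ (_ : l < N), Q l (m l)) ⊆ E := by
  obtain ⟨t', ht', hpol, hcl, -⟩ := hE.isClopenable
  exact @exists_compact_scheme_of_continuous G G t' hpol (@borel G t')
    (@BorelSpace.mk G t' (@borel G t') rfl) _ _ _ _ id (continuous_id_of_le ht')
    Function.bijective_id E hcl

end Scheme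

end CarnotNull

namespace CarnotNull

/-! ### The countable tree of choices -/

section Tree

/-- The convolution product of the measures chosen at a node. -/
noncomputable def treeMeasure {G : Type*} [Group G] [MeasurableSpace G] (η : ℕ → ℕ → Measure G) :
    List (ℕ × ℕ) → Measure G
  | [] => Measure.dirac 1
  | p :: s => (η s.length p.1).mconv (treeMeasure η s)

/-- The part of `E` selected at a node. -/
def treeSet {G : Type*} (Q : ℕ → ℕ → Set G) (E : Set G) : List (ℕ × ℕ) → Set G
  | [] => E
  | p :: s => treeSet Q E s ∩ Q s.length p.2

/-- A strictly decreasing sequence of levels in `(1 / 2, 1)`. -/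
noncomputable def level (n : ℕ) : ENNReal := ENNReal.ofReal (1 / 2 + 1 / (n + 3))

lemma level_zero_lt_one : level 0 < 1 := by
  rw [level, ← ENNReal.ofReal_one]
  exact (ENNReal.ofReal_lt_ofReal_iff one_pos).2 (by norm_num)

lemma level_succ_lt (n : ℕ) : level (n + 1) < level n := by
  refine (ENNReal.ofReal_lt_ofReal_iff (by positivity)).2 ?_
  push_cast
  gcongr
  linarith

lemma half_le_level (n : ℕ) : ENNReal.ofReal (1 / 2) ≤ level n :=
  ENNReal.ofReal_le_ofReal (by have : (0 : ℝ) ≤ 1 / (n + 3) := by positivity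
                               linarith)

/-- The points from which the translated measure of a node gives large mass to the set of the
node. -/
def treeGood {G : Type*} [Group G] [MeasurableSpace G] (η : ℕ → ℕ → Measure G)
    (Q : ℕ → ℕ → Set G) (E : Set G) (s : List (ℕ × ℕ)) : Set G :=
  {x | level s.length < treeMeasure η s {z | x * z ∈ treeSet Q E s}}

variable {G : Type*} [Group G] [MeasurableSpace G]

omit [Group G] in
lemma measurableSet_treeSet {Q : ℕ → ℕ → Set G} (hQ : ∀ n m, MeasurableSet (Q n m)) {E : Set G}
    (hE : MeasurableSet E) : ∀ s, MeasurableSet (treeSet Q E s)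
  | [] => hE
  | _ :: s => (measurableSet_treeSet hQ hE s).inter (hQ _ _)

variable [MeasurableMul₂ G] {η : ℕ → ℕ → Measure G} [∀ n j, IsProbabilityMeasure (η n j)]

instance isProbabilityMeasure_treeMeasure :
    ∀ s, IsProbabilityMeasure (treeMeasure η s)
  | [] => Measure.dirac.isProbabilityMeasure
  | _ :: s => by
    have := isProbabilityMeasure_treeMeasure s
    exact Measure.isProbabilityMeasure_map measurable_mul.aemeasurable

lemma measurableSet_treeGood {Q : ℕ → ℕ → Set G} (hQ : ∀ n m, MeasurableSet (Q n m)) {E : Set G}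
    (hE : MeasurableSet E) (s : List (ℕ × ℕ)) : MeasurableSet (treeGood η Q E s) :=
  measurableSet_lt measurable_const (measurable_measure_prodMk_left
    (measurable_mul (measurableSet_treeSet hQ hE s)))

-- At the root the measure is a Dirac mass, so its values are 0 or 1 and any level in [0, 1) selects
-- E.
omit [∀ n j, IsProbabilityMeasure (η n j)] in
lemma treeGood_nil {Q : ℕ → ℕ → Set G} {E : Set G} (hE : MeasurableSet E) :
    treeGood η Q E [] = E := by
  ext x
  have hm : MeasurableSet {z | x * z ∈ E} := measurable_const_mul x hE
  change level 0 < Measure.dirac (1 : G) {z | x * z ∈ E} ↔ x ∈ E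
  rw [Measure.dirac_apply' _ hm]
  by_cases hx : x ∈ E
  · simp [hx, level_zero_lt_one]
  · simp [hx]

/-- At a density point of the good set of a node, most measures at the next level admit a good
successor node. -/
lemma eventually_exists_mem_treeGood {Q : ℕ → ℕ → Set G} (hQ : ∀ n m, MeasurableSet (Q n m))
    (hQmono : ∀ n, Monotone (Q n)) (hQuniv : ∀ n, ⋃ m, Q n m = Set.univ) {E : Set G}
    (hE : MeasurableSet E) {s : List (ℕ × ℕ)} {x : G}
    (hx : Tendsto (fun j => η s.length j {h | x * h ∈ treeGood η Q E s}) atTop (𝓝 1)) :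
    ∀ᶠ j in atTop, ∃ m, x ∈ treeGood η Q E ((j, m) :: s) := by
  have hlim : Tendsto (fun j => level s.length * η s.length j {h | x * h ∈ treeGood η Q E s})
      atTop (𝓝 (level s.length)) := by
    simpa using ENNReal.Tendsto.const_mul hx (Or.inl one_ne_zero)
  filter_upwards [hlim.eventually (lt_mem_nhds (level_succ_lt s.length))] with j hj
  set μ := treeMeasure η s with hμ
  set B := treeSet Q E s with hB
  have hBm : MeasurableSet B := measurableSet_treeSet hQ hE s
  have hgood : MeasurableSet {h | x * h ∈ treeGood η Q E s} :=
    measurable_const_mul x (measurableSet_treeGood hQ hE s)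
  -- Condition on the new left factor h: whenever x h is good, the old measure gives x h z ∈ B mass
  -- above the old level. The drop between levels pays for the bad h.
  have h1 : level (s.length + 1) < (η s.length j).mconv μ {z | x * z ∈ B} := by
    refine hj.trans_le ?_
    have hxB : MeasurableSet {z | x * z ∈ B} := measurable_const_mul x hBm
    have hm : MeasurableSet ((fun p : G × G => p.1 * p.2) ⁻¹' {z | x * z ∈ B}) :=
      measurable_mul hxB
    rw [Measure.mconv, Measure.map_apply measurable_mul hxB,
      Measure.prod_apply hm, ← setLIntegral_const]
    refine (setLIntegral_mono' hgood fun h hh => ?_).trans (setLIntegral_le_lintegral _ _)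
    refine (le_of_lt (hh : level s.length < _)).trans (le_of_eq ?_)
    congr 1
    ext z
    simp [mul_assoc, hB]
  -- The strict inequality survives intersection with a large enough piece of the scheme, by
  -- continuity from below.
  have h2 : Tendsto (fun m => (η s.length j).mconv μ {z | x * z ∈ B ∩ Q s.length m}) atTop
      (𝓝 ((η s.length j).mconv μ (⋃ m, {z | x * z ∈ B ∩ Q s.length m}))) :=
    tendsto_measure_iUnion_atTop fun a b hab z hz => ⟨hz.1, hQmono _ hab hz.2⟩
  have h3 : ⋃ m, {z | x * z ∈ B ∩ Q s.length m} = {z | x * z ∈ B} := by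
    ext z
    have := Set.eq_univ_iff_forall.1 (hQuniv s.length) (x * z)
    simp only [Set.mem_iUnion] at this ⊢
    exact ⟨fun ⟨m, hm⟩ => hm.1, fun hz => this.imp fun m hm => ⟨hz, hm⟩⟩
  rw [h3] at h2
  exact (h2.eventually (lt_mem_nhds h1)).exists

end Tree

/-! ### The abstract theorem and its application -/

section Main

variable {G : Type*} [Group G] [MetricSpace G] [IsTopologicalGroup G]
  [SecondCountableTopology G] [MeasurableSpace G] [BorelSpace G]

/-- Left translations by elements close to `1` move most points very little. -/
lemma exists_isOpen_measure_le_dist_mul_le (μ : Measure G) [IsProbabilityMeasure μ] {c : ℝ}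
    (hc : 0 < c) {e : ENNReal} (he : 0 < e) :
    ∃ U : Set G, IsOpen U ∧ 1 ∈ U ∧ ∀ h ∈ U, μ {z | c ≤ dist (h * z) z} ≤ e := by
  have hm : ∀ h : G, MeasurableSet {z | c ≤ dist (h * z) z} := fun h =>
    measurableSet_le measurable_const ((measurable_const_mul h).dist measurable_id)
  have hlim : Tendsto (fun h : G => ∫⁻ z, {z | c ≤ dist (h * z) z}.indicator 1 z ∂μ) (𝓝 1)
      (𝓝 (∫⁻ _, 0 ∂μ)) := by
    refine tendsto_lintegral_filter_of_dominated_convergence (fun _ => 1)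
      (Eventually.of_forall fun h => measurable_one.indicator (hm h))
      (Eventually.of_forall fun h => Eventually.of_forall fun z =>
        Set.indicator_le_self' (fun _ _ => zero_le) z) (by simp)
      -- For fixed z, h * z → z; no uniformity in z is needed, since dominated convergence suffices.
      (Eventually.of_forall fun z => ?_)
    have h1 : Tendsto (fun h : G => dist (h * z) z) (𝓝 1) (𝓝 0) := by
      have : Continuous fun h : G => dist (h * z) z := by fun_prop
      simpa using this.tendsto 1
    refine tendsto_const_nhds.congr' ?_
    filter_upwards [h1.eventually (gt_mem_nhds hc)] with h hh
    rw [Set.indicator_of_notMem]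
    exact fun h' => (not_le.2 hh) h'
  rw [lintegral_zero] at hlim
  obtain ⟨U, hU, hUo, h1⟩ := mem_nhds_iff.1 (hlim.eventually (gt_mem_nhds he))
  refine ⟨U, hUo, h1, fun h hh => ?_⟩
  have := hU hh
  rw [Set.mem_ofPred_eq, lintegral_indicator_one (hm h)] at this
  exact this.le

/-- Split according to whether the left factor lies in the neighbourhood U of 1: inside U
displacement is unlikely, and the outside has vanishing mass. This gives the summable bounds needed
for convergence. -/
lemma eventually_prod_measure_le {η : ℕ → Measure G} [∀ j, IsProbabilityMeasure (η j)]
    (hη : ∀ U : Set G, IsOpen U → 1 ∈ U → Tendsto (fun j => η j U) atTop (𝓝 1))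
    (μ : Measure G) [IsProbabilityMeasure μ] {c : ℝ} (hc : 0 < c) {e : ENNReal} (he : 0 < e) :
    ∀ᶠ j in atTop, ((η j).prod μ) {p | c ≤ dist (p.1 * p.2) p.2} ≤ e := by
  obtain ⟨U, hUo, h1, hU⟩ := exists_isOpen_measure_le_dist_mul_le μ hc (ENNReal.half_pos he.ne')
  have hcompl : Tendsto (fun j => η j Uᶜ) atTop (𝓝 0) := by
    have := ENNReal.Tendsto.sub (tendsto_const_nhds (x := (1 : ENNReal)) (f := atTop))
      (hη U hUo h1) (Or.inl ENNReal.one_ne_top)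
    rw [tsub_self] at this
    exact this.congr fun j => (prob_compl_eq_one_sub hUo.measurableSet).symm
  filter_upwards [hcompl.eventually (gt_mem_nhds (ENNReal.half_pos he.ne'))] with j hj
  have hm : MeasurableSet {p : G × G | c ≤ dist (p.1 * p.2) p.2} :=
    measurableSet_le measurable_const ((measurable_fst.mul measurable_snd).dist measurable_snd)
  rw [Measure.prod_apply hm, ← lintegral_add_compl _ hUo.measurableSet, ← ENNReal.add_halves e]
  refine add_le_add ?_ ?_
  · calc _ ≤ ∫⁻ _ in U, e / 2 ∂(η j) := setLIntegral_mono' hUo.measurableSet fun h hh => hU h hh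
      _ = e / 2 * η j U := setLIntegral_const _ _
      _ ≤ e / 2 := mul_le_of_le_one_right' prob_le_one
  · calc _ ≤ ∫⁻ _ in Uᶜ, 1 ∂(η j) := lintegral_mono fun h => prob_le_one
      _ = η j Uᶜ := by rw [setLIntegral_const, one_mul]
      _ ≤ e / 2 := hj.le

/-- The abstract core of the main theorem: a Borel set outside a σ-ideal `I` is charged by a limit
of convolutions, provided that `I`-almost every point of a Borel set `A` sees `A` with almost full
measure through `η n j`, as `j → ∞`. -/
theorem exists_weaklyConverges_pos [CompleteSpace G] {η : ℕ → ℕ → Measure G}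
    [∀ n j, IsProbabilityMeasure (η n j)] {I : Set (Set G)}
    (hI : ∀ F : ℕ → Set G, (∀ n, F n ∈ I) → ⋃ n, F n ∈ I)
    (hIsub : ∀ F ∈ I, ∀ F' ⊆ F, MeasurableSet F' → F' ∈ I)
    (hη : ∀ n, ∀ U : Set G, IsOpen U → 1 ∈ U → Tendsto (fun j => η n j U) atTop (𝓝 1))
    (hdens : ∀ n, ∀ A : Set G, MeasurableSet A → ∃ Z ∈ I, ∀ x ∈ A, x ∉ Z →
      Tendsto (fun j => η n j {h | x * h ∈ A}) atTop (𝓝 1))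
    {E : Set G} (hE : MeasurableSet E) (hEI : E ∉ I) :
    ∃ x ∈ E, ∃ (j : ℕ → ℕ) (ν : Measure G),
      WeaklyConverges (iterConv fun k => η k (j k)) ν ∧ 0 < (ν.map fun g => x * g) E := by
  obtain ⟨Q, hQ, hQmono, hQuniv, hQE⟩ := exists_compact_scheme hE
  -- Exceptional sets are fixed for every node before x is chosen; the node set is countable, so a
  -- single x avoids them all.
  choose Z hZI hZ using fun s => hdens s.length (treeGood η Q E s) (measurableSet_treeGood hQ hE s)
  obtain ⟨x, hxE, hxZ⟩ : ∃ x ∈ E, ∀ s, x ∉ Z s := by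
    by_contra! hcon
    obtain ⟨f, hf⟩ := exists_surjective_nat (List (ℕ × ℕ))
    refine hEI (hIsub _ (hI (fun n => Z (f n)) fun n => hZI _) E (fun x hx => ?_) hE)
    obtain ⟨s, hs⟩ := hcon x hx
    obtain ⟨n, rfl⟩ := hf s
    exact Set.mem_iUnion.2 ⟨n, hs⟩
  have hstep : ∀ s : {s // x ∈ treeGood η Q E s}, ∃ p : ℕ × ℕ, x ∈ treeGood η Q E (p :: s.1) ∧
      ((η s.1.length p.1).prod (treeMeasure η s.1))
        {p | (1 / 2 : ℝ) ^ s.1.length ≤ dist (p.1 * p.2) p.2} ≤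
        ENNReal.ofReal ((1 / 2) ^ s.1.length) := fun s => by
    obtain ⟨j, ⟨m, hm⟩, hj⟩ := ((eventually_exists_mem_treeGood hQ hQmono hQuniv hE
      (hZ s.1 x s.2 (hxZ s.1))).and (eventually_prod_measure_le (hη s.1.length)
      (treeMeasure η s.1) (show (0 : ℝ) < (1 / 2) ^ s.1.length by positivity)
      (ENNReal.ofReal_pos.2 (show (0 : ℝ) < (1 / 2) ^ s.1.length by positivity)))).exists
    exact ⟨(j, m), hm, hj⟩
  choose p hp hsmall using hstep
  let b : ℕ → {s // x ∈ treeGood η Q E s} := fun n =>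
    Nat.rec ⟨[], (treeGood_nil hE).symm ▸ hxE⟩ (fun _ s => ⟨p s :: s.1, hp s⟩) n
  have hlen : ∀ n, (b n).1.length = n := fun n => by
    induction n with
    | zero => rfl
    | succ n ih =>
      change (p (b n) :: (b n).1).length = n + 1
      rw [List.length_cons, ih]
  have hμ : ∀ n, treeMeasure η (b n).1 = leftConv (fun k => η k (p (b k)).1) n := fun n => by
    induction n with
    | zero => rfl
    | succ n ih =>
      change (η (b n).1.length (p (b n)).1).mconv (treeMeasure η (b n).1) = _
      rw [ih, hlen]
      rfl
  have hB : ∀ n, treeSet Q E (b n).1 = E ∩ ⋂ l, ⋂ (_ : l < n), Q l (p (b l)).2 := fun n => by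
    induction n with
    | zero => simp [b, treeSet]
    | succ n ih =>
      change treeSet Q E (b n).1 ∩ Q (b n).1.length (p (b n)).2 = _
      rw [ih, hlen, Set.inter_assoc]
      congr 1
      ext y
      simp only [Set.mem_inter_iff, Set.mem_iInter, Nat.lt_succ_iff_lt_or_eq]
      exact ⟨fun h l hl => hl.elim (h.1 l) (fun hl => hl ▸ h.2),
        fun h => ⟨fun l hl => h l (Or.inl hl), h n (Or.inr rfl)⟩⟩
  obtain ⟨ν, hν⟩ := exists_weaklyConverges_iterConv (η := fun k => η k (p (b k)).1) fun n => by
    have := hsmall (b n)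
    rwa [hμ, hlen] at this
  refine ⟨x, hxE, fun k => (p (b k)).1, ν, hν, ?_⟩
  have := hν.2.1
  set F : ℕ → Set G := fun N =>
    {z | x * z ∈ closure (E ∩ ⋂ l, ⋂ (_ : l < N), Q l (p (b l)).2)} with hF
  have hFc : ∀ N, IsClosed (F N) := fun N =>
    isClosed_closure.preimage (continuous_const_mul x)
  have hFanti : Antitone F := fun N M hNM z hz => by
    refine closure_mono (Set.inter_subset_inter_right _ ?_) hz
    exact Set.iInter_mono fun l => Set.iInter_mono' fun hl => ⟨hl.trans_le hNM, le_rfl⟩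
  -- All levels exceed 1/2, and the convolution indexed by n has n + 1 factors, so it belongs to the
  -- node of length n + 1.
  have hFν : ∀ N, ENNReal.ofReal (1 / 2) ≤ ν (F N) := fun N => by
    refine hν.le_measure_of_isClosed (hFc N) (eventually_atTop.2 ⟨N, fun n hn => ?_⟩)
    have h1 : level (b (n + 1)).1.length <
        treeMeasure η (b (n + 1)).1 {z | x * z ∈ treeSet Q E (b (n + 1)).1} := (b (n + 1)).2
    rw [hμ (n + 1), hB (n + 1)] at h1
    rw [iterConv_eq_leftConv]
    refine (half_le_level _).trans (h1.le.trans (measure_mono fun z hz => ?_))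
    exact hFanti (show N ≤ n + 1 by omega) (subset_closure hz)
  have hFi : ENNReal.ofReal (1 / 2) ≤ ν (⋂ N, F N) :=
    ge_of_tendsto' (tendsto_measure_iInter_atTop (fun N => (hFc N).measurableSet.nullMeasurableSet)
      hFanti ⟨0, measure_ne_top _ _⟩) hFν
  rw [Measure.map_apply (measurable_const_mul x) hE]
  refine lt_of_lt_of_le (ENNReal.ofReal_pos.2 (by norm_num)) (hFi.trans (measure_mono fun z hz => ?_))
  refine hQE (fun l => (p (b l)).2) (Set.mem_iInter.2 fun N => ?_)
  exact Set.mem_iInter.1 hz N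

/-- The identity is a density point of each of its Borel neighbourhoods. -/
lemma isDensityPointOne_of_mem_nhds {H : Type*} [Group H] [MetricSpace H] [IsTopologicalGroup H]
    [ProperSpace H] [MeasurableSpace H] [BorelSpace H] {U : Set H} (hU : U ∈ 𝓝 1) :
    IsDensityPointOne U := by
  refine ⟨Measure.haar, inferInstance, ?_⟩
  obtain ⟨r₀, hr₀, hball⟩ := Metric.mem_nhds_iff.1 hU
  refine tendsto_const_nhds.congr' ?_
  filter_upwards [Ioo_mem_nhdsGT hr₀] with r hr
  rw [Set.inter_eq_self_of_subset_right ((Metric.ball_subset_ball hr.2.le).trans hball),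
    ENNReal.div_self (Metric.measure_ball_pos _ _ hr.1).ne' measure_ball_lt_top.ne]

end Main

end CarnotNull

theorem mainTheorem5 {G : Type*} [Group G] [MetricSpace G] [IsTopologicalGroup G]
    [MeasurableSpace G] [BorelSpace G] (δ : ℝ → G → G)
    (hG : CarnotNull.IsInfDimCarnotGroup δ)
    (X : ℕ → G) (hX : CarnotNull.IsCarnotSpanning δ X)
    (ν : (k : ℕ) → ℝ → MeasureTheory.Measure (CarnotNull.assocFiltration δ X k))
    (hAC : ∀ k, ∀ ε : ℝ, 0 < ε → CarnotNull.IsAC (ν k ε))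
    (hconc : ∀ k, CarnotNull.ConcentratesAtOne (ν k))
    (E : Set G) (hE : MeasurableSet E) (hEA : E ∉ CarnotNull.aronszajnClass δ X) :
    ∃ x ∈ E, ∃ ε : ℕ → ℝ, (∀ k, 0 < ε k) ∧
      ∃ ν' : MeasureTheory.Measure G,
        CarnotNull.WeaklyConverges
          (CarnotNull.iterConv fun k => CarnotNull.toAmbient (ν k (ε k))) ν' ∧
        0 < (ν'.map fun g => x * g) E := by
  have hδ := hG.toIsMetricScalableGroup
  have hcomplete := hG.complete
  have hsc := hG.secondCountableTopology
  have hproper : ∀ k, ProperSpace (CarnotNull.assocFiltration δ X k) := fun k =>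
    hδ.properSpace_of_isCarnotSubgroup (hX.2.isCarnotSubgroup k)
  -- A sequence of parameters tending to 0 replaces the continuum of ε, which makes the tree of
  -- choices countable.
  let η : ℕ → ℕ → Measure G := fun k j => CarnotNull.toAmbient (ν k (1 / ((j : ℝ) + 1)))
  have hη : ∀ k j, IsProbabilityMeasure (η k j) := fun k j => by
    have := (hAC k (1 / ((j : ℝ) + 1)) (by positivity)).1
    exact Measure.isProbabilityMeasure_map measurable_subtype_coe.aemeasurable
  have hlim : Tendsto (fun j : ℕ => 1 / ((j : ℝ) + 1)) atTop (𝓝[>] 0) :=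
    tendsto_nhdsWithin_iff.2 ⟨tendsto_one_div_add_atTop_nhds_zero_nat,
      Eventually.of_forall fun j => Set.mem_Ioi.2 (by positivity)⟩
  have hηlim : ∀ k, ∀ U : Set G, MeasurableSet U →
      CarnotNull.IsDensityPointOne {h : CarnotNull.assocFiltration δ X k | (h : G) ∈ U} →
      Tendsto (fun j => η k j U) atTop (𝓝 1) := fun k U hU hd => by
    refine ((hconc k _ (measurable_subtype_coe hU) hd).comp hlim).congr fun j => ?_
    exact (Measure.map_apply measurable_subtype_coe hU).symm
  have hdens : ∀ k, ∀ A : Set G, MeasurableSet A → ∃ Z ∈ CarnotNull.aronszajnClass δ X,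
      ∀ x ∈ A, x ∉ Z → Tendsto (fun j => η k j {h | x * h ∈ A}) atTop (𝓝 1) := fun k A hA => by
    obtain ⟨Z, hZm, hZ0, hZ⟩ := hδ.exists_measurableSet_not_isDensityPointOne
      (hX.2.isCarnotSubgroup k) Measure.haar hA
    exact ⟨Z, CarnotNull.mem_aronszajnClass_of_haar_null hδ hX.1 k (hX.2.isCarnotSubgroup k)
      Measure.haar hZm hZ0, fun x hxA hxZ => hηlim k _ (measurable_const_mul x hA) (hZ x hxA hxZ)⟩
  obtain ⟨x, hx, j, ν', hν', hpos⟩ := CarnotNull.exists_weaklyConverges_pos (η := η)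
    (fun F hF => CarnotNull.aronszajnClass_iUnion hF)
    (fun F hF F' hsub hm => CarnotNull.aronszajnClass_mono hF hsub hm)
    (fun k U hU h1 => hηlim k U hU.measurableSet (CarnotNull.isDensityPointOne_of_mem_nhds
      ((hU.preimage continuous_subtype_val).mem_nhds h1))) hdens hE hEA
  exact ⟨x, hx, fun k => 1 / ((j k : ℝ) + 1), fun k => by positivity, ν', hν', hpos⟩
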